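/- Let $\mathbb{L}^{n+2}$ be $\mathbb{R}^{n+2}$ with the metric $-dx_1^2+dx_2^2+\dots+dx_{n+2}^2$, and write $\mathbb{H}^n=\{-x_1^2+x_2^2+\dots+x_{n+1}^2=-1,\ x_1>0\}$ and $\mathbb{H}^n\times\mathbb{R}\subset\mathbb{L}^{n+1}\times\mathbb{R}=\mathbb{L}^{n+2}$; let $\partial_i=\partial/\partial x_i$. Let $P^3\subset\mathbb{L}^{n+2}$ be a three-dimensional subspace containing $\partial_1$ and $\partial_{n+2}$, let $P^2\subset P^3$ be a two-dimensional subspace containing $\partial_{n+2}$, and let $\alpha\colon I\to(\mathbb{H}^n\times\mathbb{R})\cap P^3$ be a smooth curve, parametrized by arc length on an interval $I$, that lies in one of the two closed half-spaces of $P^3$ determined by $P^2$. The orbit of $\alpha$ under the group of linear isometries of $\mathbb{L}^{n+2}$ that leave $\mathbb{H}^n\times\mathbb{R}$ invariant and fix $P^2$ pointwise is called a rotation hypersurface with axis $P^2$; it is of spherical, hyperbolic or parabolic type according as $P^2$ is Lorentzian, Riemannian or degenerate. For functions $k,h$ of $s$, consider the parametrizations (S) $(\cosh k(s),\ \sinh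 k(s)\,\varphi_1,\dots,\sinh k(s)\,\varphi_n,\ h(s))$, with $\varphi\in\mathbb{S}^{n-1}\subset\mathbb{R}^n$; (H) $(\cosh k(s)\,\varphi_1,\dots,\cosh k(s)\,\varphi_n,\ \sinh k(s),\ h(s))$, with $\varphi\in\mathbb{H}^{n-1}\subset\mathbb{L}^n$; (P) $k(s)\,e_1+\sum_{j=2}^n k(s)t_j\,\partial_j-\Big(\frac{1}{2k(s)}+\frac{k(s)}{2}\sum_{j=2}^n t_j^2\Big)e_{n+1}+h(s)\,\partial_{n+2}$, with $t\in\mathbb{R}^{n-1}$, $e_1=\frac{1}{\sqrt2}(\partial_1-\partial_{n+1})$, $e_{n+1}=-\frac{1}{\sqrt2}(\partial_1+\partial_{n+1})$, where $s$ runs over $\mathbb{R}$. **Theorem.** Let $n\ge 3$ and let $f\colon M^n\to\mathbb{H}^n\times\mathbb{R}$ be a smooth immersion of a smooth manifold whose image $f(M^n)$ is a rotation hypersurface (of any type), and suppose that the metric induced by $f$ has constant sectional curvature $c$. Then $c\ge -1$. Moreover, up to isometries of $\mathbb{H}^n\times\mathbb{R}$: (i) if $c=-1$, then $f(M^n)$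 is an open subset of a slice $\mathbb{H}^n\times\{t\}$; (ii) if $c\in(-1,0)$, then one of the following holds: (a) $f(M^n)$ is an open subset of a complete rotation hypersurface of spherical type that is parametrized by (S) with $$k(s)=\operatorname{arcsinh}\Big(\tfrac{1}{\sqrt{-c}}\sinh(\sqrt{-c}\,s)\Big),\qquad h(s)=\sqrt{\tfrac{c+1}{-c}}\,\ln\Big(\tfrac{\cosh(\sqrt{-c}\,s)+\sqrt{-c+\sinh^2(\sqrt{-c}\,s)}}{1+\sqrt{-c}}\Big);$$ (b) $f(M^n)$ is an open subset of a complete rotation hypersurface of hyperbolic type that is parametrized by (H) with $$k(s)=\operatorname{arccosh}\Big(\tfrac{1}{\sqrt{-c}}\cosh(\sqrt{-c}\,s)\Big),\qquad h(s)=\sqrt{\tfrac{c+1}{-c}}\,\ln\Big(\sinh(\sqrt{-c}\,s)+\sqrt{c+\cosh^2(\sqrt{-c}\,s)}\Big);$$ (c) $f(M^n)$ is an open subset of a complete rotation hypersurface of parabolic type that is parametrized by (P) with $$k(s)=\exp(\sqrt{-c}\,s),\qquad h(s)=\sqrt{1+c}\,s;$$ (iii) if $c=0$, then one of the following holds: (a)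 $f(M^n)$ is an open subset of a complete rotation hypersurface of spherical type that is parametrized by (S) with $$k(s)=\operatorname{arcsinh}(s),\qquad h(s)=-1+\sqrt{1+s^2};$$ (b) $f(M^n)$ is an open subset of a Riemannian product $M^{n-1}\times\mathbb{R}$, where $M^{n-1}$ is a horosphere of $\mathbb{H}^n$; (iv) if $c>0$, then $f(M^n)$ is an open subset of a complete rotation hypersurface of spherical type that is parametrized by (S) with $$k(s)=\operatorname{arcsinh}\Big(\tfrac{1}{\sqrt{c}}\sin(\sqrt{c}\,s)\Big),\qquad h(s)=-\sqrt{\tfrac{c+1}{c}}\,\arctan\Big(\tfrac{\cos(\sqrt{c}\,s)}{\sqrt{c+\sin^2(\sqrt{c}\,s)}}\Big).$$ -/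

import Mathlib

open Set Filter
open scoped Topology ContDiff Manifold

noncomputable section

/-! ### Lorentzian space and `ℍⁿ × ℝ` -/

/-- The Lorentzian inner product `-x₁y₁ + x₂y₂ + ⋯ + x_N y_N` on `ℝᴺ`
(coordinates are indexed from `0` here). -/
def mink {N : ℕ} (x y : Fin N → ℝ) : ℝ :=
  ∑ i : Fin N, (if (i : ℕ) = 0 then -1 else 1) * (x i * y i)

/-- The hyperbolic space `{x ∈ 𝕃ᴺ : ⟨x, x⟩ = -1, x₁ > 0}`, of dimension `N - 1`. -/
def hypSpace (N : ℕ) : Set (Fin N → ℝ) :=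
  {x | mink x x = -1 ∧ ∀ i : Fin N, (i : ℕ) = 0 → 0 < x i}

/-- `ℍⁿ × ℝ ⊆ 𝕃ⁿ⁺¹ × ℝ = 𝕃ⁿ⁺²`. -/
def hypProd (n : ℕ) : Set (Fin (n + 2) → ℝ) :=
  {x | (Fin.init x : Fin (n + 1) → ℝ) ∈ hypSpace (n + 1)}

/-- The coordinate vector `∂/∂x_{i+1}` of `𝕃ⁿ⁺²`. -/
def coordVec (n : ℕ) (i : Fin (n + 2)) : Fin (n + 2) → ℝ := Pi.single i 1

/-- The unit vector `∂/∂x_{n+2}` spanning the factor `ℝ`. -/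
def vertVec (n : ℕ) : Fin (n + 2) → ℝ := coordVec n (Fin.last (n + 1))

/-- The linear isometries of `𝕃ⁿ⁺²` that leave `ℍⁿ × ℝ` invariant. -/
def PreservesHypProd (n : ℕ) (g : (Fin (n + 2) → ℝ) ≃ₗ[ℝ] (Fin (n + 2) → ℝ)) : Prop :=
  (∀ x y, mink (g x) (g y) = mink x y) ∧ g '' hypProd n = hypProd n

/-- The isometries of `ℍⁿ × ℝ`: a linear Lorentzian isometry leaving `ℍⁿ × ℝ` invariant
(that is, an isometry of `ℍⁿ` times `± 1` on `ℝ`), followed by a vertical translation. -/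
def IsHypProdIsometry (n : ℕ) (Φ : (Fin (n + 2) → ℝ) → (Fin (n + 2) → ℝ)) : Prop :=
  ∃ (g : (Fin (n + 2) → ℝ) ≃ₗ[ℝ] (Fin (n + 2) → ℝ)) (b : ℝ),
    PreservesHypProd n g ∧ ∀ x, Φ x = g x + b • vertVec n

/-- `A` is an open subset of `S`, for the topology that `S` inherits. -/
def IsOpenPiece {n : ℕ} (A S : Set (Fin (n + 2) → ℝ)) : Prop :=
  ∃ V : Set (Fin (n + 2) → ℝ), IsOpen V ∧ A = S ∩ V

/-- Up to an isometry of `ℍⁿ × ℝ`, `A` is an open subset of `S`. -/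
def IsCongruentToOpenPiece (n : ℕ) (A S : Set (Fin (n + 2) → ℝ)) : Prop :=
  ∃ Φ, IsHypProdIsometry n Φ ∧ IsOpenPiece (Φ '' A) S

/-! ### Sectional curvature of a Riemannian metric in coordinates -/

section Curvature

variable {n : ℕ}

/-- The partial derivative `∂_i a` of a function on (an open subset of) `ℝⁿ`. -/
def pd {F : Type} [NormedAddCommGroup F] [NormedSpace ℝ F]
    (i : Fin n) (a : EuclideanSpace ℝ (Fin n) → F) (u : EuclideanSpace ℝ (Fin n)) : F :=
  fderiv ℝ a u (EuclideanSpace.single i 1)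

/-- The Christoffel symbol `Γˡᵢⱼ` of the metric `(g_{ij})`. -/
def christoffel (G : EuclideanSpace ℝ (Fin n) → Matrix (Fin n) (Fin n) ℝ)
    (l i j : Fin n) (u : EuclideanSpace ℝ (Fin n)) : ℝ :=
  (1 / 2) * ∑ m, (G u)⁻¹ l m *
    (pd i (fun v => G v j m) u + pd j (fun v => G v i m) u - pd m (fun v => G v i j) u)

/-- The components of the curvature tensor: `R(∂_i, ∂_j) ∂_k = ∑ₗ Rˡₖᵢⱼ ∂_l`, where
`R(X, Y) Z = ∇_X ∇_Y Z - ∇_Y ∇_X Z - ∇_[X,Y] Z`. -/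
def curvTensor (G : EuclideanSpace ℝ (Fin n) → Matrix (Fin n) (Fin n) ℝ)
    (l k i j : Fin n) (u : EuclideanSpace ℝ (Fin n)) : ℝ :=
  pd i (christoffel G l j k) u - pd j (christoffel G l i k) u
    + ∑ m, (christoffel G m j k u * christoffel G l i m u
      - christoffel G m i k u * christoffel G l j m u)

/-- The inner product `⟨X, Y⟩` of two tangent vectors at `u`. -/
def metricAt (G : EuclideanSpace ℝ (Fin n) → Matrix (Fin n) (Fin n) ℝ)
    (u : EuclideanSpace ℝ (Fin n)) (X Y : Fin n → ℝ) : ℝ :=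
  ∑ i, ∑ j, G u i j * (X i * Y j)

/-- `⟨R(X, Y) Y, X⟩` at `u`. -/
def curvForm (G : EuclideanSpace ℝ (Fin n) → Matrix (Fin n) (Fin n) ℝ)
    (u : EuclideanSpace ℝ (Fin n)) (X Y : Fin n → ℝ) : ℝ :=
  ∑ i, ∑ j, ∑ k, ∑ l, ∑ q, curvTensor G l k i j u * X i * Y j * Y k * (G u l q * X q)

/-- All the sectional curvatures of the metric `G` at `u` are equal to `c`. -/
def HasSectionalCurvatureAt (G : EuclideanSpace ℝ (Fin n) → Matrix (Fin n) (Fin n) ℝ)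
    (c : ℝ) (u : EuclideanSpace ℝ (Fin n)) : Prop :=
  ∀ X Y : Fin n → ℝ, LinearIndependent ℝ ![X, Y] →
    curvForm G u X Y
      / (metricAt G u X X * metricAt G u Y Y - metricAt G u X Y ^ 2) = c

/-- The first fundamental form `g_{ij} = ⟨∂_i F, ∂_j F⟩` of a map into `𝕃ⁿ⁺²`. -/
def inducedMetric (F : EuclideanSpace ℝ (Fin n) → (Fin (n + 2) → ℝ))
    (u : EuclideanSpace ℝ (Fin n)) : Matrix (Fin n) (Fin n) ℝ :=
  Matrix.of fun i j => mink (pd i F u) (pd j F u)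

end Curvature

/-- `f : Mⁿ → ℍⁿ × ℝ` is a hypersurface: a smooth immersion with values in `ℍⁿ × ℝ`. -/
def IsHypersurface {n : ℕ} {M : Type*} [TopologicalSpace M]
    [ChartedSpace (EuclideanSpace ℝ (Fin n)) M] (f : M → (Fin (n + 2) → ℝ)) : Prop :=
  ContMDiff 𝓘(ℝ, EuclideanSpace ℝ (Fin n)) 𝓘(ℝ, Fin (n + 2) → ℝ) ∞ f ∧
  (∀ p, Function.Injective
    (mfderiv 𝓘(ℝ, EuclideanSpace ℝ (Fin n)) 𝓘(ℝ, Fin (n + 2) → ℝ) f p)) ∧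
  ∀ p, f p ∈ hypProd n

/-- The metric induced by `f` on `Mⁿ` has constant sectional curvature `c`
(computed in all the charts of the smooth structure). -/
def HasConstSectionalCurvature {n : ℕ} {M : Type*} [TopologicalSpace M]
    [ChartedSpace (EuclideanSpace ℝ (Fin n)) M] (f : M → (Fin (n + 2) → ℝ)) (c : ℝ) : Prop :=
  ∀ e ∈ IsManifold.maximalAtlas 𝓘(ℝ, EuclideanSpace ℝ (Fin n)) ∞ M, ∀ u ∈ e.target,
    HasSectionalCurvatureAt (inducedMetric (f ∘ e.symm)) c u

/-! ### Rotation hypersurfaces -/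

/-- The three types of rotation hypersurfaces of `ℍⁿ × ℝ`. -/
inductive RotationType
  | spherical
  | hyperbolic
  | parabolic

/-- The axis `P²` is Lorentzian, Riemannian or degenerate, respectively. -/
def RotationType.Axis {n : ℕ} (τ : RotationType) (P2 : Submodule ℝ (Fin (n + 2) → ℝ)) : Prop :=
  match τ with
  | .spherical => ∃ v ∈ P2, mink v v < 0
  | .hyperbolic => ∀ v ∈ P2, v ≠ 0 → 0 < mink v v
  | .parabolic => ∃ v ∈ P2, v ≠ 0 ∧ ∀ w ∈ P2, mink v w = 0

/-- `P³` is a three-dimensional subspace containing `∂/∂x₁` and `∂/∂x_{n+2}`, and `P² ⊆ P³` is a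
two-dimensional subspace containing `∂/∂x_{n+2}`. -/
def IsAxisPair (n : ℕ) (P2 P3 : Submodule ℝ (Fin (n + 2) → ℝ)) : Prop :=
  Module.finrank ℝ P3 = 3 ∧ coordVec n 0 ∈ P3 ∧ vertVec n ∈ P3 ∧
  Module.finrank ℝ P2 = 2 ∧ P2 ≤ P3 ∧ vertVec n ∈ P2

/-- `α : I → (ℍⁿ × ℝ) ∩ P³` is a smooth curve, parametrized by arc length on an interval `I`, that
lies in one of the two closed half-spaces of `P³` determined by `P²`. -/
def IsProfileCurve (n : ℕ) (P2 P3 : Submodule ℝ (Fin (n + 2) → ℝ)) (I : Set ℝ)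
    (α : ℝ → (Fin (n + 2) → ℝ)) : Prop :=
  I.OrdConnected ∧ (interior I).Nonempty ∧ ContDiffOn ℝ ∞ α I ∧
  (∀ s ∈ I, α s ∈ hypProd n ∧ α s ∈ P3) ∧
  (∀ s ∈ I, mink (derivWithin α I s) (derivWithin α I s) = 1) ∧
  ∃ ℓ : (Fin (n + 2) → ℝ) →ₗ[ℝ] ℝ,
    (∀ x ∈ P2, ℓ x = 0) ∧ (∃ x ∈ P3, ℓ x ≠ 0) ∧ ∀ s ∈ I, 0 ≤ ℓ (α s)

/-- The orbit of the curve `α` under the group of the isometries (leaving `ℍⁿ × ℝ` invariant)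
that fix `P²` pointwise. -/
def rotationOrbit (n : ℕ) (P2 : Submodule ℝ (Fin (n + 2) → ℝ)) (I : Set ℝ)
    (α : ℝ → (Fin (n + 2) → ℝ)) : Set (Fin (n + 2) → ℝ) :=
  {x | ∃ g : (Fin (n + 2) → ℝ) ≃ₗ[ℝ] (Fin (n + 2) → ℝ),
    PreservesHypProd n g ∧ (∀ y ∈ P2, g y = y) ∧ ∃ s ∈ I, x = g (α s)}

/-- `R` is a rotation hypersurface of type `τ`: the orbit of some profile curve, for some axis of
type `τ`. -/
def IsRotationHypersurface (n : ℕ) (τ : RotationType) (R : Set (Fin (n + 2) → ℝ)) : Prop :=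
  ∃ (P2 P3 : Submodule ℝ (Fin (n + 2) → ℝ)) (I : Set ℝ) (α : ℝ → (Fin (n + 2) → ℝ)),
    IsAxisPair n P2 P3 ∧ τ.Axis P2 ∧ IsProfileCurve n P2 P3 I α ∧ R = rotationOrbit n P2 I α

/-! ### The explicit parametrizations -/

/-- The set of the points `(cosh k(s), sinh k(s) φ₁, …, sinh k(s) φₙ, h(s))`, where `s ∈ ℝ` and
`φ ∈ 𝕊ⁿ⁻¹ ⊆ ℝⁿ`. -/
def sphericalSet (n : ℕ) (k h : ℝ → ℝ) : Set (Fin (n + 2) → ℝ) :=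
  {x | ∃ (s : ℝ) (φ : Fin n → ℝ), ∑ i, φ i ^ 2 = 1 ∧
    x = Real.cosh (k s) • coordVec n 0
      + ∑ i : Fin n, (Real.sinh (k s) * φ i) • coordVec n i.castSucc.succ
      + h s • vertVec n}

/-- The set of the points `(cosh k(s) φ₁, …, cosh k(s) φₙ, sinh k(s), h(s))`, where `s ∈ ℝ` and
`φ ∈ ℍⁿ⁻¹ ⊆ 𝕃ⁿ`. -/
def hyperbolicSet (n : ℕ) (k h : ℝ → ℝ) : Set (Fin (n + 2) → ℝ) :=
  {x | ∃ (s : ℝ) (φ : Fin n → ℝ), φ ∈ hypSpace n ∧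
    x = ∑ i : Fin n, (Real.cosh (k s) * φ i) • coordVec n i.castSucc.castSucc
      + Real.sinh (k s) • coordVec n (Fin.last n).castSucc
      + h s • vertVec n}

/-- The null vector `e₁ = (∂/∂x₁ - ∂/∂x_{n+1}) / √2`. -/
def nullVecOne (n : ℕ) : Fin (n + 2) → ℝ :=
  (1 / √2) • (coordVec n 0 - coordVec n (Fin.last n).castSucc)

/-- The null vector `e_{n+1} = -(∂/∂x₁ + ∂/∂x_{n+1}) / √2`; it satisfies `⟨e₁, e_{n+1}⟩ = 1`. -/
def nullVecTwo (n : ℕ) : Fin (n + 2) → ℝ :=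
  -(1 / √2) • (coordVec n 0 + coordVec n (Fin.last n).castSucc)

/-- The set of the points `k e₁ + ∑ k tⱼ eⱼ - (1/(2k) + (k/2) ∑ tⱼ²) e_{n+1} + h e_{n+2}`, where
`j = 2, …, n`, `k = k(s)`, `h = h(s)`, `s ∈ ℝ` and `t ∈ ℝⁿ⁻¹`. -/
def parabolicSet (n : ℕ) (k h : ℝ → ℝ) : Set (Fin (n + 2) → ℝ) :=
  {x | ∃ (s : ℝ) (t : Fin (n - 1) → ℝ),
    x = k s • nullVecOne n
      + ∑ j : Fin (n - 1), (k s * t j) • coordVec n ⟨(j : ℕ) + 1, by omega⟩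
      + (-(1 / (2 * k s)) - k s / 2 * ∑ j, t j ^ 2) • nullVecTwo n
      + h s • vertVec n}

/-- The slice `ℍⁿ × {t}`. -/
def hypSlice (n : ℕ) (t : ℝ) : Set (Fin (n + 2) → ℝ) :=
  {x | x ∈ hypProd n ∧ x (Fin.last (n + 1)) = t}

/-- `H` is a horosphere of `ℍⁿ`: a nonempty intersection of `ℍⁿ` with an affine hyperplane
`⟨x, v⟩ = a`, where `v ≠ 0` is light-like. -/
def IsHorosphere (n : ℕ) (H : Set (Fin (n + 1) → ℝ)) : Prop :=
  H.Nonempty ∧ ∃ (v : Fin (n + 1) → ℝ) (a : ℝ), v ≠ 0 ∧ mink v v = 0 ∧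
    H = {x | x ∈ hypSpace (n + 1) ∧ mink x v = a}

/-- The product `H × ℝ ⊆ ℍⁿ × ℝ` for `H ⊆ ℍⁿ`. -/
def cylinder (n : ℕ) (H : Set (Fin (n + 1) → ℝ)) : Set (Fin (n + 2) → ℝ) :=
  {x | (Fin.init x : Fin (n + 1) → ℝ) ∈ H}

/-! ### Complete hypersurfaces -/

/-- `S` is an embedded hypersurface of `ℍⁿ × ℝ`: near each of its points it is the image of a smooth
immersion of an open subset of `ℝⁿ` that is a homeomorphism onto an open subset of `S`. -/
def IsEmbeddedHypersurface (n : ℕ) (S : Set (Fin (n + 2) → ℝ)) : Prop :=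
  S ⊆ hypProd n ∧
  ∀ p ∈ S, ∃ (U : Set (EuclideanSpace ℝ (Fin n)))
      (F : EuclideanSpace ℝ (Fin n) → (Fin (n + 2) → ℝ)),
    IsOpen U ∧ p ∈ F '' U ∧ ContDiffOn ℝ ∞ F U ∧
    (∀ u ∈ U, Function.Injective (fderiv ℝ F u)) ∧ InjOn F U ∧
    ∀ W ⊆ U, IsOpen W → IsOpenPiece (F '' W) S

/-- There is a `C¹` curve in `S` from `x` to `y` of length smaller than `r`; for a hypersurface `S`
of `ℍⁿ × ℝ` this means that the distance from `x` to `y` in the induced Riemannian metric of `S` is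
smaller than `r`. -/
def JoinedWithin {n : ℕ} (S : Set (Fin (n + 2) → ℝ)) (x y : Fin (n + 2) → ℝ) (r : ℝ) : Prop :=
  ∃ γ : ℝ → (Fin (n + 2) → ℝ), ContDiffOn ℝ 1 γ (Icc 0 1) ∧ MapsTo γ (Icc 0 1) S ∧
    γ 0 = x ∧ γ 1 = y ∧
    ∫ t in (0 : ℝ)..1, √(mink (derivWithin γ (Icc 0 1) t) (derivWithin γ (Icc 0 1) t)) < r

/-- `S` is a complete embedded hypersurface of `ℍⁿ × ℝ`: the sequences of `S` that are Cauchy for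
the distance of the induced Riemannian metric converge in `S` (this distance induces the topology
of `S`). -/
def IsCompleteHypersurface (n : ℕ) (S : Set (Fin (n + 2) → ℝ)) : Prop :=
  IsEmbeddedHypersurface n S ∧
  ∀ u : ℕ → (Fin (n + 2) → ℝ), (∀ i, u i ∈ S) →
    (∀ ε > 0, ∃ N, ∀ i ≥ N, ∀ j ≥ N, JoinedWithin S (u i) (u j) ε) →
    ∃ x ∈ S, Tendsto u atTop (𝓝 x)

/-- `S` is a complete rotation hypersurface of type `τ` and, up to an isometry of `ℍⁿ × ℝ`, `A` is
an open subset of `S`. -/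
def IsPieceOfCompleteRotation (n : ℕ) (τ : RotationType) (A S : Set (Fin (n + 2) → ℝ)) : Prop :=
  IsRotationHypersurface n τ S ∧ IsCompleteHypersurface n S ∧ IsCongruentToOpenPiece n A S

end

/-!
A rotation hypersurface `R` of `ℍⁿ × ℝ` is determined by two functions of the points of `ℍⁿ × ℝ`,
the inner product `y` with a vector spanning the axis together with `∂/∂x_{n+2}`, and the height `h`:
by reflections of `𝕃ⁿ⁺²` the orbit of a point consists of all points with the same `y` and `h`
(`rotationOrbit_eq`). A Lorentzian isometry moves the axis into normal position, `-∂/∂x₁`,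
`∂/∂x_{n+1}` or the null vector `e_{n+1}`. The square of the radius `r` of the orbits is then
`y² - κ`, where `κ = 1, -1, 0` for the spherical, hyperbolic and parabolic types, and the unit speed
of the profile curve says `y'² = r² (1 - h'²)` (`exists_profile`).

Near the points of the profile curve off the axis, `R` has a conformal parametrization of the orbits
in which the induced metric is `ds² + (r λ)² |du|²`, where `λ` makes the orbits space forms of
curvature `κ / r²` (`inducedMetric_orbitParam`). Its sectional curvatures are `-r'' / r` in the planes
containing the profile direction and `(κ - r'²) / r²` in the planes tangent to the orbits, so that
constant curvature `c` means `r'' = -c r` and `r'² = κ - c r²` (`profile_ode`). The parametrization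
has values in the image of `f` but `f` is not assumed to be injective; that its metric has curvature
`c` on a dense set follows from the Baire category theorem, applied to the countably many charts of
`M` (`exists_hasSectionalCurvatureAt`). In the spherical case the interior of the profile curve does
not meet the axis, because there `r'` would have to be both `0` and `± 1` (`IsProfileOf.ode`).

The three equations give `(y h')² = (1 + c) r²`, hence `c ≥ -1`. For `c = -1` the height is constant.
For `c > -1` the functions `y` and `z = r' / √(1 + c)` satisfy, up to the sign of `h`, the linear
system `dy/dh = z`, `dz/dh = -c/(1 + c) y` with `z² = κ - c/(1 + c) y²` (`exists_isProfileSystem`).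
Its solutions are `y = B sinh(h/B + δ)`, `B cosh(h/B - δ)`, `exp(h/B)` with `B² = (c + 1)/(-c)` for
`c < 0`; `y = 1 + h` or `y` constant for `c = 0`; `y = B cos(h/B)` with `B² = (c + 1)/c` for `c > 0`,
up to reflections and translations of `h`. So `f(M)` is contained in a level set `y = ψ(h)`.

These level sets are regular, hence embedded (`isEmbeddedHypersurface_levelSet`), and closed, hence
complete, because in `ℍⁿ × ℝ` curves of bounded length stay in bounded sets
(`IsEmbeddedHypersurface.isComplete`). They coincide with the parametrized sets of the statement,
and these are generated by unit speed curves (`rotation_complete_levelSet` and the lemmas following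
it). Finally an immersion of an `n`-manifold into an embedded hypersurface has relatively open image
(`isOpenPiece_range`).
-/

noncomputable section

/-! ### The Lorentzian inner product and reflections -/

section Lorentz

variable {N n : ℕ}

lemma mink_comm (x y : Fin N → ℝ) : mink x y = mink y x := by
  simp only [mink, mul_comm (x _)]

lemma mink_add_left (x y z : Fin N → ℝ) : mink (x + y) z = mink x z + mink y z := by
  simp only [mink, ← Finset.sum_add_distrib, Pi.add_apply]
  exact Finset.sum_congr rfl fun i _ => by ring

lemma mink_smul_left (a : ℝ) (x y : Fin N → ℝ) : mink (a • x) y = a * mink x y := by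
  simp only [mink, Finset.mul_sum, Pi.smul_apply, smul_eq_mul]
  exact Finset.sum_congr rfl fun i _ => by ring

lemma mink_add_right (x y z : Fin N → ℝ) : mink x (y + z) = mink x y + mink x z := by
  rw [mink_comm, mink_add_left, mink_comm y, mink_comm z]

lemma mink_smul_right (a : ℝ) (x y : Fin N → ℝ) : mink x (a • y) = a * mink x y := by
  rw [mink_comm, mink_smul_left, mink_comm]

lemma mink_neg_left (x y : Fin N → ℝ) : mink (-x) y = -mink x y := by
  rw [← neg_one_smul ℝ x, mink_smul_left]; ring

lemma mink_neg_right (x y : Fin N → ℝ) : mink x (-y) = -mink x y := by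
  rw [mink_comm, mink_neg_left, mink_comm]

lemma mink_sub_left (x y z : Fin N → ℝ) : mink (x - y) z = mink x z - mink y z := by
  rw [sub_eq_add_neg, mink_add_left, mink_neg_left]; ring

lemma mink_sub_right (x y z : Fin N → ℝ) : mink x (y - z) = mink x y - mink x z := by
  rw [mink_comm, mink_sub_left, mink_comm y, mink_comm z]

lemma mink_zero_left (y : Fin N → ℝ) : mink 0 y = 0 := by simp [mink]

lemma mink_zero_right (y : Fin N → ℝ) : mink y 0 = 0 := by simp [mink]

lemma mink_succ (x y : Fin (N + 1) → ℝ) :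
    mink x y = -(x 0 * y 0) + ∑ i : Fin N, x i.succ * y i.succ := by
  simp [mink, Fin.sum_univ_succ]

lemma mink_init (x y : Fin (N + 2) → ℝ) :
    mink x y = mink (Fin.init x : Fin (N + 1) → ℝ) (Fin.init y)
      + x (Fin.last (N + 1)) * y (Fin.last (N + 1)) := by
  rw [mink, Fin.sum_univ_castSucc]
  simp [mink, Fin.init]

/-- The Lorentzian inner product with a fixed vector, as a linear form. -/
def minkForm (v : Fin N → ℝ) : (Fin N → ℝ) →ₗ[ℝ] ℝ where
  toFun x := mink x v
  map_add' x y := mink_add_left x y v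
  map_smul' a x := mink_smul_left a x v

lemma mink_coordVec (x : Fin (n + 2) → ℝ) (i : Fin (n + 2)) :
    mink x (coordVec n i) = if (i : ℕ) = 0 then -x i else x i := by
  rw [mink, Finset.sum_eq_single i]
  · by_cases h : (i : ℕ) = 0 <;> simp [coordVec, h]
  · intro j _ hj
    simp [coordVec, Pi.single_eq_of_ne hj]
  · simp

lemma mink_vertVec (x : Fin (n + 2) → ℝ) : mink x (vertVec n) = x (Fin.last (n + 1)) := by
  rw [vertVec, mink_coordVec]; simp

lemma vertVec_last : vertVec n (Fin.last (n + 1)) = 1 := by simp [vertVec, coordVec]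

lemma init_vertVec : (Fin.init (vertVec n) : Fin (n + 1) → ℝ) = 0 := by
  ext i
  simp [Fin.init, vertVec, coordVec, Fin.castSucc_ne_last]

lemma mink_self_succ (x : Fin (N + 1) → ℝ) :
    mink x x = -(x 0) ^ 2 + ∑ i : Fin N, x i.succ ^ 2 := by
  rw [mink_succ]; simp only [sq]

lemma mem_hypSpace_succ {x : Fin (N + 1) → ℝ} :
    x ∈ hypSpace (N + 1) ↔ mink x x = -1 ∧ 0 < x 0 := by
  constructor
  · rintro ⟨h1, h2⟩
    exact ⟨h1, h2 0 (by simp)⟩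
  · rintro ⟨h1, h2⟩
    refine ⟨h1, fun i hi => ?_⟩
    obtain rfl : i = 0 := Fin.ext hi
    exact h2

/-- The square of the Cauchy-Schwarz inequality for the spatial parts of two vectors. -/
lemma sq_mink_add_le (x y : Fin (N + 1) → ℝ) :
    (mink x y + x 0 * y 0) ^ 2 ≤ (mink x x + x 0 ^ 2) * (mink y y + y 0 ^ 2) := by
  have h := Finset.sum_mul_sq_le_sq_mul_sq Finset.univ (fun i : Fin N => x i.succ)
    (fun i : Fin N => y i.succ)
  rw [mink_succ x y, mink_self_succ x, mink_self_succ y]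
  have e1 : -(x 0 * y 0) + ∑ i : Fin N, x i.succ * y i.succ + x 0 * y 0
      = ∑ i : Fin N, x i.succ * y i.succ := by ring
  have e2 : ∀ z : Fin (N + 1) → ℝ, -(z 0) ^ 2 + ∑ i : Fin N, z i.succ ^ 2 + z 0 ^ 2
      = ∑ i : Fin N, z i.succ ^ 2 := fun z => by ring
  rw [e1, e2, e2]
  exact h

lemma mink_self_add_sq_nonneg (x : Fin (N + 1) → ℝ) : 0 ≤ mink x x + x 0 ^ 2 := by
  rw [mink_self_succ]
  have : 0 ≤ ∑ i : Fin N, x i.succ ^ 2 := Finset.sum_nonneg fun i _ => sq_nonneg _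
  linarith

lemma sq_le_mink_self_add_sq (x : Fin (N + 1) → ℝ) (i : Fin N) :
    x i.succ ^ 2 ≤ mink x x + x 0 ^ 2 := by
  rw [mink_self_succ]
  have : x i.succ ^ 2 ≤ ∑ i : Fin N, x i.succ ^ 2 :=
    Finset.single_le_sum (f := fun i : Fin N => x i.succ ^ 2) (fun i _ => sq_nonneg _)
      (Finset.mem_univ i)
  linarith

lemma eq_zero_of_mink_self {x : Fin (N + 1) → ℝ} (h : mink x x ≤ 0) (h0 : x 0 = 0) : x = 0 := by
  ext i
  refine Fin.cases h0 (fun i => ?_) i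
  have := sq_le_mink_self_add_sq x i
  rw [h0] at this
  have : x i.succ ^ 2 ≤ 0 := by nlinarith
  simpa using pow_eq_zero_iff (two_ne_zero) |>.1 (le_antisymm this (sq_nonneg _))

lemma one_le_of_mem_hypSpace {x : Fin (N + 1) → ℝ} (hx : x ∈ hypSpace (N + 1)) : 1 ≤ x 0 := by
  rw [mem_hypSpace_succ] at hx
  have := mink_self_add_sq_nonneg x
  nlinarith

/-- The reverse Cauchy-Schwarz inequality on `ℍᴺ`. -/
lemma mink_le_neg_one {x y : Fin (N + 1) → ℝ} (hx : x ∈ hypSpace (N + 1))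
    (hy : y ∈ hypSpace (N + 1)) : mink x y ≤ -1 := by
  have h := sq_mink_add_le x y
  have hx1 := one_le_of_mem_hypSpace hx
  have hy1 := one_le_of_mem_hypSpace hy
  rw [mem_hypSpace_succ] at hx hy
  rw [hx.1, hy.1] at h
  have h2 : (mink x y + x 0 * y 0) ^ 2 ≤ (x 0 * y 0 - 1) ^ 2 := by
    nlinarith [sq_nonneg (x 0 - y 0)]
  have h3 := le_of_abs_le (abs_le_of_sq_le_sq h2 (by nlinarith))
  linarith

/-- The difference of two distinct points of `ℍᴺ` is space-like. -/
lemma mink_sub_self_pos {x y : Fin (N + 1) → ℝ} (hx : x ∈ hypSpace (N + 1))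
    (hy : y ∈ hypSpace (N + 1)) (hxy : x ≠ y) : 0 < mink (x - y) (x - y) := by
  by_contra hle
  have h := sq_mink_add_le x y
  have hxy1 : mink (x - y) (x - y) = mink x x - 2 * mink x y + mink y y := by
    rw [mink_sub_left, mink_sub_right, mink_sub_right, mink_comm y x]; ring
  rw [mem_hypSpace_succ] at hx hy
  rw [hx.1, hy.1] at h hxy1
  have h2 := mink_le_neg_one (mem_hypSpace_succ.2 hx) (mem_hypSpace_succ.2 hy)
  have h3 : mink x y = -1 := by linarith
  rw [h3] at h
  have h4 : x 0 = y 0 := by nlinarith [sq_nonneg (x 0 - y 0)]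
  apply hxy
  have := eq_zero_of_mink_self (not_lt.1 hle) (by simp [h4])
  exact sub_eq_zero.1 this

lemma mem_hypSpace_of_mink_neg {x y : Fin (N + 1) → ℝ} (hx : x ∈ hypSpace (N + 1))
    (hy : mink y y = -1) (hxy : mink y x < 0) : y ∈ hypSpace (N + 1) := by
  rw [mem_hypSpace_succ]
  refine ⟨hy, ?_⟩
  by_contra h0
  have h1 := mink_self_add_sq_nonneg y
  have h2 : 0 < -y 0 := by
    rcases (not_lt.1 h0).lt_or_eq with h | h
    · linarith
    · rw [h, hy] at h1; norm_num at h1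
  have h3 : -y ∈ hypSpace (N + 1) :=
    mem_hypSpace_succ.2 ⟨by rw [mink_neg_left, mink_neg_right, hy]; norm_num, h2⟩
  have := mink_le_neg_one h3 hx
  rw [mink_neg_left] at this
  linarith

/-! ### Points of `ℍⁿ × ℝ` and its isometries -/

lemma mem_hypProd {x : Fin (n + 2) → ℝ} :
    x ∈ hypProd n ↔ mink x x = -1 + x (Fin.last (n + 1)) ^ 2 ∧ 0 < x 0 := by
  rw [hypProd, mem_ofPred_eq, mem_hypSpace_succ, mink_init x x]
  have : (Fin.init x : Fin (n + 1) → ℝ) 0 = x 0 := rfl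
  rw [this, sq]
  constructor
  · rintro ⟨h1, h2⟩; exact ⟨by rw [h1], h2⟩
  · rintro ⟨h1, h2⟩; exact ⟨by linarith, h2⟩

lemma one_le_of_mem_hypProd {x : Fin (n + 2) → ℝ} (hx : x ∈ hypProd n) : 1 ≤ x 0 :=
  one_le_of_mem_hypSpace (x := (Fin.init x : Fin (n + 1) → ℝ)) hx

lemma init_sub (x y : Fin (n + 2) → ℝ) :
    (Fin.init (x - y) : Fin (n + 1) → ℝ) = Fin.init x - Fin.init y := rfl

lemma isClosed_hypProd : IsClosed (hypProd n) := by
  have : hypProd n = {x | mink x x = -1 + x (Fin.last (n + 1)) ^ 2} ∩ {x | 1 ≤ x 0} := by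
    ext x
    constructor
    · intro hx
      exact ⟨(mem_hypProd.1 hx).1, one_le_of_mem_hypProd hx⟩
    · rintro ⟨h1, h2⟩
      exact mem_hypProd.2 ⟨h1, lt_of_lt_of_le one_pos h2⟩
  rw [this]
  refine IsClosed.inter (isClosed_eq ?_ (by fun_prop)) (isClosed_le (by fun_prop) (by fun_prop))
  unfold mink
  fun_prop

/-- The reflection in the hyperplane orthogonal to `d`. -/
def minkReflection (d : Fin N → ℝ) (hd : mink d d ≠ 0) : (Fin N → ℝ) ≃ₗ[ℝ] (Fin N → ℝ) :=
  LinearEquiv.ofInvolutive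
    (LinearMap.id - (LinearMap.toSpanSingleton ℝ _ d).comp ((2 / mink d d) • minkForm d)) (by
      intro x
      simp only [LinearMap.sub_apply, LinearMap.id_apply, LinearMap.comp_apply,
        LinearMap.smul_apply, LinearMap.toSpanSingleton_apply, minkForm, LinearMap.coe_mk,
        AddHom.coe_mk, mink_sub_left, mink_smul_left, smul_eq_mul]
      rw [sub_sub, ← add_smul]
      have : 2 / mink d d * mink x d
          + 2 / mink d d * (mink x d - 2 / mink d d * mink x d * mink d d) = 0 := by
        field_simp; ring
      rw [this]; simp)

lemma minkReflection_apply (d : Fin N → ℝ) (hd : mink d d ≠ 0) (x : Fin N → ℝ) :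
    minkReflection d hd x = x - (2 / mink d d * mink x d) • d := rfl

lemma mink_minkReflection (d : Fin N → ℝ) (hd : mink d d ≠ 0) (x y : Fin N → ℝ) :
    mink (minkReflection d hd x) (minkReflection d hd y) = mink x y := by
  simp only [minkReflection_apply, mink_sub_left, mink_sub_right, mink_smul_left, mink_smul_right,
    mink_comm d y]
  field_simp
  ring

lemma minkReflection_of_mink_eq_zero {d x : Fin N → ℝ} (hd : mink d d ≠ 0) (h : mink x d = 0) :
    minkReflection d hd x = x := by
  rw [minkReflection_apply, h]; simp

/-- The reflection in `x - y` exchanges two vectors of the same length. -/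
lemma minkReflection_sub {x y : Fin N → ℝ} (hd : mink (x - y) (x - y) ≠ 0)
    (h : mink x x = mink y y) : minkReflection (x - y) hd x = y := by
  have : 2 / mink (x - y) (x - y) * mink x (x - y) = 1 := by
    rw [div_mul_eq_mul_div, div_eq_one_iff_eq hd]
    simp only [mink_sub_left, mink_sub_right, mink_comm y x, h]; ring
  rw [minkReflection_apply, this]; simp

lemma PreservesHypProd.of_mapsTo {g : (Fin (n + 2) → ℝ) ≃ₗ[ℝ] (Fin (n + 2) → ℝ)}
    (hg : ∀ x y, mink (g x) (g y) = mink x y) (hinv : ∀ x, g (g x) = x)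
    (hm : ∀ x ∈ hypProd n, g x ∈ hypProd n) : PreservesHypProd n g := by
  refine ⟨hg, Subset.antisymm (image_subset_iff.2 hm) fun x hx => ⟨g x, hm x hx, hinv x⟩⟩

lemma PreservesHypProd.refl : PreservesHypProd n (LinearEquiv.refl ℝ _) :=
  ⟨fun _ _ => rfl, image_id _⟩

lemma PreservesHypProd.trans {g g' : (Fin (n + 2) → ℝ) ≃ₗ[ℝ] (Fin (n + 2) → ℝ)}
    (hg : PreservesHypProd n g) (hg' : PreservesHypProd n g') :
    PreservesHypProd n (g.trans g') := by
  refine ⟨fun x y => ?_, ?_⟩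
  · simp only [LinearEquiv.trans_apply, hg'.1, hg.1]
  · have : (g.trans g' : (Fin (n + 2) → ℝ) → _) = g' ∘ g := rfl
    rw [this, image_comp, hg.2, hg'.2]

lemma PreservesHypProd.apply_mem {g : (Fin (n + 2) → ℝ) ≃ₗ[ℝ] (Fin (n + 2) → ℝ)}
    (hg : PreservesHypProd n g) {x : Fin (n + 2) → ℝ} (hx : x ∈ hypProd n) : g x ∈ hypProd n := by
  rw [← hg.2]; exact mem_image_of_mem _ hx

/-- The reflection in a space-like vector tangent to the factor `ℍⁿ` preserves the sheet `x₁ > 0` of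
the hyperboloid. -/
lemma preservesHypProd_minkReflection {d : Fin (n + 2) → ℝ} (hd : 0 < mink d d)
    (hl : d (Fin.last (n + 1)) = 0) : PreservesHypProd n (minkReflection d hd.ne') := by
  refine .of_mapsTo (mink_minkReflection d _) ?_ ?_
  · intro x
    exact (minkReflection d hd.ne').symm_apply_apply x
  · intro x hx
    set g := minkReflection d hd.ne' with hg
    have hlast : g x (Fin.last (n + 1)) = x (Fin.last (n + 1)) := by
      rw [hg, minkReflection_apply]; simp [hl]
    have h1 : mink (g x) (g x) = mink x x := mink_minkReflection _ _ _ _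
    have hx' := mem_hypProd.1 hx
    have hxx : mink (Fin.init x : Fin (n + 1) → ℝ) (Fin.init x) = -1 :=
      (mem_hypSpace_succ.1 hx).1
    have h2 : mink (g x) x = mink x x - 2 * mink x d ^ 2 / mink d d := by
      rw [hg, minkReflection_apply, mink_sub_left, mink_smul_left, mink_comm d x]; ring
    have h3 : 0 ≤ 2 * mink x d ^ 2 / mink d d := by positivity
    refine mem_hypSpace_of_mink_neg hx ?_ ?_
    · rw [mink_init, mink_init x x, hlast] at h1
      linarith
    · rw [mink_init, mink_init x x, hlast] at h2
      linarith

/-- The reflection of the factor `ℝ`. -/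
lemma preservesHypProd_vertReflection :
    ∃ g : (Fin (n + 2) → ℝ) ≃ₗ[ℝ] (Fin (n + 2) → ℝ), PreservesHypProd n g ∧
      ∀ x, (Fin.init (g x) : Fin (n + 1) → ℝ) = Fin.init x ∧
        g x (Fin.last (n + 1)) = -x (Fin.last (n + 1)) := by
  have hv : mink (vertVec n) (vertVec n) = 1 := by rw [mink_vertVec, vertVec_last]
  have key : ∀ x, (Fin.init (minkReflection (vertVec n) (by rw [hv]; norm_num) x) :
      Fin (n + 1) → ℝ) = Fin.init x ∧
      minkReflection (vertVec n) (by rw [hv]; norm_num) x (Fin.last (n + 1))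
        = -x (Fin.last (n + 1)) := by
    intro x
    rw [minkReflection_apply, hv, mink_vertVec]
    constructor
    · ext i
      have : (Fin.init (vertVec n) : Fin (n + 1) → ℝ) i = 0 := by rw [init_vertVec]; rfl
      simp only [Fin.init] at this ⊢
      simp [this]
    · simp [vertVec_last]; ring
  refine ⟨minkReflection (vertVec n) (by rw [hv]; norm_num), ?_, key⟩
  refine .of_mapsTo (mink_minkReflection _ _) (minkReflection (vertVec n) _).symm_apply_apply ?_
  intro x hx
  rw [hypProd, mem_ofPred_eq, (key x).1]
  exact hx

/-! ### Orbits as level sets -/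

/-- The axis group acts transitively on the points of `ℍⁿ × ℝ` with a given height and a given
inner product with `v`: the reflection in the difference of two such points belongs to it. -/
lemma exists_isometry_map_eq {v x x' : Fin (n + 2) → ℝ}
    (hx : x ∈ hypProd n) (hx' : x' ∈ hypProd n) (hv : mink x v = mink x' v)
    (hh : x (Fin.last (n + 1)) = x' (Fin.last (n + 1))) :
    ∃ g : (Fin (n + 2) → ℝ) ≃ₗ[ℝ] (Fin (n + 2) → ℝ), PreservesHypProd n g ∧ g v = v ∧
      g (vertVec n) = vertVec n ∧ g x = x' := by
  by_cases hxx : x = x'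
  · exact ⟨LinearEquiv.refl ℝ _, .refl, rfl, rfl, hxx⟩
  have hl : (x - x') (Fin.last (n + 1)) = 0 := by simp [hh]
  have hd : 0 < mink (x - x') (x - x') := by
    rw [mink_init, hl, init_sub]
    have hne : (Fin.init x : Fin (n + 1) → ℝ) ≠ Fin.init x' := by
      intro h
      apply hxx
      ext i
      refine Fin.lastCases hh (fun i => ?_) i
      exact congrFun h i
    have := mink_sub_self_pos hx hx' hne
    linarith
  refine ⟨minkReflection _ hd.ne', preservesHypProd_minkReflection hd hl, ?_, ?_, ?_⟩
  · apply minkReflection_of_mink_eq_zero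
    rw [mink_sub_right, mink_comm v, mink_comm v, hv, sub_self]
  · apply minkReflection_of_mink_eq_zero
    rw [mink_comm, mink_vertVec, hl]
  · apply minkReflection_sub
    rw [(mem_hypProd.1 hx).1, (mem_hypProd.1 hx').1, hh]

lemma rotationOrbit_eq {P2 : Submodule ℝ (Fin (n + 2) → ℝ)} {v : Fin (n + 2) → ℝ}
    (hv : v ∈ P2) (hvert : vertVec n ∈ P2)
    (hspan : ∀ w ∈ P2, ∃ a b : ℝ, w = a • v + b • vertVec n)
    {I : Set ℝ} {α : ℝ → (Fin (n + 2) → ℝ)} (hα : ∀ s ∈ I, α s ∈ hypProd n) :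
    rotationOrbit n P2 I α = {x | x ∈ hypProd n ∧ ∃ s ∈ I, mink x v = mink (α s) v ∧
      x (Fin.last (n + 1)) = α s (Fin.last (n + 1))} := by
  ext x
  constructor
  · rintro ⟨g, hg, hfix, s, hs, rfl⟩
    refine ⟨hg.apply_mem (hα s hs), s, hs, ?_, ?_⟩
    · conv_lhs => rw [← hfix v hv]
      exact hg.1 _ _
    · have h := hg.1 (α s) (vertVec n)
      rwa [hfix _ hvert, mink_vertVec, mink_vertVec] at h
  · rintro ⟨hx, s, hs, h1, h2⟩
    obtain ⟨g, hg, hgv, hgvert, hgx⟩ := exists_isometry_map_eq (hα s hs) hx h1.symm h2.symm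
    refine ⟨g, hg, fun y hy => ?_, s, hs, hgx.symm⟩
    obtain ⟨a, b, rfl⟩ := hspan y hy
    rw [map_add, map_smul, map_smul, hgv, hgvert]

/-- Two vectors of the same length can be exchanged by an isometry when their difference is
space-like. -/
lemma exists_isometry_map_eq_of_sub {v v' : Fin (n + 2) → ℝ} (hl : v (Fin.last (n + 1)) = 0)
    (hl' : v' (Fin.last (n + 1)) = 0) (hvv : mink v v = mink v' v')
    (h : v = v' ∨ 0 < mink (v - v') (v - v')) :
    ∃ g : (Fin (n + 2) → ℝ) ≃ₗ[ℝ] (Fin (n + 2) → ℝ), PreservesHypProd n g ∧ g v = v' ∧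
      g (vertVec n) = vertVec n := by
  rcases h with h | h
  · exact ⟨LinearEquiv.refl ℝ _, .refl, h, rfl⟩
  · have hl2 : (v - v') (Fin.last (n + 1)) = 0 := by simp [hl, hl']
    refine ⟨minkReflection _ h.ne', preservesHypProd_minkReflection h hl2,
      minkReflection_sub _ hvv, ?_⟩
    apply minkReflection_of_mink_eq_zero
    rw [mink_comm, mink_vertVec, hl2]

end Lorentz

/-! ### Local diffeomorphisms -/

section LocalDiffeo

variable {X Y : Type*} [NormedAddCommGroup X] [NormedSpace ℝ X]
  [NormedAddCommGroup Y] [NormedSpace ℝ Y]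

lemma isInvertible_of_injective [FiniteDimensional ℝ X] [FiniteDimensional ℝ Y] {A : X →L[ℝ] Y} (hA : Function.Injective A)
    (h : Module.finrank ℝ X = Module.finrank ℝ Y) : A.IsInvertible :=
  ⟨(LinearEquiv.ofBijective (A : X →ₗ[ℝ] Y)
    ⟨hA, (LinearMap.injective_iff_surjective_of_finrank_eq_finrank h).1 hA⟩).toContinuousLinearEquiv,
    by ext; rfl⟩

/-- The inverse function theorem, with a smooth inverse on the whole target. -/
lemma exists_openPartialHomeomorph [FiniteDimensional ℝ X] {F : X → Y} {U : Set X} (hU : IsOpen U)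
    (hF : ContDiffOn ℝ ∞ F U) {x : X} (hx : x ∈ U) (hinv : (fderiv ℝ F x).IsInvertible) :
    ∃ φ : OpenPartialHomeomorph X Y, x ∈ φ.source ∧ φ.source ⊆ U ∧ (φ : X → Y) = F ∧
      ContDiffOn ℝ ∞ φ.symm φ.target := by
  have : CompleteSpace X := FiniteDimensional.complete ℝ X
  have hdiff : ∀ y ∈ U, ContDiffAt ℝ ∞ F y := fun y hy => hF.contDiffAt (hU.mem_nhds hy)
  have hne : (∞ : WithTop ℕ∞) ≠ 0 := by simp
  obtain ⟨A, hA⟩ := hinv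
  have hFx : HasFDerivAt F (A : X →L[ℝ] Y) x := by
    rw [hA]; exact ((hdiff x hx).differentiableAt hne).hasFDerivAt
  set φ₀ := (hdiff x hx).toOpenPartialHomeomorph F hFx hne with hφ₀
  set W : Set X := U ∩ fderiv ℝ F ⁻¹' (range ((↑) : (X ≃L[ℝ] Y) → X →L[ℝ] Y)) with hW
  have hWo : IsOpen W :=
    (hF.continuousOn_fderiv_of_isOpen hU (by norm_cast)).isOpen_inter_preimage hU
      ContinuousLinearEquiv.isOpen
  refine ⟨φ₀.restrOpen W hWo, ?_, ?_, rfl, ?_⟩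
  · exact ⟨(hdiff x hx).mem_toOpenPartialHomeomorph_source hFx hne, hx, A, hA⟩
  · intro y hy
    exact hy.2.1
  · intro y hy
    have hsrc : (φ₀.restrOpen W hWo).symm y ∈ (φ₀.restrOpen W hWo).source :=
      (φ₀.restrOpen W hWo).map_target hy
    obtain ⟨A', hA'⟩ := hsrc.2.2
    refine ContDiffAt.contDiffWithinAt ?_
    refine (φ₀.restrOpen W hWo).contDiffAt_symm hy (f₀' := A') ?_ (hdiff _ hsrc.2.1)
    rw [hA']
    exact ((hdiff _ hsrc.2.1).differentiableAt hne).hasFDerivAt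

lemma exists_leftInverse_clm [FiniteDimensional ℝ Y] {A : X →L[ℝ] Y} (hA : Function.Injective A) :
    ∃ L : Y →L[ℝ] X, ∀ w, L (A w) = w := by
  obtain ⟨L, hL⟩ := LinearMap.exists_leftInverse_of_injective (A : X →ₗ[ℝ] Y)
    (LinearMap.ker_eq_bot.2 hA)
  exact ⟨LinearMap.toContinuousLinearMap L, fun w => LinearMap.congr_fun hL w⟩

/-- An immersion becomes a local diffeomorphism after composition with a suitable linear map. -/
lemma exists_projection_openPartialHomeomorph [FiniteDimensional ℝ X]
    [FiniteDimensional ℝ Y] {F : X → Y} {U : Set X} (hU : IsOpen U)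
    (hF : ContDiffOn ℝ ∞ F U) {x : X} (hx : x ∈ U) (hinj : Function.Injective (fderiv ℝ F x)) :
    ∃ (L : Y →L[ℝ] X) (φ : OpenPartialHomeomorph X X), x ∈ φ.source ∧ φ.source ⊆ U ∧
      (∀ y, φ y = L (F y)) ∧ ContDiffOn ℝ ∞ φ.symm φ.target := by
  obtain ⟨L, hL⟩ := exists_leftInverse_clm hinj
  have hd : DifferentiableAt ℝ F x :=
    ((hF x hx).contDiffAt (hU.mem_nhds hx)).differentiableAt (by simp)
  have h1 : fderiv ℝ (fun y => L (F y)) x = ContinuousLinearMap.id ℝ X := by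
    have h : HasFDerivAt (fun y => L (F y)) (L.comp (fderiv ℝ F x)) x :=
      L.hasFDerivAt.comp x hd.hasFDerivAt
    rw [h.fderiv]
    ext w
    simp [hL]
  obtain ⟨φ, h2, h3, h4, h5⟩ := exists_openPartialHomeomorph (F := fun y => L (F y)) hU
    (L.contDiff.comp_contDiffOn hF) hx (h1 ▸ ⟨ContinuousLinearEquiv.refl ℝ X, rfl⟩)
  exact ⟨L, φ, h2, h3, fun y => by rw [h4], h5⟩

lemma injective_fderiv_of_eventuallyEq_comp {Z : Type*} [NormedAddCommGroup Z] [NormedSpace ℝ Z]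
    {F : X → Y} {K : Z → Y} {G : X → Z} {x : X} (h : F =ᶠ[𝓝 x] fun w => K (G w))
    (hK : DifferentiableAt ℝ K (G x)) (hG : DifferentiableAt ℝ G x)
    (hF : Function.Injective (fderiv ℝ F x)) : Function.Injective (fderiv ℝ G x) := by
  have h1 : HasFDerivAt (fun w => K (G w)) ((fderiv ℝ K (G x)).comp (fderiv ℝ G x)) x :=
    hK.hasFDerivAt.comp x hG.hasFDerivAt
  rw [h.fderiv_eq, h1.fderiv] at hF
  exact Function.Injective.of_comp hF

end LocalDiffeo

/-! ### The curvature depends only on the germ of the metric -/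

section Germ

variable {n : ℕ}

lemma pd_congr {F : Type} [NormedAddCommGroup F] [NormedSpace ℝ F]
    {a b : EuclideanSpace ℝ (Fin n) → F} {u : EuclideanSpace ℝ (Fin n)} (h : a =ᶠ[𝓝 u] b)
    (i : Fin n) : pd i a u = pd i b u := by
  rw [pd, pd, h.fderiv_eq]

lemma christoffel_congr {G G' : EuclideanSpace ℝ (Fin n) → Matrix (Fin n) (Fin n) ℝ}
    {u : EuclideanSpace ℝ (Fin n)} (h : G =ᶠ[𝓝 u] G') (l i j : Fin n) :
    christoffel G l i j u = christoffel G' l i j u := by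
  have hc : ∀ a b, (fun v => G v a b) =ᶠ[𝓝 u] fun v => G' v a b := fun a b =>
    h.mono fun v hv => by simp only [hv]
  simp only [christoffel, h.eq_of_nhds, pd_congr (hc _ _)]

lemma curvTensor_congr {G G' : EuclideanSpace ℝ (Fin n) → Matrix (Fin n) (Fin n) ℝ}
    {u : EuclideanSpace ℝ (Fin n)} (h : G =ᶠ[𝓝 u] G') (l k i j : Fin n) :
    curvTensor G l k i j u = curvTensor G' l k i j u := by
  have hc : ∀ a b d, christoffel G a b d =ᶠ[𝓝 u] christoffel G' a b d := fun a b d =>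
    h.eventuallyEq_nhds.mono fun v hv => christoffel_congr hv a b d
  simp only [curvTensor, christoffel_congr h, pd_congr (hc _ _ _)]

lemma HasSectionalCurvatureAt.congr {G G' : EuclideanSpace ℝ (Fin n) → Matrix (Fin n) (Fin n) ℝ}
    {u : EuclideanSpace ℝ (Fin n)} {c : ℝ} (hc : HasSectionalCurvatureAt G c u)
    (h : G =ᶠ[𝓝 u] G') : HasSectionalCurvatureAt G' c u := by
  intro X Y hXY
  rw [← hc X Y hXY]
  simp only [curvForm, metricAt, curvTensor_congr h, h.eq_of_nhds]

lemma inducedMetric_congr {F F' : EuclideanSpace ℝ (Fin n) → (Fin (n + 2) → ℝ)}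
    {u : EuclideanSpace ℝ (Fin n)} (h : F =ᶠ[𝓝 u] F') :
    inducedMetric F =ᶠ[𝓝 u] inducedMetric F' := by
  refine h.eventuallyEq_nhds.mono fun v hv => ?_
  simp only [inducedMetric, pd_congr hv]

end Germ

/-! ### Parametrizations with values in the image of an immersion -/

section Immersion

variable {n : ℕ} {M : Type*} [TopologicalSpace M] [ChartedSpace (EuclideanSpace ℝ (Fin n)) M]
  {f : M → (Fin (n + 2) → ℝ)}

lemma contDiffOn_comp_symm {e : OpenPartialHomeomorph M (EuclideanSpace ℝ (Fin n))}
    (he : e ∈ IsManifold.maximalAtlas 𝓘(ℝ, EuclideanSpace ℝ (Fin n)) ∞ M)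
    (hf : IsHypersurface f) : ContDiffOn ℝ ∞ (f ∘ e.symm) e.target := by
  rw [← contMDiffOn_iff_contDiffOn]
  exact hf.1.comp_contMDiffOn (contMDiffOn_symm_of_mem_maximalAtlas he)

variable [IsManifold 𝓘(ℝ, EuclideanSpace ℝ (Fin n)) ∞ M]

lemma injective_fderiv_comp_chart_symm (hf : IsHypersurface f) (p : M)
    {u : EuclideanSpace ℝ (Fin n)} (hu : u ∈ (chartAt (EuclideanSpace ℝ (Fin n)) p).target) :
    Function.Injective
      (fderiv ℝ (f ∘ (chartAt (EuclideanSpace ℝ (Fin n)) p).symm) u) := by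
  have hne : (∞ : WithTop ℕ∞) ≠ 0 := by simp
  have hc := mdifferentiable_chart (I := 𝓘(ℝ, EuclideanSpace ℝ (Fin n))) p
  rw [← mfderiv_eq_fderiv, mfderiv_comp u ((hf.1 _).mdifferentiableAt hne)
    (hc.mdifferentiableAt_symm hu)]
  exact (hf.2.1 _).comp (hc.symm.mfderiv_injective hu)

/-- Around each point an immersion into `ℝⁿ⁺²` has a chart that is the restriction of a linear
projection. -/
lemma exists_projection_chart (hf : IsHypersurface f) (p : M) :
    ∃ e ∈ IsManifold.maximalAtlas 𝓘(ℝ, EuclideanSpace ℝ (Fin n)) ∞ M, p ∈ e.source ∧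
      ∃ L : (Fin (n + 2) → ℝ) →L[ℝ] EuclideanSpace ℝ (Fin n), ∀ q ∈ e.source, e q = L (f q) := by
  set c := chartAt (EuclideanSpace ℝ (Fin n)) p with hc
  have hcm : c ∈ IsManifold.maximalAtlas 𝓘(ℝ, EuclideanSpace ℝ (Fin n)) ∞ M :=
    IsManifold.chart_mem_maximalAtlas p
  obtain ⟨L, φ, h1, h2, h3, h4⟩ := exists_projection_openPartialHomeomorph c.open_target
    (contDiffOn_comp_symm hcm hf) (mem_chart_target _ p)
    (injective_fderiv_comp_chart_symm hf p (mem_chart_target _ p))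
  have hL : ∀ q ∈ (c.trans φ).source, (c.trans φ) q = L (f q) := by
    intro q hq
    have hq1 : q ∈ c.source := (c.trans_source φ ▸ hq).1
    simp only [OpenPartialHomeomorph.trans_apply, h3, Function.comp_apply, c.left_inv hq1]
  refine ⟨c.trans φ, ?_, ?_, L, hL⟩
  · refine OpenPartialHomeomorph.mem_maximalAtlas_of_contMDiffOn _ ?_ ?_
    · refine ContMDiffOn.congr (f := fun q => L (f q)) ?_ hL
      exact (L.contDiff.contMDiff.comp hf.1).contMDiffOn
    · rw [OpenPartialHomeomorph.coe_trans_symm]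
      refine (contMDiffOn_symm_of_mem_maximalAtlas hcm).comp
        ((contMDiffOn_iff_contDiffOn.2 h4).mono ?_) ?_
      · intro y hy
        rw [OpenPartialHomeomorph.trans_target] at hy
        exact hy.1
      · intro y hy
        rw [OpenPartialHomeomorph.trans_target] at hy
        exact hy.2
  · rw [OpenPartialHomeomorph.trans_source]
    exact ⟨mem_chart_source _ p, h1⟩

/-- A chart followed by a diffeomorphism between open subsets of `ℝⁿ` is a chart. -/
lemma trans_mem_maximalAtlas {e : OpenPartialHomeomorph M (EuclideanSpace ℝ (Fin n))}
    (he : e ∈ IsManifold.maximalAtlas 𝓘(ℝ, EuclideanSpace ℝ (Fin n)) ∞ M)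
    {φ : OpenPartialHomeomorph (EuclideanSpace ℝ (Fin n)) (EuclideanSpace ℝ (Fin n))}
    (h : ContDiffOn ℝ ∞ φ φ.source) (h' : ContDiffOn ℝ ∞ φ.symm φ.target) :
    e.trans φ ∈ IsManifold.maximalAtlas 𝓘(ℝ, EuclideanSpace ℝ (Fin n)) ∞ M := by
  refine OpenPartialHomeomorph.mem_maximalAtlas_of_contMDiffOn _ ?_ ?_
  · rw [OpenPartialHomeomorph.coe_trans]
    refine (contMDiffOn_iff_contDiffOn.2 h).comp
      ((contMDiffOn_of_mem_maximalAtlas he).mono ?_) ?_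
    · intro y hy
      rw [OpenPartialHomeomorph.trans_source] at hy
      exact hy.1
    · intro y hy
      rw [OpenPartialHomeomorph.trans_source] at hy
      exact hy.2
  · rw [OpenPartialHomeomorph.coe_trans_symm]
    refine (contMDiffOn_symm_of_mem_maximalAtlas he).comp
      ((contMDiffOn_iff_contDiffOn.2 h').mono ?_) ?_
    · intro y hy
      rw [OpenPartialHomeomorph.trans_target] at hy
      exact hy.1
    · intro y hy
      rw [OpenPartialHomeomorph.trans_target] at hy
      exact hy.2

/-- An immersed parametrized piece of the image of `f` carries the curvature of `f` at some point,
even though `f` need not be injective: by Baire's theorem some open subset of the piece is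
contained in the image of a single projection chart, and there the parametrization is the inverse
of a chart of `M`. -/
lemma exists_hasSectionalCurvatureAt [T2Space M] [SecondCountableTopology M]
    (hf : IsHypersurface f) {c : ℝ} (hc : HasConstSectionalCurvature f c)
    {Ψ : EuclideanSpace ℝ (Fin n) → (Fin (n + 2) → ℝ)} {V : Set (EuclideanSpace ℝ (Fin n))}
    (hV : IsOpen V) (hVne : V.Nonempty) (hΨ : ContDiffOn ℝ ∞ Ψ V)
    (hinj : ∀ w ∈ V, Function.Injective (fderiv ℝ Ψ w)) (hran : ∀ w ∈ V, Ψ w ∈ range f) :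
    ∃ w ∈ V, HasSectionalCurvatureAt (inducedMetric Ψ) c w := by
  have : LocallyCompactSpace M :=
    Manifold.locallyCompact_of_finiteDimensional 𝓘(ℝ, EuclideanSpace ℝ (Fin n))
  choose e he hpe L hL using exists_projection_chart hf
  have hK : ∀ p : M, ∃ K, K ∈ 𝓝 p ∧ K ⊆ (e p).source ∧ IsCompact K := fun p =>
    local_compact_nhds ((e p).open_source.mem_nhds (hpe p))
  choose K hKn hKs hKc using hK
  obtain ⟨T, hT, hTU⟩ := TopologicalSpace.countable_cover_nhds hKn
  have : Countable T := hT.to_subtype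
  have : BaireSpace V := hV.baireSpace
  have : Nonempty V := hVne.to_subtype
  have hΨc : Continuous fun w : V => Ψ w := hΨ.continuousOn.comp_continuous continuous_subtype_val
    fun w => w.2
  obtain ⟨p, hp⟩ := nonempty_interior_of_iUnion_of_closed
    (f := fun p : T => (fun w : V => Ψ w) ⁻¹' (f '' K p))
    (fun p => (((hKc p).image hf.1.continuous).isClosed).preimage hΨc) (by
      ext w
      simp only [mem_iUnion, mem_univ, iff_true]
      obtain ⟨q, hq⟩ := hran w w.2
      have : q ∈ ⋃ x ∈ T, K x := hTU ▸ mem_univ q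
      simp only [mem_iUnion] at this
      obtain ⟨x, hx, hqx⟩ := this
      exact ⟨⟨x, hx⟩, q, hqx, hq⟩)
  -- On the open set `W ⊆ V`, the map `Ψ` has values in the image of a single projection chart.
  obtain ⟨w₀, hw₀⟩ := hp
  set W : Set (EuclideanSpace ℝ (Fin n)) :=
    Subtype.val '' interior ((fun w : V => Ψ w) ⁻¹' (f '' K p)) with hWdef
  have hW : IsOpen W := hV.isOpenMap_subtype_val _ isOpen_interior
  have hWV : W ⊆ V := by rintro _ ⟨w, _, rfl⟩; exact w.2
  have hWK : ∀ w ∈ W, ∃ q ∈ K p, f q = Ψ w := by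
    rintro _ ⟨w, hw, rfl⟩
    have h : w ∈ (fun w : V => Ψ w) ⁻¹' (f '' K p) := interior_subset hw
    exact h
  have hEq : ∀ w ∈ W, L p (Ψ w) ∈ (e p).target ∧ f ((e p).symm (L p (Ψ w))) = Ψ w := by
    intro w hw
    obtain ⟨q, hq, hqw⟩ := hWK w hw
    have hqs := hKs p hq
    rw [← hqw, ← hL p q hqs]
    exact ⟨(e p).map_source hqs, by rw [(e p).left_inv hqs]⟩
  have hw₀W : (w₀ : EuclideanSpace ℝ (Fin n)) ∈ W := mem_image_of_mem _ hw₀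
  have hne : (∞ : WithTop ℕ∞) ≠ 0 := by simp
  have hΨd : ∀ w ∈ V, DifferentiableAt ℝ Ψ w := fun w hw =>
    ((hΨ w hw).contDiffAt (hV.mem_nhds hw)).differentiableAt hne
  have hinjL : Function.Injective (fderiv ℝ (fun w => L p (Ψ w)) w₀) := by
    have h1 : Ψ =ᶠ[𝓝 (w₀ : EuclideanSpace ℝ (Fin n))]
        fun w => (f ∘ (e p).symm) (L p (Ψ w)) :=
      Filter.mem_of_superset (hW.mem_nhds hw₀W) fun w hw => (hEq w hw).2.symm
    have hsm := contDiffOn_comp_symm (he p) hf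
    have h2 : DifferentiableAt ℝ (f ∘ (e p).symm) (L p (Ψ w₀)) :=
      ((hsm _ (hEq _ hw₀W).1).contDiffAt
        ((e p).open_target.mem_nhds (hEq _ hw₀W).1)).differentiableAt hne
    have h3 : DifferentiableAt ℝ (fun w => L p (Ψ w)) w₀ :=
      (L p).differentiableAt.comp _ (hΨd _ w₀.2)
    exact injective_fderiv_of_eventuallyEq_comp h1 h2 h3 (hinj _ w₀.2)
  obtain ⟨φ, hφ1, hφ2, hφ3, hφ4⟩ := exists_openPartialHomeomorph hW
    (F := fun w => L p (Ψ w)) ((L p).contDiff.comp_contDiffOn (hΨ.mono hWV)) hw₀W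
    (isInvertible_of_injective hinjL rfl)
  have hφs : ContDiffOn ℝ ∞ φ φ.source := by
    rw [hφ3]
    exact (L p).contDiff.comp_contDiffOn (hΨ.mono (hφ2.trans hWV))
  have he' := trans_mem_maximalAtlas (he p) (φ := φ.symm) hφ4 (by simpa using hφs)
  have htarget : ∀ w ∈ φ.source, w ∈ ((e p).trans φ.symm).target := by
    intro w hw
    rw [OpenPartialHomeomorph.trans_target]
    refine ⟨hw, ?_⟩
    rw [mem_preimage, OpenPartialHomeomorph.symm_symm, hφ3]
    exact (hEq w (hφ2 hw)).1
  refine ⟨w₀, w₀.2, (hc _ he' w₀ (htarget _ hφ1)).congr (inducedMetric_congr ?_)⟩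
  refine Filter.mem_of_superset (φ.open_source.mem_nhds hφ1) fun w hw => ?_
  change f (((e p).trans φ.symm).symm w) = Ψ w
  rw [OpenPartialHomeomorph.coe_trans_symm, OpenPartialHomeomorph.symm_symm, hφ3]
  exact (hEq w (hφ2 hw)).2

/-- An immersion of an `n`-manifold into an embedded hypersurface is open. -/
lemma isOpenPiece_range {S : Set (Fin (n + 2) → ℝ)} (hS : IsEmbeddedHypersurface n S)
    (hf : IsHypersurface f) (hran : ∀ p, f p ∈ S) : IsOpenPiece (range f) S := by
  have hne : (∞ : WithTop ℕ∞) ≠ 0 := by simp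
  have key : ∀ p, ∃ V : Set (Fin (n + 2) → ℝ), IsOpen V ∧ f p ∈ V ∧ S ∩ V ⊆ range f := by
    intro p
    obtain ⟨U, F, hU, ⟨u₀, hu₀, hu₀p⟩, hF, hFi, -, hFo⟩ := hS.2 _ (hran p)
    obtain ⟨L, ψ, hψ1, hψ2, hψ3, hψ4⟩ :=
      exists_projection_openPartialHomeomorph hU hF hu₀ (hFi _ hu₀)
    obtain ⟨V₀, hV₀, hV₀S⟩ := hFo ψ.source hψ2 ψ.open_source
    set c := chartAt (EuclideanSpace ℝ (Fin n)) p with hc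
    have hcm : c ∈ IsManifold.maximalAtlas 𝓘(ℝ, EuclideanSpace ℝ (Fin n)) ∞ M :=
      IsManifold.chart_mem_maximalAtlas p
    have hcs := contDiffOn_comp_symm hcm hf
    set D := c.target ∩ (f ∘ c.symm) ⁻¹' V₀ with hD
    have hDo : IsOpen D := hcs.continuousOn.isOpen_inter_preimage c.open_target hV₀
    have hpD : c p ∈ D := by
      refine ⟨mem_chart_target _ p, ?_⟩
      have h1 : F u₀ ∈ S ∩ V₀ := hV₀S ▸ mem_image_of_mem _ hψ1
      rw [mem_preimage, Function.comp_apply, c.left_inv (mem_chart_source _ p), ← hu₀p]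
      exact h1.2
    have hEq : ∀ d ∈ D, L (f (c.symm d)) ∈ ψ.target ∧
        F (ψ.symm (L (f (c.symm d)))) = f (c.symm d) := by
      intro d hd
      have h1 : f (c.symm d) ∈ F '' ψ.source := hV₀S ▸ ⟨hran _, hd.2⟩
      obtain ⟨w, hw, hwd⟩ := h1
      rw [← hwd, ← hψ3]
      exact ⟨ψ.map_source hw, by rw [ψ.left_inv hw]⟩
    have hinjL : Function.Injective (fderiv ℝ (fun d => L (f (c.symm d))) (c p)) := by
      have h1 : (f ∘ c.symm) =ᶠ[𝓝 (c p)]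
          fun d => (F ∘ ψ.symm) (L (f (c.symm d))) :=
        Filter.mem_of_superset (hDo.mem_nhds hpD) fun d hd => (hEq d hd).2.symm
      have hmem := (hEq _ hpD).1
      have h2 : DifferentiableAt ℝ (F ∘ ψ.symm) (L (f (c.symm (c p)))) := by
        refine DifferentiableAt.comp _ ?_
          ((hψ4.contDiffAt (ψ.open_target.mem_nhds hmem)).differentiableAt hne)
        exact (hF.contDiffAt (hU.mem_nhds (hψ2 (ψ.map_target hmem)))).differentiableAt hne
      have h3 : DifferentiableAt ℝ (fun d => L ((f ∘ c.symm) d)) (c p) :=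
        (ContinuousLinearMap.differentiableAt L).comp _
          ((hcs.contDiffAt (c.open_target.mem_nhds hpD.1)).differentiableAt hne)
      exact injective_fderiv_of_eventuallyEq_comp h1 h2 h3
        (injective_fderiv_comp_chart_symm hf p (mem_chart_target _ p))
    obtain ⟨χ, hχ1, hχ2, hχ3, -⟩ := exists_openPartialHomeomorph hDo
      (F := fun d => L (f (c.symm d)))
      (L.contDiff.comp_contDiffOn (hcs.mono inter_subset_left)) hpD
      (isInvertible_of_injective hinjL rfl)
    obtain ⟨V₁, hV₁, hV₁S⟩ := hFo (ψ.source ∩ ψ ⁻¹' χ.target) (inter_subset_left.trans hψ2)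
      (ψ.isOpen_inter_preimage χ.open_target)
    refine ⟨V₁, hV₁, ?_, ?_⟩
    · have h1 : u₀ ∈ ψ.source ∩ ψ ⁻¹' χ.target := by
        refine ⟨hψ1, ?_⟩
        rw [mem_preimage, hψ3, hu₀p]
        have := χ.map_source hχ1
        simp only [hχ3] at this
        rwa [c.left_inv (mem_chart_source _ p)] at this
      have h2 : F u₀ ∈ S ∩ V₁ := hV₁S ▸ mem_image_of_mem _ h1
      exact hu₀p ▸ h2.2
    · rw [← hV₁S]
      rintro _ ⟨w, ⟨hw1, hw2⟩, rfl⟩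
      refine ⟨c.symm (χ.symm (ψ w)), ?_⟩
      have hd := χ.map_target hw2
      rw [← (hEq _ (hχ2 hd)).2]
      have h1 : L (f (c.symm (χ.symm (ψ w)))) = ψ w := by
        have := χ.right_inv hw2
        rwa [hχ3] at this
      rw [h1, ψ.left_inv hw1]
  choose V hVo hpV hVr using key
  refine ⟨⋃ p, V p, isOpen_iUnion hVo, Subset.antisymm ?_ ?_⟩
  · rintro _ ⟨p, rfl⟩
    exact ⟨hran p, mem_iUnion.2 ⟨p, hpV p⟩⟩
  · rintro x ⟨hxS, hx⟩
    obtain ⟨p, hp⟩ := mem_iUnion.1 hx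
    exact hVr p ⟨hxS, hp⟩

end Immersion

/-! ### Regular level sets -/

/-- A regular level set of codimension two in `ℝⁿ⁺²` that is contained in `ℍⁿ × ℝ` is an embedded
hypersurface of `ℍⁿ × ℝ`. -/
lemma isEmbeddedHypersurface_of_regular {n : ℕ} {S O : Set (Fin (n + 2) → ℝ)}
    {Φ : (Fin (n + 2) → ℝ) → ℝ × ℝ} (hO : IsOpen O) (hΦ : ContDiffOn ℝ ∞ Φ O)
    (hS : S = {x | x ∈ O ∧ Φ x = 0}) (hSH : S ⊆ hypProd n)
    (hsurj : ∀ x ∈ S, Function.Surjective (fderiv ℝ Φ x)) : IsEmbeddedHypersurface n S := by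
  have hne : (∞ : WithTop ℕ∞) ≠ 0 := by simp
  refine ⟨hSH, fun p hp => ?_⟩
  have hpO : p ∈ O := by rw [hS] at hp; exact hp.1
  have hpΦ : Φ p = 0 := by rw [hS] at hp; exact hp.2
  set D := fderiv ℝ Φ p with hD
  have hker : Module.finrank ℝ (LinearMap.ker (D : (Fin (n + 2) → ℝ) →ₗ[ℝ] ℝ × ℝ)) = n := by
    have h1 := LinearMap.finrank_range_add_finrank_ker (D : (Fin (n + 2) → ℝ) →ₗ[ℝ] ℝ × ℝ)
    rw [LinearMap.range_eq_top.2 (hsurj p hp), finrank_top] at h1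
    simp at h1
    omega
  -- A linear map `A` that restricts to an isomorphism from the kernel of `D` to `ℝⁿ`.
  obtain ⟨q, hq⟩ := Submodule.exists_isCompl (LinearMap.ker (D : (Fin (n + 2) → ℝ) →ₗ[ℝ] ℝ × ℝ))
  have iso : LinearMap.ker (D : (Fin (n + 2) → ℝ) →ₗ[ℝ] ℝ × ℝ) ≃ₗ[ℝ] EuclideanSpace ℝ (Fin n) :=
    LinearEquiv.ofFinrankEq _ _ (by rw [hker, finrank_euclideanSpace_fin])
  set A : (Fin (n + 2) → ℝ) →L[ℝ] EuclideanSpace ℝ (Fin n) := LinearMap.toContinuousLinearMap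
    (iso.toLinearMap ∘ₗ Submodule.projectionOnto _ q hq) with hA
  have hAker : ∀ x, D x = 0 → A x = 0 → x = 0 := by
    intro x hx hAx
    have hx' : x ∈ LinearMap.ker (D : (Fin (n + 2) → ℝ) →ₗ[ℝ] ℝ × ℝ) := hx
    have h1 : iso (Submodule.projectionOnto _ q hq x) = 0 := hAx
    have h2 := Submodule.projectionOnto_apply_left hq ⟨x, hx'⟩
    rw [LinearEquiv.map_eq_zero_iff, h2] at h1
    exact congrArg Subtype.val h1
  have hdΦ : ∀ x ∈ O, DifferentiableAt ℝ Φ x := fun x hx =>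
    (hΦ.contDiffAt (hO.mem_nhds hx)).differentiableAt hne
  set P : (Fin (n + 2) → ℝ) → (ℝ × ℝ) × EuclideanSpace ℝ (Fin n) := fun x => (Φ x, A x) with hP
  have hPinj : Function.Injective (fderiv ℝ P p) := by
    have h1 : HasFDerivAt P (D.prod A) p := (hdΦ p hpO).hasFDerivAt.prodMk A.hasFDerivAt
    rw [h1.fderiv, injective_iff_map_eq_zero]
    intro x hx
    have := Prod.mk_eq_zero.1 hx
    exact hAker x this.1 this.2
  obtain ⟨φ, hφ1, hφ2, hφ3, hφ4⟩ := exists_openPartialHomeomorph hO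
    (F := P) (hΦ.prodMk A.contDiff.contDiffOn) hpO
    (isInvertible_of_injective hPinj (by simp [add_comm]))
  have hincl : Continuous fun u : EuclideanSpace ℝ (Fin n) => ((0 : ℝ × ℝ), u) := by fun_prop
  set U : Set (EuclideanSpace ℝ (Fin n)) := (fun u => ((0 : ℝ × ℝ), u)) ⁻¹' φ.target with hU
  set F : EuclideanSpace ℝ (Fin n) → (Fin (n + 2) → ℝ) := fun u => φ.symm (0, u) with hF
  have hUo : IsOpen U := φ.open_target.preimage hincl
  have hAF : ∀ u ∈ U, A (F u) = u ∧ Φ (F u) = 0 := by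
    intro u hu
    have h1 := φ.right_inv hu
    rw [hφ3] at h1
    exact ⟨congrArg Prod.snd h1, congrArg Prod.fst h1⟩
  have hFc : ContDiffOn ℝ ∞ F U := hφ4.comp (by fun_prop) fun u hu => hu
  have hpA : φ p = (0, A p) := by rw [hφ3, hP]; simp [hpΦ]
  refine ⟨U, F, hUo, ⟨A p, ?_, ?_⟩, hFc, ?_, ?_, ?_⟩
  · rw [hU, mem_preimage, ← hpA]
    exact φ.map_source hφ1
  · rw [hF]
    simp only
    rw [← hpA, φ.left_inv hφ1]
  · intro u hu
    have h1 : (fun u => A (F u)) =ᶠ[𝓝 u] id :=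
      Filter.mem_of_superset (hUo.mem_nhds hu) fun v hv => (hAF v hv).1
    have hFd : DifferentiableAt ℝ F u := (hFc.contDiffAt (hUo.mem_nhds hu)).differentiableAt hne
    have h2 := h1.fderiv_eq (𝕜 := ℝ)
    have h3 : HasFDerivAt (fun u => A (F u)) (A.comp (fderiv ℝ F u)) u :=
      A.hasFDerivAt.comp u hFd.hasFDerivAt
    rw [h3.fderiv, fderiv_id] at h2
    intro x y hxy
    have h4 : ∀ z, A (fderiv ℝ F u z) = z := fun z => by
      simpa using congrArg (fun T : EuclideanSpace ℝ (Fin n) →L[ℝ] _ => T z) h2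
    rw [← h4 x, ← h4 y, hxy]
  · intro u hu v hv huv
    rw [← (hAF u hu).1, ← (hAF v hv).1, huv]
  · intro W hWU hW
    refine ⟨φ.source ∩ A ⁻¹' W, φ.open_source.inter (hW.preimage A.continuous), ?_⟩
    ext x
    constructor
    · rintro ⟨u, hu, rfl⟩
      have h1 : F u ∈ φ.source := φ.map_target (hWU hu)
      refine ⟨?_, h1, ?_⟩
      · rw [hS]
        exact ⟨hφ2 h1, (hAF u (hWU hu)).2⟩
      · rw [mem_preimage, (hAF u (hWU hu)).1]
        exact hu
    · rintro ⟨hxS, hx1, hx2⟩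
      refine ⟨A x, hx2, ?_⟩
      have h1 : φ x = (0, A x) := by
        rw [hS] at hxS
        rw [hφ3, hP]; simp [hxS.2]
      rw [hF]
      simp only
      rw [← h1, φ.left_inv hx1]

/-! ### Curvature of warped metrics -/

section WarpedMetric

variable {n : ℕ}

/-- The metric `du_z² + ρ ∑_{i ≠ z} du_i²` on an open subset of `ℝⁿ`. -/
def warpedMetric (z : Fin n) (ρ : EuclideanSpace ℝ (Fin n) → ℝ) (v : EuclideanSpace ℝ (Fin n)) :
    Matrix (Fin n) (Fin n) ℝ :=
  Matrix.diagonal fun i => if i = z then 1 else ρ v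

variable {z : Fin n} {ρ : EuclideanSpace ℝ (Fin n) → ℝ} {w : Fin n → EuclideanSpace ℝ (Fin n) → ℝ}
  {O : Set (EuclideanSpace ℝ (Fin n))}

lemma pd_const {F : Type} [NormedAddCommGroup F] [NormedSpace ℝ F] (i : Fin n) (a : F)
    (u : EuclideanSpace ℝ (Fin n)) : pd i (fun _ => a) u = 0 := by
  simp [pd]

lemma pd_const_mul (i : Fin n) (a : ℝ) {b : EuclideanSpace ℝ (Fin n) → ℝ}
    {u : EuclideanSpace ℝ (Fin n)} (hb : DifferentiableAt ℝ b u) :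
    pd i (fun v => a * b v) u = a * pd i b u := by
  rw [pd, pd, fderiv_const_mul hb]; simp

lemma pd_mul (i : Fin n) {a b : EuclideanSpace ℝ (Fin n) → ℝ}
    {u : EuclideanSpace ℝ (Fin n)} (ha : DifferentiableAt ℝ a u) (hb : DifferentiableAt ℝ b u) :
    pd i (fun v => a v * b v) u = a u * pd i b u + b u * pd i a u := by
  rw [pd, pd, pd, fderiv_fun_mul ha hb]; simp

lemma pd_warpedMetric (i a b : Fin n) (v : EuclideanSpace ℝ (Fin n)) :
    pd i (fun v => warpedMetric z ρ v a b) v = if a = b ∧ a ≠ z then pd i ρ v else 0 := by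
  by_cases hab : a = b
  · subst hab
    by_cases ha : a = z
    · simp [warpedMetric, ha, pd_const]
    · have h : (fun v => warpedMetric z ρ v a a) = ρ := by
        ext v
        rw [warpedMetric, Matrix.diagonal_apply_eq, if_neg ha]
      rw [h, if_pos ⟨rfl, ha⟩]
  · simp [warpedMetric, hab, pd_const]

lemma warpedMetric_inv {v : EuclideanSpace ℝ (Fin n)} (hρ : 0 < ρ v) :
    (warpedMetric z ρ v)⁻¹ = Matrix.diagonal fun i => if i = z then 1 else (ρ v)⁻¹ := by
  refine Matrix.inv_eq_right_inv ?_
  rw [warpedMetric, Matrix.diagonal_mul_diagonal, ← Matrix.diagonal_one]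
  congr 1
  ext i
  by_cases hi : i = z <;> simp [hi, hρ.ne']

/-- The Christoffel symbols of a warped metric, in terms of the logarithmic derivatives
`w_i = ∂_i ρ / ρ`. -/
lemma christoffel_warpedMetric (hρ : ∀ v ∈ O, 0 < ρ v)
    (hw : ∀ i, ∀ v ∈ O, pd i ρ v = ρ v * w i v) {v : EuclideanSpace ℝ (Fin n)} (hv : v ∈ O)
    (l i j : Fin n) :
    christoffel (warpedMetric z ρ) l i j v =
      (1 / 2) * ((if j = l ∧ l ≠ z then w i v else 0) + (if i = l ∧ l ≠ z then w j v else 0)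
        - (if i = j ∧ i ≠ z then (if l = z then ρ v * w z v else w l v) else 0)) := by
  have hρv := (hρ v hv).ne'
  rw [christoffel, warpedMetric_inv (hρ v hv), Finset.sum_eq_single l]
  · simp only [pd_warpedMetric, Matrix.diagonal_apply_eq, hw _ v hv]
    congr 1
    by_cases hl : l = z
    · subst hl
      have h1 : ∀ a : Fin n, ¬(a = l ∧ a ≠ l) := fun a h => h.2 h.1
      simp [h1]
    · have h1 : ∀ a : Fin n, (a = l ∧ a ≠ z) ↔ (a = l ∧ l ≠ z) := fun a =>
        ⟨fun h => ⟨h.1, hl⟩, fun h => ⟨h.1, h.1 ▸ hl⟩⟩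
      simp only [h1, hl, if_false]
      rw [mul_sub, mul_add]
      simp only [mul_ite, mul_zero, inv_mul_cancel_left₀ hρv]
  · intro m _ hm
    rw [Matrix.diagonal_apply_ne' _ hm, zero_mul]
  · simp

lemma curvForm_single (G : EuclideanSpace ℝ (Fin n) → Matrix (Fin n) (Fin n) ℝ)
    (u : EuclideanSpace ℝ (Fin n)) (a b : Fin n) :
    curvForm G u (Pi.single a 1) (Pi.single b 1) = ∑ l, curvTensor G l b a b u * G u l a := by
  simp [curvForm, Pi.single_apply]

lemma metricAt_single (G : EuclideanSpace ℝ (Fin n) → Matrix (Fin n) (Fin n) ℝ)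
    (u : EuclideanSpace ℝ (Fin n)) (a b : Fin n) :
    metricAt G u (Pi.single a 1) (Pi.single b 1) = G u a b := by
  simp [metricAt, Pi.single_apply]

lemma linearIndependent_single {a b : Fin n} (hab : a ≠ b) :
    LinearIndependent ℝ ![(Pi.single a 1 : Fin n → ℝ), Pi.single b 1] := by
  rw [LinearIndependent.pair_iff]
  intro s t h
  have ha := congrFun h a
  have hb := congrFun h b
  simp [hab, hab.symm] at ha hb
  exact ⟨ha, hb⟩

/-- The curvature of the coordinate planes of a metric with all sectional curvatures equal. -/
lemma curvTensor_of_hasSectionalCurvatureAt {c : ℝ} {u : EuclideanSpace ℝ (Fin n)}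
    (hc : HasSectionalCurvatureAt (warpedMetric z ρ) c u) (hρ : 0 < ρ u) {a b : Fin n}
    (hab : a ≠ b) (hb : b ≠ z) : curvTensor (warpedMetric z ρ) a b a b u = c * ρ u := by
  have h := hc _ _ (linearIndependent_single hab)
  rw [curvForm_single, metricAt_single, metricAt_single, metricAt_single,
    Finset.sum_eq_single a] at h
  · have h1 : warpedMetric z ρ u a a ≠ 0 := by
      rw [warpedMetric, Matrix.diagonal_apply_eq]
      split_ifs
      · exact one_ne_zero
      · exact hρ.ne'
    have h2 : warpedMetric z ρ u b b = ρ u := by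
      rw [warpedMetric, Matrix.diagonal_apply_eq, if_neg hb]
    have h3 : warpedMetric z ρ u a b = 0 := Matrix.diagonal_apply_ne _ hab
    have := hρ.ne'
    rw [h2, h3] at h
    rw [← h]
    field_simp
    ring
  · intro l _ hl
    rw [warpedMetric, Matrix.diagonal_apply_ne _ hl, mul_zero]
  · simp

/-- The sectional curvature of a plane containing `∂_z`. -/
lemma radial_curvature (hO : IsOpen O) (hρ : ∀ v ∈ O, 0 < ρ v)
    (hρd : ∀ v ∈ O, DifferentiableAt ℝ ρ v) (hw : ∀ i, ∀ v ∈ O, pd i ρ v = ρ v * w i v)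
    (hwd : ∀ i, ∀ v ∈ O, DifferentiableAt ℝ (w i) v) {c : ℝ} {u : EuclideanSpace ℝ (Fin n)}
    (hu : u ∈ O) (hc : HasSectionalCurvatureAt (warpedMetric z ρ) c u) {b : Fin n} (hb : b ≠ z) :
    c = -(1 / 2) * pd z (w z) u - (1 / 4) * w z u ^ 2 := by
  have h := curvTensor_of_hasSectionalCurvatureAt hc (hρ u hu) hb.symm hb
  have hΓ := fun l i j v hv => christoffel_warpedMetric (z := z) hρ hw (v := v) hv l i j
  have h1 : christoffel (warpedMetric z ρ) z b b =ᶠ[𝓝 u] fun v => -(1 / 2) * (ρ v * w z v) :=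
    Filter.mem_of_superset (hO.mem_nhds hu) fun v hv => by
      simp only [mem_ofPred_eq, hΓ _ _ _ v hv]; simp [hb]
  have h2 : christoffel (warpedMetric z ρ) z z b =ᶠ[𝓝 u] fun v => 0 :=
    Filter.mem_of_superset (hO.mem_nhds hu) fun v hv => by
      simp only [mem_ofPred_eq, hΓ _ _ _ v hv]; simp [hb]
  have h3 : ∀ m, christoffel (warpedMetric z ρ) z z m u = 0 := fun m => by
    rw [hΓ _ _ _ u hu]; simp
  have h4 : ∀ m, christoffel (warpedMetric z ρ) m z b u * christoffel (warpedMetric z ρ) z b m u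
      = if m = b then -(1 / 4) * (ρ u * w z u ^ 2) else 0 := fun m => by
    rw [hΓ _ _ _ u hu, hΓ _ _ _ u hu]
    by_cases hm : m = b
    · subst hm; simp [hb, hb.symm]; ring
    · simp [hb, hb.symm, hm, Ne.symm hm]
  rw [curvTensor, pd_congr h1, pd_congr h2, pd_const,
    pd_const_mul _ _ ((hρd u hu).fun_mul (hwd z u hu)), pd_mul _ (hρd u hu) (hwd z u hu), hw z u hu]
    at h
  simp only [h3, h4, mul_zero, zero_sub, Finset.sum_neg_distrib, Finset.sum_ite_eq',
    Finset.mem_univ, if_true] at h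
  have := (hρ u hu).ne'
  apply mul_right_cancel₀ this
  rw [← h]; ring

/-- The sectional curvature of a coordinate plane orthogonal to `∂_z`. -/
lemma tangential_curvature (hO : IsOpen O) (hρ : ∀ v ∈ O, 0 < ρ v)
    (hw : ∀ i, ∀ v ∈ O, pd i ρ v = ρ v * w i v)
    (hwd : ∀ i, ∀ v ∈ O, DifferentiableAt ℝ (w i) v) {c : ℝ} {u : EuclideanSpace ℝ (Fin n)}
    (hu : u ∈ O) (hc : HasSectionalCurvatureAt (warpedMetric z ρ) c u) {a b : Fin n}
    (ha : a ≠ z) (hb : b ≠ z) (hab : a ≠ b) :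
    c * ρ u = -(1 / 2) * pd a (w a) u - (1 / 2) * pd b (w b) u - (1 / 4) * (ρ u * w z u ^ 2)
      + (1 / 4) * w a u ^ 2 + (1 / 4) * w b u ^ 2
      - (1 / 4) * ∑ m, if m = z then 0 else w m u ^ 2 := by
  have h := curvTensor_of_hasSectionalCurvatureAt hc (hρ u hu) hab hb
  have hΓ := fun l i j v hv => christoffel_warpedMetric (z := z) hρ hw (v := v) hv l i j
  have h1 : christoffel (warpedMetric z ρ) a b b =ᶠ[𝓝 u] fun v => -(1 / 2) * w a v :=
    Filter.mem_of_superset (hO.mem_nhds hu) fun v hv => by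
      simp only [mem_ofPred_eq, hΓ _ _ _ v hv]; simp [ha, hb, hab.symm]
  have h2 : christoffel (warpedMetric z ρ) a a b =ᶠ[𝓝 u] fun v => (1 / 2) * w b v :=
    Filter.mem_of_superset (hO.mem_nhds hu) fun v hv => by
      simp only [mem_ofPred_eq, hΓ _ _ _ v hv]; simp [ha, hab, hab.symm]
  have h3 : ∀ m, christoffel (warpedMetric z ρ) m b b u * christoffel (warpedMetric z ρ) a a m u
      - christoffel (warpedMetric z ρ) m a b u * christoffel (warpedMetric z ρ) a b m u
      = (if m = z then -(1 / 4) * (ρ u * w z u ^ 2) else 0)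
        + (if m = a then -(1 / 4) * w b u ^ 2 else 0)
        + (if m = b then (1 / 2) * w b u ^ 2 + (1 / 4) * w a u ^ 2 else 0)
        - (1 / 4) * (if m = z then 0 else w m u ^ 2) := fun m => by
    rw [hΓ _ _ _ u hu, hΓ _ _ _ u hu, hΓ _ _ _ u hu, hΓ _ _ _ u hu]
    by_cases hmz : m = z
    · subst hmz; simp [ha, hb, ha.symm, hb.symm, hab, hab.symm]; ring
    · by_cases hma : m = a
      · subst hma; simp [ha, hb, hab, hab.symm]; ring
      · by_cases hmb : m = b
        · subst hmb; simp [ha, hb, hab, hab.symm]; ring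
        · simp [ha, hb, hab, hmz, hma, hmb, Ne.symm hma, Ne.symm hmb]
          ring
  rw [curvTensor, pd_congr h1, pd_congr h2, pd_const_mul _ _ (hwd a u hu),
    pd_const_mul _ _ (hwd b u hu)] at h
  simp only [h3, Finset.sum_add_distrib, Finset.sum_sub_distrib, Finset.sum_ite_eq',
    Finset.mem_univ, if_true, ← Finset.mul_sum] at h
  rw [← h]; ring

end WarpedMetric

/-! ### Partial derivatives -/

section PartialDerivatives

variable {n : ℕ}

/-- The real function `f` is differentiable at `u` with partial derivatives `D i`. -/
def HasPartials (f : EuclideanSpace ℝ (Fin n) → ℝ) (D : Fin n → ℝ)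
    (u : EuclideanSpace ℝ (Fin n)) : Prop :=
  DifferentiableAt ℝ f u ∧ ∀ i, pd i f u = D i

variable {f g : EuclideanSpace ℝ (Fin n) → ℝ} {D D' : Fin n → ℝ} {u : EuclideanSpace ℝ (Fin n)}

lemma HasPartials.congr_partials (h : HasPartials f D u) (hD : ∀ i, D i = D' i) :
    HasPartials f D' u := ⟨h.1, fun i => (h.2 i).trans (hD i)⟩

lemma hasPartials_const (a : ℝ) : HasPartials (fun _ => a) (fun _ => 0) u :=
  ⟨differentiableAt_const a, fun i => pd_const i a u⟩

lemma hasPartials_coord (j : Fin n) :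
    HasPartials (fun v => v j) (fun i => if i = j then 1 else 0) u := by
  have h : HasFDerivAt (fun v : EuclideanSpace ℝ (Fin n) => v j)
      (EuclideanSpace.proj j : EuclideanSpace ℝ (Fin n) →L[ℝ] ℝ) u :=
    (EuclideanSpace.proj (𝕜 := ℝ) j).hasFDerivAt
  refine ⟨h.differentiableAt, fun i => ?_⟩
  rw [pd, h.fderiv]
  simp [eq_comm]

lemma HasPartials.add (hf : HasPartials f D u) (hg : HasPartials g D' u) :
    HasPartials (fun v => f v + g v) (fun i => D i + D' i) u := by
  refine ⟨hf.1.fun_add hg.1, fun i => ?_⟩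
  change _ = D i + D' i
  rw [← hf.2, ← hg.2, pd, fderiv_fun_add hf.1 hg.1]
  rfl

lemma HasPartials.mul (hf : HasPartials f D u) (hg : HasPartials g D' u) :
    HasPartials (fun v => f v * g v) (fun i => f u * D' i + g u * D i) u :=
  ⟨hf.1.fun_mul hg.1, fun i => by rw [pd_mul i hf.1 hg.1, hf.2, hg.2]⟩

lemma HasPartials.comp {φ : ℝ → ℝ} {φ' : ℝ} (hφ : HasDerivAt φ φ' (f u))
    (hf : HasPartials f D u) : HasPartials (fun v => φ (f v)) (fun i => φ' * D i) u := by
  have h := hφ.comp_hasFDerivAt u hf.1.hasFDerivAt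
  refine ⟨h.differentiableAt, fun i => ?_⟩
  have h2 : fderiv ℝ (fun v => φ (f v)) u = φ' • fderiv ℝ f u := h.fderiv
  change _ = φ' * D i
  rw [← hf.2, pd, pd, h2]
  rfl

lemma HasPartials.sum {ι : Type*} {s : Finset ι} {f : ι → EuclideanSpace ℝ (Fin n) → ℝ}
    {D : ι → Fin n → ℝ} (hf : ∀ j ∈ s, HasPartials (f j) (D j) u) :
    HasPartials (fun v => ∑ j ∈ s, f j v) (fun i => ∑ j ∈ s, D j i) u := by
  refine ⟨DifferentiableAt.fun_sum fun j hj => (hf j hj).1, fun i => ?_⟩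
  rw [pd, fderiv_fun_sum fun j hj => (hf j hj).1, sum_apply]
  exact Finset.sum_congr rfl fun j hj => (hf j hj).2 i

lemma hasPartials_comp_coord {φ : ℝ → ℝ} {φ' : ℝ} (z : Fin n) (hφ : HasDerivAt φ φ' (u z)) :
    HasPartials (fun v => φ (v z)) (fun i => if i = z then φ' else 0) u :=
  (HasPartials.comp hφ (hasPartials_coord z)).congr_partials fun i => by simp

end PartialDerivatives

/-! ### Parametrization of the orbits -/

section OrbitParam

variable {n : ℕ} (z : Fin n)

/-- The vector of `𝕃ⁿ⁺²` with coordinate `x₀` in the direction `∂/∂x₁` (when `z = 0`), `x₁` in the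
direction `∂/∂x_{n+1}`, `x₂` in the direction `∂/∂x_{n+2}`, and the remaining `n - 1` coordinates
those of `y`. -/
def frameVec (x₀ x₁ x₂ : ℝ) (y : Fin n → ℝ) : Fin (n + 2) → ℝ :=
  Fin.snoc (α := fun _ => ℝ) (Fin.snoc (α := fun _ => ℝ) (fun j => if j = z then x₀ else y j) x₁) x₂

@[simp] lemma frameVec_castSucc (x₀ x₁ x₂ : ℝ) (y : Fin n → ℝ) (j : Fin n) :
    frameVec z x₀ x₁ x₂ y j.castSucc.castSucc = if j = z then x₀ else y j := by
  rw [frameVec, Fin.snoc_castSucc, Fin.snoc_castSucc]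

@[simp] lemma frameVec_last_castSucc (x₀ x₁ x₂ : ℝ) (y : Fin n → ℝ) :
    frameVec z x₀ x₁ x₂ y (Fin.last n).castSucc = x₁ := by
  rw [frameVec, Fin.snoc_castSucc, Fin.snoc_last]

@[simp] lemma frameVec_last (x₀ x₁ x₂ : ℝ) (y : Fin n → ℝ) :
    frameVec z x₀ x₁ x₂ y (Fin.last (n + 1)) = x₂ := by
  rw [frameVec, Fin.snoc_last]

lemma mink_castSucc (x y : Fin (n + 2) → ℝ) :
    mink x y = (∑ i : Fin n, (if (i : ℕ) = 0 then -1 else 1)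
        * (x i.castSucc.castSucc * y i.castSucc.castSucc))
      + (if n = 0 then -1 else 1) * (x (Fin.last n).castSucc * y (Fin.last n).castSucc)
      + x (Fin.last (n + 1)) * y (Fin.last (n + 1)) := by
  rw [mink, Fin.sum_univ_castSucc, Fin.sum_univ_castSucc]
  simp

lemma mink_frameVec (hz : (z : ℕ) = 0) (x₀ x₁ x₂ x₀' x₁' x₂' : ℝ) (y y' : Fin n → ℝ) :
    mink (frameVec z x₀ x₁ x₂ y) (frameVec z x₀' x₁' x₂' y') =
      -(x₀ * x₀') + x₁ * x₁' + x₂ * x₂' + ∑ j, if j = z then 0 else y j * y' j := by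
  have hn : n ≠ 0 := by have := z.2; omega
  have h : ∀ i : Fin n, (if (i : ℕ) = 0 then (-1 : ℝ) else 1)
      * (frameVec z x₀ x₁ x₂ y i.castSucc.castSucc
        * frameVec z x₀' x₁' x₂' y' i.castSucc.castSucc)
      = (if i = z then -(x₀ * x₀') else 0) + if i = z then 0 else y i * y' i := by
    intro i
    rw [frameVec_castSucc, frameVec_castSucc]
    by_cases hi : i = z
    · simp [hi, hz]
    · have : (i : ℕ) ≠ 0 := fun h0 => hi (Fin.ext (h0.trans hz.symm))
      simp [hi, this]
  rw [mink_castSucc, Finset.sum_congr rfl fun i _ => h i, Finset.sum_add_distrib,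
    Finset.sum_ite_eq' Finset.univ z]
  simp [hn]
  ring

/-- The square of the distance to the `z`-axis. -/
def radiusSq (u : EuclideanSpace ℝ (Fin n)) : ℝ := ∑ j, if j = z then 0 else u j ^ 2

/-- The conformal factor of the stereographic coordinates of the space form of curvature `κ`. -/
def confFactor (κ : ℝ) (u : EuclideanSpace ℝ (Fin n)) : ℝ := (1 + κ / 4 * radiusSq z u)⁻¹

/-- The parametrization of the orbit of the curve `s ↦ a₀(s) ∂₁ + a₁(s) ∂_{n+1} + H(s) ∂_{n+2}`
by stereographic coordinates on the orbits of its points, which are space forms of curvature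
`κ / r²`, where `κ = ⟨q, q⟩` and `r = -⟨q, a⟩`. -/
def orbitParam (κ q₀ q₁ : ℝ) (a₀ a₁ r H : ℝ → ℝ) (u : EuclideanSpace ℝ (Fin n)) :
    Fin (n + 2) → ℝ :=
  frameVec z (a₀ (u z) + r (u z) * (confFactor z κ u * radiusSq z u) * (q₀ / 2))
    (a₁ (u z) + r (u z) * (confFactor z κ u * radiusSq z u) * (q₁ / 2)) (H (u z))
    fun j => r (u z) * confFactor z κ u * u j

variable {z} {κ q₀ q₁ : ℝ} {a₀ a₁ r H : ℝ → ℝ} {u : EuclideanSpace ℝ (Fin n)}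

lemma hasPartials_radiusSq : HasPartials (radiusSq z) (fun i => if i = z then 0 else 2 * u i) u := by
  have h : ∀ j ∈ Finset.univ, HasPartials (fun v : EuclideanSpace ℝ (Fin n) =>
      if j = z then 0 else v j ^ 2)
      (fun i => if j = z then 0 else if i = j then 2 * u j else 0) u := by
    intro j _
    by_cases hj : j = z
    · simpa [hj] using hasPartials_const 0
    · simp only [hj, if_false]
      exact hasPartials_comp_coord j (by simpa using hasDerivAt_pow 2 (u j))
  refine (HasPartials.sum h).congr_partials fun i => ?_
  rw [Finset.sum_eq_single i]
  · simp
  · intro j _ hj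
    simp [hj.symm]
  · simp

lemma hasPartials_confFactor (hu : 0 < 1 + κ / 4 * radiusSq z u) :
    HasPartials (confFactor z κ)
      (fun i => if i = z then 0 else -(κ / 2) * confFactor z κ u ^ 2 * u i) u := by
  have h1 : HasDerivAt (fun x : ℝ => (1 + κ / 4 * x)⁻¹) (-(κ / 4) / (1 + κ / 4 * radiusSq z u) ^ 2)
      (radiusSq z u) :=
    (((hasDerivAt_id (radiusSq z u)).const_mul (κ / 4)).const_add 1 |>.fun_inv hu.ne').congr_deriv (by
      simp only [mul_one, id_eq])
  refine (HasPartials.comp h1 hasPartials_radiusSq).congr_partials fun i => ?_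
  split_ifs
  · simp
  · rw [confFactor]; field_simp; ring

/-- The function `λ N`, where `λ` is the conformal factor and `N` the square of the distance. -/
lemma hasPartials_confFactor_mul (hu : 0 < 1 + κ / 4 * radiusSq z u) :
    HasPartials (fun v => confFactor z κ v * radiusSq z v)
      (fun i => if i = z then 0 else 2 * confFactor z κ u ^ 2 * u i) u := by
  refine ((hasPartials_confFactor hu).mul hasPartials_radiusSq).congr_partials fun i => ?_
  split_ifs
  · simp
  · rw [confFactor]; field_simp; ring

/-- The partial derivatives of the parametrization of an orbit. -/
lemma pd_orbitParam {a₀' a₁' r' H' : ℝ} (ha₀ : HasDerivAt a₀ a₀' (u z))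
    (ha₁ : HasDerivAt a₁ a₁' (u z)) (hr : HasDerivAt r r' (u z)) (hH : HasDerivAt H H' (u z))
    (hu : 0 < 1 + κ / 4 * radiusSq z u) :
    DifferentiableAt ℝ (orbitParam z κ q₀ q₁ a₀ a₁ r H) u ∧
    ∀ i, pd i (orbitParam z κ q₀ q₁ a₀ a₁ r H) u =
      if i = z then
        frameVec z (a₀' + r' * (confFactor z κ u * radiusSq z u) * (q₀ / 2))
          (a₁' + r' * (confFactor z κ u * radiusSq z u) * (q₁ / 2)) H'
          fun j => r' * confFactor z κ u * u j
      else
        frameVec z (r (u z) * confFactor z κ u ^ 2 * u i * q₀)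
          (r (u z) * confFactor z κ u ^ 2 * u i * q₁) 0
          fun j => r (u z) * ((if i = j then confFactor z κ u else 0)
            - κ / 2 * confFactor z κ u ^ 2 * u i * u j) := by
  have hA : ∀ {a : ℝ → ℝ} {a' : ℝ} (q : ℝ), HasDerivAt a a' (u z) → HasPartials
      (fun v => a (v z) + r (v z) * (confFactor z κ v * radiusSq z v) * (q / 2))
      (fun i => if i = z then a' + r' * (confFactor z κ u * radiusSq z u) * (q / 2)
        else r (u z) * confFactor z κ u ^ 2 * u i * q) u := by
    intro a a' q ha
    refine ((hasPartials_comp_coord z ha).add (((hasPartials_comp_coord z hr).mul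
      (hasPartials_confFactor_mul hu)).mul (hasPartials_const (q / 2)))).congr_partials fun i => ?_
    by_cases hi : i = z
    · simp [hi]; ring
    · simp [hi]; ring
  have hB : ∀ j, j ≠ z → HasPartials (fun v => r (v z) * confFactor z κ v * v j)
      (fun i => if i = z then r' * confFactor z κ u * u j else
        r (u z) * ((if i = j then confFactor z κ u else 0)
            - κ / 2 * confFactor z κ u ^ 2 * u i * u j)) u := by
    intro j hj
    refine (((hasPartials_comp_coord z hr).mul (hasPartials_confFactor hu)).mul
      (hasPartials_coord j)).congr_partials fun i => ?_
    by_cases hi : i = z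
    · simp [hi, hj.symm]; ring
    · by_cases hij : i = j
      · simp [hij, hj]; ring
      · simp [hi, hij]; ring
  have key : ∀ m : Fin (n + 2), HasPartials (fun v => orbitParam z κ q₀ q₁ a₀ a₁ r H v m)
      (fun i => (if i = z then
        frameVec z (a₀' + r' * (confFactor z κ u * radiusSq z u) * (q₀ / 2))
          (a₁' + r' * (confFactor z κ u * radiusSq z u) * (q₁ / 2)) H'
          (fun j => r' * confFactor z κ u * u j)
      else
        frameVec z (r (u z) * confFactor z κ u ^ 2 * u i * q₀)
          (r (u z) * confFactor z κ u ^ 2 * u i * q₁) 0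
          (fun j => r (u z) * ((if i = j then confFactor z κ u else 0)
            - κ / 2 * confFactor z κ u ^ 2 * u i * u j))) m) u := by
    intro m
    simp only [orbitParam]
    refine Fin.lastCases ?_ (fun m => Fin.lastCases ?_ (fun j => ?_) m) m
    · simp only [frameVec_last]
      refine (hasPartials_comp_coord z hH).congr_partials fun i => ?_
      by_cases hi : i = z <;> simp [hi]
    · simp only [frameVec_last_castSucc]
      refine (hA q₁ ha₁).congr_partials fun i => ?_
      by_cases hi : i = z <;> simp [hi]
    · simp only [frameVec_castSucc]
      by_cases hj : j = z
      · simp only [hj, if_true]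
        refine (hA q₀ ha₀).congr_partials fun i => ?_
        by_cases hi : i = z <;> simp [hi]
      · simp only [hj, if_false]
        refine (hB j hj).congr_partials fun i => ?_
        by_cases hi : i = z <;> simp [hi, hj]
  have hd : DifferentiableAt ℝ (orbitParam z κ q₀ q₁ a₀ a₁ r H) u :=
    differentiableAt_pi.2 fun m => (key m).1
  refine ⟨hd, fun i => ?_⟩
  ext m
  have h := (key m).2 i
  simp only at h
  rw [← h, pd, pd, (hasFDerivAt_pi'.1 hd.hasFDerivAt m).fderiv]
  rfl

lemma sum_mul_coord (a b : ℝ) (u : EuclideanSpace ℝ (Fin n)) :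
    (∑ j, if j = z then 0 else a * u j * (b * u j)) = a * b * radiusSq z u := by
  rw [radiusSq, Finset.mul_sum]
  refine Finset.sum_congr rfl fun j _ => ?_
  split_ifs <;> ring

lemma sum_mul_coord_sub (a l b : ℝ) (u : EuclideanSpace ℝ (Fin n)) {i : Fin n} (hi : i ≠ z) :
    (∑ j, if j = z then 0 else a * u j * ((if i = j then l else 0) - b * u i * u j))
      = a * u i * (l - b * radiusSq z u) := by
  have h : ∀ j, (if j = z then 0 else a * u j * ((if i = j then l else 0) - b * u i * u j))
      = (if i = j then a * u i * l else 0)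
        - a * b * u i * (if j = z then 0 else u j ^ 2) := by
    intro j
    by_cases hj : j = z
    · simp [hj, hi]
    · by_cases hij : i = j
      · simp [hj, hij]; ring
      · simp [hj, hij]; ring
  rw [Finset.sum_congr rfl fun j _ => h j, Finset.sum_sub_distrib, ← Finset.mul_sum,
    Finset.sum_ite_eq, if_pos (Finset.mem_univ i), radiusSq]
  ring

lemma sum_sub_mul_sub (l b : ℝ) (u : EuclideanSpace ℝ (Fin n)) {i k : Fin n} (hi : i ≠ z)
    (hk : k ≠ z) :
    (∑ j, if j = z then 0 else ((if i = j then l else 0) - b * u i * u j)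
        * ((if k = j then l else 0) - b * u k * u j))
      = (if i = k then l ^ 2 else 0) - 2 * l * b * u i * u k + b ^ 2 * u i * u k * radiusSq z u := by
  have h : ∀ j, (if j = z then 0 else ((if i = j then l else 0) - b * u i * u j)
        * ((if k = j then l else 0) - b * u k * u j))
      = (if i = j then (if i = k then l ^ 2 else 0) - l * b * u i * u k else 0)
        - (if k = j then l * b * u i * u k else 0)
        + b ^ 2 * u i * u k * (if j = z then 0 else u j ^ 2) := by
    intro j
    by_cases hj : j = z
    · simp [hj, hi, hk]
    · by_cases hij : i = j
      · subst hij
        by_cases hki : k = i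
        · subst hki; simp [hj]; ring
        · simp [hj, hki, Ne.symm hki]; ring
      · by_cases hkj : k = j
        · subst hkj; simp [hj, hij]; ring
        · simp [hj, hij, hkj]; ring
  rw [Finset.sum_congr rfl fun j _ => h j, Finset.sum_add_distrib, Finset.sum_sub_distrib,
    ← Finset.mul_sum, Finset.sum_ite_eq, Finset.sum_ite_eq, if_pos (Finset.mem_univ i),
    if_pos (Finset.mem_univ k), radiusSq]
  ring

/-- In the coordinates of `orbitParam` the induced metric is a warped product. -/
lemma inducedMetric_orbitParam (hz : (z : ℕ) = 0) (hq : -q₀ ^ 2 + q₁ ^ 2 = κ)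
    {a₀' a₁' r' H' : ℝ} (ha₀ : HasDerivAt a₀ a₀' (u z))
    (ha₁ : HasDerivAt a₁ a₁' (u z)) (hr : HasDerivAt r r' (u z)) (hH : HasDerivAt H H' (u z))
    (hu : 0 < 1 + κ / 4 * radiusSq z u) (hqa : q₀ * a₀' - q₁ * a₁' = r')
    (hunit : -a₀' ^ 2 + a₁' ^ 2 + H' ^ 2 = 1) :
    inducedMetric (orbitParam z κ q₀ q₁ a₀ a₁ r H) u
      = warpedMetric z (fun v => (r (v z) * confFactor z κ v) ^ 2) u := by
  obtain ⟨-, hpd⟩ := pd_orbitParam (q₀ := q₀) (q₁ := q₁) ha₀ ha₁ hr hH hu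
  have hl : confFactor z κ u * (1 + κ / 4 * radiusSq z u) = 1 := inv_mul_cancel₀ hu.ne'
  set l := confFactor z κ u with hldef
  set N := radiusSq z u with hN
  have hzi : ∀ k, k ≠ z → inducedMetric (orbitParam z κ q₀ q₁ a₀ a₁ r H) u z k = 0 := by
    intro k hk
    rw [inducedMetric, Matrix.of_apply, hpd, hpd, if_pos rfl, if_neg hk, mink_frameVec z hz]
    have h := sum_mul_coord_sub (z := z) (r' * l * r (u z)) l (κ / 2 * l ^ 2) u hk
    have h' : (∑ j, if j = z then 0 else r' * l * u j *
        (r (u z) * ((if k = j then l else 0) - κ / 2 * l ^ 2 * u k * u j)))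
        = r' * l * r (u z) * u k * (l - κ / 2 * l ^ 2 * N) := by
      rw [← h]
      refine Finset.sum_congr rfl fun j _ => ?_
      split_ifs <;> ring
    rw [h']
    linear_combination -(r (u z) * l ^ 2 * u k) * hqa + r (u z) * l ^ 2 * u k * r' * l * N / 2 * hq
  ext i k
  by_cases hi : i = z
  · by_cases hk : k = z
    · subst hi
      rw [hk, inducedMetric, Matrix.of_apply, hpd, if_pos rfl, mink_frameVec i hz, sum_mul_coord,
        warpedMetric, Matrix.diagonal_apply_eq, if_pos rfl, ← hN]
      linear_combination hunit - r' * l * N * hqa + r' ^ 2 * l ^ 2 * N ^ 2 / 4 * hq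
        + r' ^ 2 * l * N * hl
    · rw [hi, hzi k hk, warpedMetric, Matrix.diagonal_apply_ne _ (Ne.symm hk)]
  · by_cases hk : k = z
    · have : inducedMetric (orbitParam z κ q₀ q₁ a₀ a₁ r H) u i k
          = inducedMetric (orbitParam z κ q₀ q₁ a₀ a₁ r H) u k i := by
        rw [inducedMetric, Matrix.of_apply, Matrix.of_apply, mink_comm]
      rw [this, hk, hzi i hi, warpedMetric, Matrix.diagonal_apply_ne _ hi]
    · rw [inducedMetric, Matrix.of_apply, hpd, hpd, if_neg hi, if_neg hk, mink_frameVec z hz]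
      have h := sum_sub_mul_sub (z := z) l (κ / 2 * l ^ 2) u hi hk
      have h' : (∑ j, if j = z then 0 else
          r (u z) * ((if i = j then l else 0) - κ / 2 * l ^ 2 * u i * u j) *
          (r (u z) * ((if k = j then l else 0) - κ / 2 * l ^ 2 * u k * u j)))
          = r (u z) ^ 2 * ((if i = k then l ^ 2 else 0) - 2 * l * (κ / 2 * l ^ 2) * u i * u k
            + (κ / 2 * l ^ 2) ^ 2 * u i * u k * N) := by
        rw [← h, Finset.mul_sum]
        refine Finset.sum_congr rfl fun j _ => ?_
        split_ifs <;> ring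
      rw [h', warpedMetric]
      by_cases hik : i = k
      · subst hik
        rw [if_pos rfl, Matrix.diagonal_apply_eq, if_neg hi]
        linear_combination r (u z) ^ 2 * u i * u i * l ^ 4 * hq + r (u z) ^ 2 * u i * u i * l ^ 3 * κ * hl
      · rw [if_neg hik, Matrix.diagonal_apply_ne _ hik]
        linear_combination r (u z) ^ 2 * u i * u k * l ^ 4 * hq + r (u z) ^ 2 * u i * u k * l ^ 3 * κ * hl

end OrbitParam

/-! ### The differential equation of the profile -/

section ProfileODE

variable {n : ℕ} {z : Fin n}

lemma hasDerivAt_of_contDiffOn {g : ℝ → ℝ} {J : Set ℝ} (hJ : IsOpen J) (hg : ContDiffOn ℝ ∞ g J)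
    {s : ℝ} (hs : s ∈ J) : HasDerivAt g (deriv g s) s :=
  ((hg.contDiffAt (hJ.mem_nhds hs)).differentiableAt (by simp)).hasDerivAt

lemma contDiffOn_deriv {g : ℝ → ℝ} {J : Set ℝ} (hJ : IsOpen J) (hg : ContDiffOn ℝ ∞ g J) :
    ContDiffOn ℝ ∞ (deriv g) J := hg.deriv_of_isOpen hJ (by norm_cast)

lemma radiusSq_nonneg (u : EuclideanSpace ℝ (Fin n)) : 0 ≤ radiusSq z u :=
  Finset.sum_nonneg fun j _ => by split_ifs <;> positivity

lemma contDiff_radiusSq : ContDiff ℝ ∞ (radiusSq z) := by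
  refine ContDiff.sum fun j _ => ?_
  split_ifs <;> fun_prop

/-- The domain of the parametrization `orbitParam` of the part of an orbit over `J`. -/
def orbitDomain (z : Fin n) (κ : ℝ) (J : Set ℝ) : Set (EuclideanSpace ℝ (Fin n)) :=
  {u | u z ∈ J ∧ 0 < 1 + κ / 4 * radiusSq z u}

variable {κ q₀ q₁ : ℝ} {a₀ a₁ r H : ℝ → ℝ} {J : Set ℝ}

lemma isOpen_orbitDomain (hJ : IsOpen J) : IsOpen (orbitDomain z κ J) := by
  have h := (contDiff_radiusSq (z := z)).continuous
  have h1 : IsOpen {u : EuclideanSpace ℝ (Fin n) | 0 < 1 + κ / 4 * radiusSq z u} :=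
    isOpen_lt continuous_const (by fun_prop)
  have h2 : IsOpen {u : EuclideanSpace ℝ (Fin n) | u z ∈ J} := hJ.preimage (by fun_prop)
  exact h2.inter h1

lemma exists_mem_orbitDomain (κ : ℝ) {s : ℝ} (hs : s ∈ J) : ∃ u ∈ orbitDomain z κ J, u z = s := by
  refine ⟨EuclideanSpace.single z s, ⟨by simpa using hs, ?_⟩, by simp⟩
  have : radiusSq z (EuclideanSpace.single z s) = 0 :=
    Finset.sum_eq_zero fun j _ => by by_cases hj : j = z <;> simp [hj]
  rw [this]; norm_num

lemma contDiffOn_orbitParam (ha₀ : ContDiffOn ℝ ∞ a₀ J) (ha₁ : ContDiffOn ℝ ∞ a₁ J)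
    (hr : ContDiffOn ℝ ∞ r J) (hH : ContDiffOn ℝ ∞ H J) :
    ContDiffOn ℝ ∞ (orbitParam z κ q₀ q₁ a₀ a₁ r H) (orbitDomain z κ J) := by
  have hc : ∀ {g : ℝ → ℝ}, ContDiffOn ℝ ∞ g J →
      ContDiffOn ℝ ∞ (fun u : EuclideanSpace ℝ (Fin n) => g (u z)) (orbitDomain z κ J) :=
    fun hg => hg.comp (by fun_prop) fun u hu => hu.1
  have hN : ContDiffOn ℝ ∞ (radiusSq z) (orbitDomain z κ J) := contDiff_radiusSq.contDiffOn
  have hl : ContDiffOn ℝ ∞ (confFactor z κ) (orbitDomain z κ J) :=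
    ContDiffOn.inv (contDiffOn_const.add (contDiffOn_const.mul hN)) fun u hu => hu.2.ne'
  refine contDiffOn_pi.2 fun m => ?_
  simp only [orbitParam]
  refine Fin.lastCases ?_ (fun m => Fin.lastCases ?_ (fun j => ?_) m) m
  · simpa only [frameVec_last] using hc hH
  · simp only [frameVec_last_castSucc]
    exact (hc ha₁).add (((hc hr).mul (hl.mul hN)).mul contDiffOn_const)
  · simp only [frameVec_castSucc]
    split_ifs
    · exact (hc ha₀).add (((hc hr).mul (hl.mul hN)).mul contDiffOn_const)
    · exact ((hc hr).mul hl).mul (by fun_prop)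

lemma injective_fderiv_of_inducedMetric {F : EuclideanSpace ℝ (Fin n) → (Fin (n + 2) → ℝ)}
    {ρ : EuclideanSpace ℝ (Fin n) → ℝ} {u : EuclideanSpace ℝ (Fin n)}
    (h : inducedMetric F u = warpedMetric z ρ u) (hρ : 0 < ρ u) :
    Function.Injective (fderiv ℝ F u) := by
  rw [injective_iff_map_eq_zero]
  intro x hx
  ext k
  have hxs : x = ∑ i, x i • EuclideanSpace.single i (1 : ℝ) := by
    ext j; simp [Pi.single_apply]
  have h1 : mink (fderiv ℝ F u x) (pd k F u) = x k * warpedMetric z ρ u k k := by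
    have h2 : mink (fderiv ℝ F u x) (pd k F u) = ∑ i, x i * inducedMetric F u i k := by
      rw [hxs, map_sum]
      have := map_sum (minkForm (pd k F u))
        (fun i => fderiv ℝ F u (x i • EuclideanSpace.single i (1 : ℝ))) Finset.univ
      refine this.trans (Finset.sum_congr rfl fun i _ => ?_)
      rw [← hxs, map_smul]
      exact mink_smul_left _ _ _
    rw [h2, h, Finset.sum_eq_single k]
    · intro i _ hi
      rw [warpedMetric, Matrix.diagonal_apply_ne _ hi, mul_zero]
    · simp
  rw [hx, mink_zero_left] at h1
  have h2 : warpedMetric z ρ u k k ≠ 0 := by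
    rw [warpedMetric, Matrix.diagonal_apply_eq]
    split_ifs
    · exact one_ne_zero
    · exact hρ.ne'
  simpa [h2] using h1.symm

/-- The curvature of a hypersurface parametrized by `orbitParam` determines the radius `r` of its
orbits up to first order data: `r'' = -c r` and `r'² = κ - c r²`. -/
lemma ode_of_hasSectionalCurvatureAt (hn : 3 ≤ n) (hJ : IsOpen J) (hr : ContDiffOn ℝ ∞ r J)
    (hrpos : ∀ s ∈ J, 0 < r s) {c : ℝ} {u : EuclideanSpace ℝ (Fin n)}
    (hu : u ∈ orbitDomain z κ J)
    (hc : HasSectionalCurvatureAt (warpedMetric z fun v => (r (v z) * confFactor z κ v) ^ 2) c u) :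
    deriv (deriv r) (u z) = -c * r (u z) ∧ deriv r (u z) ^ 2 = κ - c * r (u z) ^ 2 := by
  set ρ : EuclideanSpace ℝ (Fin n) → ℝ := fun v => (r (v z) * confFactor z κ v) ^ 2 with hρdef
  set w : Fin n → EuclideanSpace ℝ (Fin n) → ℝ := fun i v =>
    if i = z then 2 * (deriv r (v z) * (r (v z))⁻¹) else -κ * (confFactor z κ v * v i) with hwdef
  have hl : ∀ v ∈ orbitDomain z κ J, 0 < confFactor z κ v := fun v hv => inv_pos.2 hv.2
  have hρ : ∀ v ∈ orbitDomain z κ J, 0 < ρ v := fun v hv =>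
    pow_pos (mul_pos (hrpos _ hv.1) (hl v hv)) 2
  have hρp : ∀ v ∈ orbitDomain z κ J, HasPartials ρ (fun i => ρ v * w i v) v := by
    intro v hv
    have h1 := ((hasPartials_comp_coord z (hasDerivAt_of_contDiffOn hJ hr hv.1)).mul
      (hasPartials_confFactor hv.2))
    refine (HasPartials.comp (by simpa using hasDerivAt_pow 2 (r (v z) * confFactor z κ v))
      h1).congr_partials fun i => ?_
    have := (hrpos _ hv.1).ne'
    by_cases hi : i = z
    · simp only [hi, if_true, hρdef, hwdef]
      field_simp
      ring
    · simp only [hi, if_false, hρdef, hwdef]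
      ring
  have hwz : HasPartials (w z) (fun i => if i = z then
      2 * (deriv (deriv r) (u z) * (r (u z))⁻¹ - deriv r (u z) ^ 2 * (r (u z))⁻¹ ^ 2) else 0) u ∧
      ∀ v ∈ orbitDomain z κ J, DifferentiableAt ℝ (w z) v := by
    have key : ∀ v ∈ orbitDomain z κ J, HasPartials (w z) (fun i => if i = z then
      2 * (deriv (deriv r) (v z) * (r (v z))⁻¹ - deriv r (v z) ^ 2 * (r (v z))⁻¹ ^ 2) else 0) v := by
      intro v hv
      have h1 := hasDerivAt_of_contDiffOn hJ hr hv.1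
      have h2 := hasDerivAt_of_contDiffOn hJ (contDiffOn_deriv hJ hr) hv.1
      have h3 : HasDerivAt (fun s => 2 * (deriv r s * (r s)⁻¹))
          (2 * (deriv (deriv r) (v z) * (r (v z))⁻¹ - deriv r (v z) ^ 2 * (r (v z))⁻¹ ^ 2)) (v z) := by
        refine ((h2.fun_mul (h1.fun_inv (hrpos _ hv.1).ne')).const_mul 2).congr_deriv ?_
        have := (hrpos _ hv.1).ne'
        field_simp
        ring
      simpa only [hwdef, if_true] using hasPartials_comp_coord z h3
    exact ⟨key u hu, fun v hv => (key v hv).1⟩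
  have hwi : ∀ i, i ≠ z → ∀ v ∈ orbitDomain z κ J, HasPartials (w i) (fun k =>
      -κ * (confFactor z κ v * (if k = i then 1 else 0)
        + v i * (if k = z then 0 else -(κ / 2) * confFactor z κ v ^ 2 * v k))) v := by
    intro i hi v hv
    have h := (hasPartials_const (-κ)).mul
      ((hasPartials_confFactor hv.2).mul (hasPartials_coord i))
    simp only [hwdef, hi, if_false]
    exact h.congr_partials fun k => by ring
  have hwd : ∀ i, ∀ v ∈ orbitDomain z κ J, DifferentiableAt ℝ (w i) v := by
    intro i v hv
    by_cases hi : i = z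
    · rw [hi]; exact hwz.2 v hv
    · exact (hwi i hi v hv).1
  have hO := isOpen_orbitDomain (z := z) (κ := κ) hJ
  have hr0 := (hrpos _ hu.1).ne'
  -- Since `n ≥ 3`, there are two coordinates different from `z`.
  obtain ⟨a, ha, b, hb, hab⟩ : ∃ a, a ≠ z ∧ ∃ b, b ≠ z ∧ a ≠ b := by
    have h1 : 1 < (Finset.univ.erase z).card := by
      rw [Finset.card_erase_of_mem (Finset.mem_univ _), Finset.card_univ, Fintype.card_fin]; omega
    obtain ⟨a, ha, b, hb, hab⟩ := Finset.one_lt_card.1 h1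
    exact ⟨a, Finset.ne_of_mem_erase ha, b, Finset.ne_of_mem_erase hb, hab⟩
  have hrad := radial_curvature hO hρ (fun v hv => (hρp v hv).1) (fun i v hv => (hρp v hv).2 i) hwd
    hu hc ha
  have htan := tangential_curvature hO hρ (fun i v hv => (hρp v hv).2 i) hwd hu hc ha hb hab
  rw [hwz.1.2 z] at hrad
  simp only [if_true] at hrad
  have hwzu : w z u = 2 * (deriv r (u z) * (r (u z))⁻¹) := by simp only [hwdef, if_true]
  have hwiu : ∀ i, i ≠ z → w i u = -κ * (confFactor z κ u * u i) := fun i hi => by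
    simp only [hwdef, hi, if_false]
  have hsum : (∑ m, if m = z then 0 else w m u ^ 2)
      = κ ^ 2 * confFactor z κ u ^ 2 * radiusSq z u := by
    rw [radiusSq, Finset.mul_sum]
    refine Finset.sum_congr rfl fun m _ => ?_
    split_ifs with hm
    · simp
    · rw [hwiu m hm]; ring
  rw [hsum, (hwi a ha u hu).2 a, (hwi b hb u hu).2 b, hwzu, hwiu a ha, hwiu b hb] at htan
  simp only [if_true, if_neg ha, if_neg hb] at htan
  rw [hwzu] at hrad
  have hlu := hl u hu
  have hlN : confFactor z κ u * (1 + κ / 4 * radiusSq z u) = 1 := inv_mul_cancel₀ hu.2.ne'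
  constructor
  · rw [hrad]; field_simp; ring
  · have h1 : ρ u = r (u z) ^ 2 * confFactor z κ u ^ 2 := by rw [hρdef]; ring
    rw [h1] at htan
    have h2 : c * r (u z) ^ 2 * confFactor z κ u ^ 2
        = (κ - deriv r (u z) ^ 2) * confFactor z κ u ^ 2 := by
      rw [mul_assoc, htan]
      field_simp
      linear_combination (-16) * κ * hlN
    have h3 := mul_right_cancel₀ (pow_pos hlu 2).ne' h2
    linarith

/-! ### Axes in normal position -/

/-- The sign of the curvature of the orbits: for an axis spanned by `∂/∂x_{n+2}` and `v`, it is the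
sign of `-⟨v, v⟩`. -/
def RotationType.sign : RotationType → ℝ
  | .spherical => 1
  | .hyperbolic => -1
  | .parabolic => 0

/-- The vector that spans, together with `∂/∂x_{n+2}`, the axis of the rotation hypersurfaces in
normal position. -/
def RotationType.axisVec (n : ℕ) : RotationType → (Fin (n + 2) → ℝ)
  | .spherical => -coordVec n 0
  | .hyperbolic => coordVec n (Fin.last n).castSucc
  | .parabolic => nullVecTwo n

lemma coordVec_zero_eq (hz : (z : ℕ) = 0) : coordVec n 0 = frameVec z 1 0 0 0 := by
  ext m
  refine Fin.lastCases ?_ (fun m => Fin.lastCases ?_ (fun j => ?_) m) m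
  · rw [frameVec_last, coordVec, Pi.single_eq_of_ne]
    exact (Fin.last_pos).ne'
  · rw [frameVec_last_castSucc, coordVec, Pi.single_eq_of_ne]
    intro h
    have := congrArg Fin.val h
    have := z.2
    simp at *
    omega
  · rw [frameVec_castSucc]
    by_cases hj : j = z
    · have : j.castSucc.castSucc = (0 : Fin (n + 2)) := by
        ext; simp [hj, hz]
      rw [this, coordVec, Pi.single_eq_same, if_pos hj]
    · rw [if_neg hj, coordVec, Pi.single_eq_of_ne]
      · rfl
      · intro h
        apply hj
        have := congrArg Fin.val h
        ext
        simpa [hz] using this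

lemma coordVec_last_castSucc_eq : coordVec n (Fin.last n).castSucc = frameVec z 0 1 0 0 := by
  ext m
  refine Fin.lastCases ?_ (fun m => Fin.lastCases ?_ (fun j => ?_) m) m
  · rw [frameVec_last, coordVec, Pi.single_eq_of_ne]
    exact (Fin.castSucc_ne_last _).symm
  · rw [frameVec_last_castSucc, coordVec, Pi.single_eq_same]
  · rw [frameVec_castSucc, coordVec, Pi.single_eq_of_ne]
    · simp
    · intro h
      have := Fin.castSucc_injective _ h
      exact Fin.castSucc_ne_last _ this

lemma smul_frameVec (c x₀ x₁ x₂ : ℝ) (y : Fin n → ℝ) :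
    c • frameVec z x₀ x₁ x₂ y = frameVec z (c * x₀) (c * x₁) (c * x₂) (c • y) := by
  ext m
  refine Fin.lastCases ?_ (fun m => Fin.lastCases ?_ (fun j => ?_) m) m
  · simp
  · simp
  · simp [mul_ite]

lemma frameVec_add (x₀ x₁ x₂ x₀' x₁' x₂' : ℝ) (y y' : Fin n → ℝ) :
    frameVec z x₀ x₁ x₂ y + frameVec z x₀' x₁' x₂' y'
      = frameVec z (x₀ + x₀') (x₁ + x₁') (x₂ + x₂') (y + y') := by
  ext m
  refine Fin.lastCases ?_ (fun m => Fin.lastCases ?_ (fun j => ?_) m) m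
  · simp
  · simp
  · by_cases hj : j = z <;> simp [hj]

lemma nullVecTwo_eq (hz : (z : ℕ) = 0) :
    nullVecTwo n = frameVec z (-(1 / √2)) (-(1 / √2)) 0 0 := by
  rw [nullVecTwo, coordVec_zero_eq hz, coordVec_last_castSucc_eq (z := z), frameVec_add,
    smul_frameVec]
  simp

/-- The plane of `∂/∂x₁` and `∂/∂x_{n+1}` contains a curve `(a₀, a₁)` with `⟨a, v⟩ = y`, where `v` is
the axis vector of the given type, and a vector `(q₀, q₁)` orthogonal to `v` with `⟨q, a⟩ = -r`. -/
lemma exists_planar_profile (τ : RotationType) (hz : (z : ℕ) = 0) {y : ℝ → ℝ} (hJ : IsOpen J)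
    (hy : ContDiffOn ℝ ∞ y J) (hr : ContDiffOn ℝ ∞ r J) (hrpos : ∀ s ∈ J, 0 < r s)
    (hry : ∀ s ∈ J, r s ^ 2 = y s ^ 2 - τ.sign) (hpos : τ ≠ .hyperbolic → ∀ s ∈ J, 0 < y s)
    (hunit : ∀ s ∈ J, deriv y s ^ 2 = r s ^ 2 * (1 - deriv H s ^ 2)) :
    ∃ (v₀ v₁ q₀ q₁ : ℝ) (a₀ a₁ : ℝ → ℝ), τ.axisVec n = frameVec z v₀ v₁ 0 0 ∧
      ContDiffOn ℝ ∞ a₀ J ∧ ContDiffOn ℝ ∞ a₁ J ∧ -q₀ ^ 2 + q₁ ^ 2 = τ.sign ∧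
      -(q₀ * v₀) + q₁ * v₁ = 0 ∧ 0 ≤ q₀ ∧
      ∀ s ∈ J, -(a₀ s * v₀) + a₁ s * v₁ = y s ∧ q₀ * a₀ s - q₁ * a₁ s = r s ∧
        -a₀ s ^ 2 + a₁ s ^ 2 = -1 ∧ 0 < a₀ s ∧ q₀ * deriv a₀ s - q₁ * deriv a₁ s = deriv r s ∧
        -deriv a₀ s ^ 2 + deriv a₁ s ^ 2 + deriv H s ^ 2 = 1 := by
  have hyd := fun s hs => hasDerivAt_of_contDiffOn (s := s) hJ hy hs
  have hrd := fun s hs => hasDerivAt_of_contDiffOn (s := s) hJ hr hs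
  have hryd : ∀ s ∈ J, r s * deriv r s = y s * deriv y s := by
    intro s hs
    have h1 : HasDerivAt (fun s => r s ^ 2) (2 * r s * deriv r s) s := by
      simpa using (hrd s hs).fun_pow 2
    have h2 : HasDerivAt (fun s => y s ^ 2 - τ.sign) (2 * y s * deriv y s) s := by
      simpa using ((hyd s hs).fun_pow 2).sub_const τ.sign
    have h3 : (fun s => r s ^ 2) =ᶠ[𝓝 s] fun s => y s ^ 2 - τ.sign :=
      Filter.mem_of_superset (hJ.mem_nhds hs) hry
    have := (h2.congr_of_eventuallyEq h3).unique h1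
    linarith
  cases τ with
  | spherical =>
    refine ⟨-1, 0, 0, -1, y, r, ?_, hy, hr, by simp [RotationType.sign], by simp, le_rfl,
      fun s hs => ⟨by ring, by ring, ?_, hpos (by simp) s hs, by ring, ?_⟩⟩
    · rw [RotationType.axisVec, coordVec_zero_eq hz, ← neg_one_smul ℝ, smul_frameVec]
      simp
    · have := hry s hs
      simp only [RotationType.sign] at this
      linarith
    · have h1 := hry s hs
      have h2 := hryd s hs
      have h3 := hunit s hs
      have h4 := hrpos s hs
      simp only [RotationType.sign] at h1
      have h5 : r s ^ 2 * (-deriv y s ^ 2 + deriv r s ^ 2 + deriv H s ^ 2) = r s ^ 2 * 1 := by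
        linear_combination (r s * deriv r s + y s * deriv y s) * h2 - deriv y s ^ 2 * h1 + h3
      exact mul_left_cancel₀ (pow_pos h4 2).ne' h5
  | hyperbolic =>
    refine ⟨0, 1, 1, 0, r, y, ?_, hr, hy, by simp [RotationType.sign], by simp, zero_le_one,
      fun s hs => ⟨by ring, by ring, ?_, hrpos s hs, by ring, ?_⟩⟩
    · rw [RotationType.axisVec, coordVec_last_castSucc_eq (z := z)]
    · have := hry s hs
      simp only [RotationType.sign] at this
      linarith
    · have h1 := hry s hs
      have h2 := hryd s hs
      have h3 := hunit s hs
      have h4 := hrpos s hs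
      simp only [RotationType.sign] at h1
      have h5 : r s ^ 2 * (-deriv r s ^ 2 + deriv y s ^ 2 + deriv H s ^ 2) = r s ^ 2 * 1 := by
        linear_combination -(r s * deriv r s + y s * deriv y s) * h2 + deriv y s ^ 2 * h1 + h3
      exact mul_left_cancel₀ (pow_pos h4 2).ne' h5
  | parabolic =>
    have hy0 : ∀ s ∈ J, 0 < y s := hpos (by simp)
    have hyr : ∀ s ∈ J, r s = y s := by
      intro s hs
      have h1 := hry s hs
      simp only [RotationType.sign, sub_zero] at h1
      exact (pow_left_inj₀ (hrpos s hs).le (hy0 s hs).le two_ne_zero).1 h1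
    have h2 : (√2 : ℝ) ^ 2 = 2 := Real.sq_sqrt (by norm_num)
    have h2' : (√2 : ℝ) ≠ 0 := by positivity
    have hd0 : ∀ s ∈ J, HasDerivAt (fun s => (y s + (2 * y s)⁻¹) / √2)
        ((deriv y s - deriv y s / (2 * y s ^ 2)) / √2) s := by
      intro s hs
      have h0 := (hy0 s hs).ne'
      refine (((hyd s hs).fun_add (((hyd s hs).const_mul 2).fun_inv (by positivity))).div_const
        √2).congr_deriv ?_
      field_simp
      ring
    have hd1 : ∀ s ∈ J, HasDerivAt (fun s => (-y s + (2 * y s)⁻¹) / √2)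
        ((-deriv y s - deriv y s / (2 * y s ^ 2)) / √2) s := by
      intro s hs
      have h0 := (hy0 s hs).ne'
      refine (((hyd s hs).fun_neg.fun_add (((hyd s hs).const_mul 2).fun_inv (by positivity))).div_const
        √2).congr_deriv ?_
      field_simp
      ring
    refine ⟨-(1 / √2), -(1 / √2), 1 / √2, 1 / √2, fun s => (y s + (2 * y s)⁻¹) / √2,
      fun s => (-y s + (2 * y s)⁻¹) / √2, nullVecTwo_eq hz, ?_, ?_, by simp [RotationType.sign],
      by ring, by positivity, fun s hs => ?_⟩
    · exact (hy.add (ContDiffOn.inv (contDiffOn_const.mul hy)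
        fun s hs => (mul_pos two_pos (hy0 s hs)).ne')).div_const _
    · exact (hy.neg.add (ContDiffOn.inv (contDiffOn_const.mul hy)
        fun s hs => (mul_pos two_pos (hy0 s hs)).ne')).div_const _
    · rw [(hd0 s hs).deriv, (hd1 s hs).deriv]
      have h0 := hy0 s hs
      have hrd' : deriv r s = deriv y s := by
        have h3 := hryd s hs
        rw [hyr s hs] at h3
        exact mul_left_cancel₀ h0.ne' h3
      have h3 := hunit s hs
      rw [hyr s hs] at h3
      rw [hyr s hs, hrd']
      refine ⟨?_, ?_, ?_, by positivity, ?_, ?_⟩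
      · field_simp; rw [h2]; ring
      · field_simp; rw [h2]; ring
      · field_simp; rw [h2]; ring
      · field_simp; rw [h2]; ring
      · field_simp; rw [h2]
        field_simp at h3
        linear_combination 8 * y s ^ 2 * h3

/-- The parametrization of the orbits takes values in `ℍⁿ × ℝ`, with the inner product with the axis
vector and the height of the profile. -/
lemma orbitParam_mem {v₀ v₁ : ℝ} (hz : (z : ℕ) = 0) (hq : -q₀ ^ 2 + q₁ ^ 2 = κ)
    (hqv : -(q₀ * v₀) + q₁ * v₁ = 0) (hq₀ : 0 ≤ q₀) {u : EuclideanSpace ℝ (Fin n)}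
    (hu : u ∈ orbitDomain z κ J) (hr : 0 < r (u z))
    (hqa : q₀ * a₀ (u z) - q₁ * a₁ (u z) = r (u z)) (ha : -a₀ (u z) ^ 2 + a₁ (u z) ^ 2 = -1)
    (ha₀ : 0 < a₀ (u z)) :
    orbitParam z κ q₀ q₁ a₀ a₁ r H u ∈ hypProd n ∧
      mink (orbitParam z κ q₀ q₁ a₀ a₁ r H u) (frameVec z v₀ v₁ 0 0)
        = -(a₀ (u z) * v₀) + a₁ (u z) * v₁ ∧
      orbitParam z κ q₀ q₁ a₀ a₁ r H u (Fin.last (n + 1)) = H (u z) := by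
  have hl : confFactor z κ u * (1 + κ / 4 * radiusSq z u) = 1 := inv_mul_cancel₀ hu.2.ne'
  have hl0 : 0 < confFactor z κ u := inv_pos.2 hu.2
  have hN := radiusSq_nonneg (z := z) u
  refine ⟨mem_hypProd.2 ⟨?_, ?_⟩, ?_, ?_⟩
  · rw [orbitParam, mink_frameVec z hz, frameVec_last, sum_mul_coord]
    set l := confFactor z κ u
    set N := radiusSq z u
    linear_combination ha - r (u z) * l * N * hqa + r (u z) ^ 2 * l ^ 2 * N ^ 2 / 4 * hq
        + r (u z) ^ 2 * l * N * hl
  · have : (0 : Fin (n + 2)) = z.castSucc.castSucc := by ext; simp [hz]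
    rw [orbitParam, this, frameVec_castSucc, if_pos rfl]
    positivity
  · rw [orbitParam, mink_frameVec z hz]
    simp only [Pi.zero_apply, mul_zero, ite_self, Finset.sum_const_zero]
    linear_combination r (u z) * (confFactor z κ u * radiusSq z u) / 2 * hqv
  · rw [orbitParam, frameVec_last]

/-- The differential equation of the profile `(y, H)` of a rotation hypersurface of constant
sectional curvature `c`, away from the axis. -/
lemma profile_ode {M : Type*} [TopologicalSpace M] [T2Space M] [SecondCountableTopology M]
    [ChartedSpace (EuclideanSpace ℝ (Fin n)) M]
    [IsManifold 𝓘(ℝ, EuclideanSpace ℝ (Fin n)) ∞ M] {f : M → (Fin (n + 2) → ℝ)}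
    (hn : 3 ≤ n) (hf : IsHypersurface f) {c : ℝ} (hc : HasConstSectionalCurvature f c)
    (τ : RotationType) {y : ℝ → ℝ} (hJ : IsOpen J)
    (hy : ContDiffOn ℝ ∞ y J) (hH : ContDiffOn ℝ ∞ H J) (hr : ContDiffOn ℝ ∞ r J)
    (hrpos : ∀ s ∈ J, 0 < r s)
    (hry : ∀ s ∈ J, r s ^ 2 = y s ^ 2 - τ.sign) (hpos : τ ≠ .hyperbolic → ∀ s ∈ J, 0 < y s)
    (hunit : ∀ s ∈ J, deriv y s ^ 2 = r s ^ 2 * (1 - deriv H s ^ 2))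
    (hran : ∀ x ∈ hypProd n, ∀ s ∈ J, mink x (τ.axisVec n) = y s →
      x (Fin.last (n + 1)) = H s → x ∈ range f) :
    ∀ s ∈ J, deriv (deriv r) s = -c * r s ∧ deriv r s ^ 2 = τ.sign - c * r s ^ 2 := by
  set z : Fin n := ⟨0, by omega⟩ with hzdef
  have hz : (z : ℕ) = 0 := rfl
  obtain ⟨v₀, v₁, q₀, q₁, a₀, a₁, hv, ha₀, ha₁, hq, hqv, hq₀, hs⟩ :=
    exists_planar_profile τ hz hJ hy hr hrpos hry hpos hunit
  have hmem : ∀ u ∈ orbitDomain z τ.sign J,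
      orbitParam z τ.sign q₀ q₁ a₀ a₁ r H u ∈ range f := by
    intro u hu
    obtain ⟨h1, h2, h3, h4, -, -⟩ := hs _ hu.1
    obtain ⟨h5, h6, h7⟩ := orbitParam_mem (H := H) hz hq hqv hq₀ hu (hrpos _ hu.1) h2 h3 h4
    exact hran _ h5 _ hu.1 (by rw [hv, h6, h1]) h7
  have hmetric : ∀ u ∈ orbitDomain z τ.sign J,
      inducedMetric (orbitParam z τ.sign q₀ q₁ a₀ a₁ r H) u
        = warpedMetric z (fun v => (r (v z) * confFactor z τ.sign v) ^ 2) u := by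
    intro u hu
    obtain ⟨-, -, -, -, h5, h6⟩ := hs _ hu.1
    exact inducedMetric_orbitParam hz hq (hasDerivAt_of_contDiffOn hJ ha₀ hu.1)
      (hasDerivAt_of_contDiffOn hJ ha₁ hu.1) (hasDerivAt_of_contDiffOn hJ hr hu.1)
      (hasDerivAt_of_contDiffOn hJ hH hu.1) hu.2 h5 h6
  have hpos' : ∀ u ∈ orbitDomain z τ.sign J, 0 < (r (u z) * confFactor z τ.sign u) ^ 2 :=
    fun u hu => pow_pos (mul_pos (hrpos _ hu.1) (inv_pos.2 hu.2)) 2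
  -- The equation holds on a dense subset of `J`, hence on `J`.
  set E : ℝ → ℝ := fun s => (deriv (deriv r) s + c * r s) ^ 2
    + (deriv r s ^ 2 - τ.sign + c * r s ^ 2) ^ 2 with hE
  have hEc : ContinuousOn E J := by
    have h0 := hr.continuousOn
    have h1 := (contDiffOn_deriv hJ hr).continuousOn
    have h2 := (contDiffOn_deriv hJ (contDiffOn_deriv hJ hr)).continuousOn
    fun_prop
  have hE0 : ∀ s ∈ J, E s = 0 := by
    intro s hsJ
    by_contra hne
    have hJ' : IsOpen (J ∩ E ⁻¹' {0}ᶜ) := hEc.isOpen_inter_preimage hJ isOpen_compl_singleton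
    obtain ⟨u₀, hu₀, -⟩ := exists_mem_orbitDomain (z := z) τ.sign (J := J ∩ E ⁻¹' {0}ᶜ) ⟨hsJ, hne⟩
    have hsub : orbitDomain z τ.sign (J ∩ E ⁻¹' {0}ᶜ) ⊆ orbitDomain z τ.sign J :=
      fun u hu => ⟨hu.1.1, hu.2⟩
    obtain ⟨u, hu, hcu⟩ := exists_hasSectionalCurvatureAt hf hc
      (isOpen_orbitDomain (z := z) (κ := τ.sign) hJ') ⟨u₀, hu₀⟩
      ((contDiffOn_orbitParam (q₀ := q₀) (q₁ := q₁) ha₀ ha₁ hr hH).mono hsub)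
      (fun u hu => injective_fderiv_of_inducedMetric (hmetric u (hsub hu)) (hpos' u (hsub hu)))
      (fun u hu => hmem u (hsub hu))
    obtain ⟨h1, h2⟩ := ode_of_hasSectionalCurvatureAt hn hJ hr hrpos (hsub hu)
      (hcu.congr (Filter.mem_of_superset ((isOpen_orbitDomain hJ).mem_nhds (hsub hu)) hmetric))
    refine hu.1.2 ?_
    simp only [hE, h1, h2, mem_singleton_iff]
    ring
  intro s hsJ
  have h := hE0 s hsJ
  simp only [hE] at h
  have h1 := (add_eq_zero_iff_of_nonneg (sq_nonneg _) (sq_nonneg _)).1 h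
  have h2 := pow_eq_zero_iff (two_ne_zero) |>.1 h1.1
  have h3 := pow_eq_zero_iff (two_ne_zero) |>.1 h1.2
  constructor <;> linarith

end ProfileODE

/-! ### Reduction of a rotation hypersurface to a profile in normal position -/

section Reduction

variable {n : ℕ}

lemma mink_nullVecTwo (x : Fin (n + 2) → ℝ) (hn : n ≠ 0) :
    mink x (nullVecTwo n) = (x 0 - x (Fin.last n).castSucc) / √2 := by
  rw [nullVecTwo, mink_smul_right, mink_add_right, mink_coordVec, mink_coordVec]
  simp [hn]
  ring

lemma mink_axisVec_self (hn : n ≠ 0) (τ : RotationType) :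
    mink (τ.axisVec n) (τ.axisVec n) = -τ.sign := by
  set z : Fin n := ⟨0, by omega⟩
  have hz : (z : ℕ) = 0 := rfl
  cases τ with
  | spherical =>
    rw [RotationType.axisVec, mink_neg_left, mink_neg_right, coordVec_zero_eq hz, mink_frameVec z hz]
    simp [RotationType.sign]
  | hyperbolic =>
    rw [RotationType.axisVec, coordVec_last_castSucc_eq (z := z), mink_frameVec z hz]
    simp [RotationType.sign]
  | parabolic =>
    rw [RotationType.axisVec, nullVecTwo_eq hz, mink_frameVec z hz]
    simp [RotationType.sign]

lemma axisVec_last (hn : n ≠ 0) (τ : RotationType) : τ.axisVec n (Fin.last (n + 1)) = 0 := by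
  set z : Fin n := ⟨0, by omega⟩
  have hz : (z : ℕ) = 0 := rfl
  cases τ with
  | spherical => rw [RotationType.axisVec, coordVec_zero_eq hz]; simp
  | hyperbolic => rw [RotationType.axisVec, coordVec_last_castSucc_eq (z := z), frameVec_last]
  | parabolic => rw [RotationType.axisVec, nullVecTwo_eq hz, frameVec_last]

lemma sq_lt_of_mem_hypProd (hn : n ≠ 0) {x : Fin (n + 2) → ℝ} (hx : x ∈ hypProd n) :
    x (Fin.last n).castSucc ^ 2 < x 0 ^ 2 := by
  obtain ⟨i, hi⟩ := Fin.exists_succ_eq.2 (show Fin.last n ≠ 0 from fun h => hn (by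
    simpa using congrArg Fin.val h))
  have h := sq_le_mink_self_add_sq (Fin.init x : Fin (n + 1) → ℝ) i
  have h1 := (mem_hypSpace_succ.1 hx).1
  rw [hi, h1] at h
  have h2 : (Fin.init x : Fin (n + 1) → ℝ) (Fin.last n) = x (Fin.last n).castSucc := rfl
  have h3 : (Fin.init x : Fin (n + 1) → ℝ) 0 = x 0 := rfl
  rw [h2, h3] at h
  linarith

lemma mink_axisVec_pos (hn : n ≠ 0) {τ : RotationType} (hτ : τ ≠ .hyperbolic)
    {x : Fin (n + 2) → ℝ} (hx : x ∈ hypProd n) : 0 < mink x (τ.axisVec n) := by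
  have h0 := (mem_hypProd.1 hx).2
  cases τ with
  | spherical =>
    rw [RotationType.axisVec, mink_neg_right, mink_coordVec]
    simpa using h0
  | hyperbolic => exact absurd rfl hτ
  | parabolic =>
    rw [RotationType.axisVec, mink_nullVecTwo x hn]
    have := abs_lt_of_sq_lt_sq (sq_lt_of_mem_hypProd hn hx) h0.le
    have := (abs_lt.1 this).2
    have : 0 < x 0 - x (Fin.last n).castSucc := by linarith
    positivity

/-- A nonzero vector orthogonal to a time-like vector is space-like. -/
lemma mink_self_pos_of_orthogonal {N : ℕ} {v w : Fin (N + 1) → ℝ} (hv : mink v v = -1) (hw : w ≠ 0)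
    (hvw : mink w v = 0) : 0 < mink w w := by
  by_contra hle
  have h := sq_mink_add_le w v
  have hv0 := mink_self_add_sq_nonneg v
  rw [hv, hvw] at h
  rw [hv] at hv0
  have h1 : (-1 + v 0 ^ 2) * mink w w ≤ 0 := mul_nonpos_of_nonneg_of_nonpos hv0 (not_lt.1 hle)
  have h2 : w 0 ^ 2 ≤ 0 := by nlinarith
  exact hw (eq_zero_of_mink_self (not_lt.1 hle)
    (pow_eq_zero_iff two_ne_zero |>.1 (le_antisymm h2 (sq_nonneg _))))

/-- The axis is spanned by `∂/∂x_{n+2}` and a vector of `𝕃ⁿ⁺¹`. -/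
lemma exists_axis_generator {P2 : Submodule ℝ (Fin (n + 2) → ℝ)} (h2 : Module.finrank ℝ P2 = 2)
    (hvert : vertVec n ∈ P2) :
    ∃ v ∈ P2, v ≠ 0 ∧ v (Fin.last (n + 1)) = 0 ∧
      ∀ w ∈ P2, ∃ a b : ℝ, w = a • v + b • vertVec n := by
  have hlt : Submodule.span ℝ {vertVec n} < P2 := by
    refine lt_of_le_of_ne ((Submodule.span_singleton_le_iff_mem _ _).2 hvert) fun h => ?_
    have h1 := finrank_span_le_card (R := ℝ) ({vertVec n} : Set (Fin (n + 2) → ℝ))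
    rw [h, h2] at h1
    simp at h1
  obtain ⟨u, hu, hu'⟩ := SetLike.exists_of_lt hlt
  have hvP : u - u (Fin.last (n + 1)) • vertVec n ∈ P2 := P2.sub_mem hu (P2.smul_mem _ hvert)
  refine ⟨u - u (Fin.last (n + 1)) • vertVec n, hvP, ?_, by simp [vertVec_last], ?_⟩
  · intro h
    exact hu' (Submodule.mem_span_singleton.2 ⟨_, (sub_eq_zero.1 h).symm⟩)
  · have hlt2 : Submodule.span ℝ {vertVec n}
        < Submodule.span ℝ {u - u (Fin.last (n + 1)) • vertVec n, vertVec n} := by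
      refine lt_of_le_of_ne (Submodule.span_mono (by simp)) fun h => hu' ?_
      have h1 : u - u (Fin.last (n + 1)) • vertVec n ∈ Submodule.span ℝ {vertVec n} := by
        rw [h]; exact Submodule.subset_span (by simp)
      have h3 := Submodule.add_mem _ h1 (Submodule.smul_mem _ (u (Fin.last (n + 1)))
        (Submodule.mem_span_singleton_self (vertVec n)))
      simpa using h3
    have hvert0 : vertVec n ≠ 0 := fun h => by
      have := vertVec_last (n := n); rw [h] at this; simp at this
    have h3 := Submodule.finrank_lt_finrank_of_lt hlt2
    rw [finrank_span_singleton hvert0] at h3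
    have h4 : Submodule.span ℝ {u - u (Fin.last (n + 1)) • vertVec n, vertVec n} = P2 := by
      refine Submodule.eq_of_le_of_finrank_le (Submodule.span_le.2 ?_) (by omega)
      rintro x (rfl | rfl)
      · exact hvP
      · exact hvert
    intro w hw
    rw [← h4, Submodule.mem_span_pair] at hw
    obtain ⟨a, b, h⟩ := hw
    exact ⟨a, b, h.symm⟩

/-- The causal character of the axis is that of its generator in `𝕃ⁿ⁺¹`. -/
lemma RotationType.Axis.mink_generator {τ : RotationType} {P2 : Submodule ℝ (Fin (n + 2) → ℝ)}
    (hτ : τ.Axis P2) {v : Fin (n + 2) → ℝ} (hv : v ∈ P2) (hv0 : v ≠ 0)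
    (hvl : v (Fin.last (n + 1)) = 0) (hvert : vertVec n ∈ P2)
    (hspan : ∀ w ∈ P2, ∃ a b : ℝ, w = a • v + b • vertVec n) :
    ∃ t : ℝ, 0 < t ∧ mink v v = -τ.sign * t := by
  have hvv : mink v (vertVec n) = 0 := by rw [mink_vertVec, hvl]
  have hee : mink (vertVec n) (vertVec n) = 1 := by rw [mink_vertVec, vertVec_last]
  cases τ with
  | spherical =>
    obtain ⟨w, hw, hneg⟩ := hτ
    obtain ⟨a, b, rfl⟩ := hspan w hw
    refine ⟨-mink v v, ?_, by simp [RotationType.sign]⟩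
    simp only [mink_add_left, mink_add_right, mink_smul_left, mink_smul_right, hvv, hee,
      mink_comm (vertVec n) v] at hneg
    by_contra h
    have h' : 0 ≤ mink v v := by linarith [not_lt.1 h]
    nlinarith [mul_nonneg (sq_nonneg a) h', sq_nonneg b]
  | hyperbolic => exact ⟨mink v v, hτ v hv hv0, by simp [RotationType.sign]⟩
  | parabolic =>
    refine ⟨1, one_pos, ?_⟩
    obtain ⟨w, hw, hw0, hort⟩ := hτ
    obtain ⟨a, b, rfl⟩ := hspan w hw
    have h1 := hort _ hvert
    have h2 := hort _ hv
    simp only [mink_add_left, mink_smul_left, hvv, hee, mink_comm (vertVec n) v] at h1 h2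
    have hb : b = 0 := by linarith
    have ha : a ≠ 0 := by
      rintro rfl
      exact hw0 (by simp [hb])
    rw [hb] at h2
    simp only [zero_mul, add_zero, mul_eq_zero, ha, false_or] at h2
    simp [RotationType.sign, h2]

/-- A suitable multiple of the generator of the axis is mapped to the axis vector in normal position
by an isometry. For a hyperbolic axis both signs are possible. -/
lemma exists_isometry_axisVec (hn : n ≠ 0) {τ : RotationType} {v : Fin (n + 2) → ℝ} (hv0 : v ≠ 0)
    (hvl : v (Fin.last (n + 1)) = 0) {t : ℝ} (ht : 0 < t) (hvv : mink v v = -τ.sign * t)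
    (ε : ℝ) (hε : ε = 1 ∨ ε = -1) :
    ∃ (a : ℝ) (g : (Fin (n + 2) → ℝ) ≃ₗ[ℝ] (Fin (n + 2) → ℝ)), a ≠ 0 ∧
      (τ = .hyperbolic → 0 < ε * a) ∧ PreservesHypProd n g ∧ g (a • v) = τ.axisVec n ∧
      g (vertVec n) = vertVec n := by
  have hal := axisVec_last hn τ
  have haa := mink_axisVec_self hn τ
  have hl : ∀ a : ℝ, (a • v) (Fin.last (n + 1)) = 0 := fun a => by simp [hvl]
  have hst : √t ^ 2 = t := Real.sq_sqrt ht.le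
  have hst0 : √t ≠ 0 := (Real.sqrt_pos.2 ht).ne'
  cases τ with
  | spherical =>
    simp only [RotationType.sign] at hvv haa
    -- The multiple of `v` that is a past-directed unit vector.
    obtain ⟨a, ha, hva, hv0⟩ : ∃ a : ℝ, a ≠ 0 ∧ mink (a • v) (a • v) = -1 ∧ (a • v) 0 < 0 := by
      have hne : v 0 ≠ 0 := by
        intro h
        have := mink_self_add_sq_nonneg v
        rw [h, hvv] at this
        linarith
      have h1 : ∀ e : ℝ, e ^ 2 = 1 → mink ((e / √t) • v) ((e / √t) • v) = -1 := by
        intro e he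
        rw [mink_smul_left, mink_smul_right, hvv]
        field_simp
        rw [hst, he]; ring
      rcases hne.lt_or_gt with h | h
      · refine ⟨1 / √t, by positivity, h1 1 (by norm_num), ?_⟩
        rw [Pi.smul_apply, smul_eq_mul]
        exact mul_neg_of_pos_of_neg (by positivity) h
      · refine ⟨-1 / √t, by simp [hst0], h1 (-1) (by norm_num), ?_⟩
        rw [Pi.smul_apply, smul_eq_mul]
        exact mul_neg_of_neg_of_pos (div_neg_of_neg_of_pos (by norm_num) (by positivity)) h
    have hmem : ∀ x : Fin (n + 2) → ℝ, mink x x = -1 → x (Fin.last (n + 1)) = 0 → x 0 < 0 →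
        -x ∈ hypProd n := by
      intro x h1 h2 h3
      rw [mem_hypProd]
      simp [mink_neg_left, mink_neg_right, h1, h2, h3]
    have ha0 : RotationType.spherical.axisVec n 0 < 0 := by simp [RotationType.axisVec, coordVec]
    obtain ⟨g, hg1, hg2, hg3⟩ := exists_isometry_map_eq_of_sub (hl a) hal (hva.trans haa.symm) (by
      by_cases hne : a • v = RotationType.spherical.axisVec n
      · exact Or.inl hne
      · right
        have h1 := hmem _ haa hal ha0
        have h2 := hmem _ hva (hl a) hv0
        have hne' : (Fin.init (-RotationType.spherical.axisVec n) : Fin (n + 1) → ℝ)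
            ≠ Fin.init (-(a • v)) := by
          intro h
          apply hne
          have : -RotationType.spherical.axisVec n = -(a • v) := by
            ext i
            refine Fin.lastCases ?_ (fun i => ?_) i
            · rw [Pi.neg_apply, Pi.neg_apply, hal, hl a]
            · exact congrFun h i
          exact (neg_injective this).symm
        have h3 := mink_sub_self_pos h1 h2 hne'
        rw [← init_sub] at h3
        rw [mink_init, Pi.sub_apply, hl a, hal]
        have h4 : a • v - RotationType.spherical.axisVec n
            = -RotationType.spherical.axisVec n - -(a • v) := by abel
        rw [h4]
        linarith)
    exact ⟨a, g, ha, by simp, hg1, hg2, hg3⟩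
  | hyperbolic =>
    simp only [RotationType.sign] at hvv haa
    have hε2 : ε ^ 2 = 1 := by rcases hε with rfl | rfl <;> norm_num
    have hε0 : ε ≠ 0 := by rcases hε with rfl | rfl <;> norm_num
    have hva : mink ((ε / √t) • v) ((ε / √t) • v) = 1 := by
      rw [mink_smul_left, mink_smul_right, hvv]
      field_simp
      rw [hst, hε2]; ring
    set v' := (ε / √t) • v with hv'
    set e := RotationType.hyperbolic.axisVec n with he
    have hee : mink e e = 1 := by rw [haa]; norm_num
    have hnl : (-e) (Fin.last (n + 1)) = 0 := by rw [Pi.neg_apply, hal, neg_zero]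
    have hnn : mink (-e) (-e) = 1 := by rw [mink_neg_left, mink_neg_right, hee, neg_neg]
    have hpos : 0 < ε * (ε / √t) := by
      have : ε * (ε / √t) = ε ^ 2 / √t := by ring
      rw [this, hε2]; positivity
    rcases le_or_gt (mink v' e) 0 with hle | hgt
    · obtain ⟨g, hg1, hg2, hg3⟩ := exists_isometry_map_eq_of_sub (hl (ε / √t)) hal
        (hva.trans hee.symm) (by
          right
          rw [mink_sub_left, mink_sub_right, mink_sub_right, mink_comm e, hva, hee]
          linarith)
      exact ⟨ε / √t, g, by positivity, fun _ => hpos, hg1, hg2, hg3⟩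
    · obtain ⟨g, hg1, hg2, hg3⟩ := exists_isometry_map_eq_of_sub (hl (ε / √t)) hnl
        (hva.trans hnn.symm) (by
          right
          rw [mink_sub_left, mink_sub_right, mink_sub_right, mink_comm (-e) v', hva, hnn,
            mink_neg_right]
          linarith)
      obtain ⟨g', hg1', hg2', hg3'⟩ := exists_isometry_map_eq_of_sub hnl hal
        (hnn.trans hee.symm) (by
          right
          rw [mink_sub_left, mink_sub_right, mink_sub_right, mink_neg_left, mink_neg_right, hee]
          norm_num [mink_neg_left, hee])
      exact ⟨ε / √t, g.trans g', by positivity, fun _ => hpos, hg1.trans hg1', by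
        rw [LinearEquiv.trans_apply, hg2, hg2'], by rw [LinearEquiv.trans_apply, hg3, hg3']⟩
  | parabolic =>
    simp only [RotationType.sign, neg_zero, zero_mul] at hvv haa
    -- Light-like vectors with the same first coordinate have a space-like difference.
    have hne : v 0 ≠ 0 := fun h => hv0 (eq_zero_of_mink_self hvv.le h)
    have he0 : RotationType.parabolic.axisVec n 0 = -(1 / √2) := by
      have : (0 : Fin (n + 2)) ≠ (Fin.last n).castSucc := by
        intro h; have := congrArg Fin.val h; simp at this; omega
      simp [RotationType.axisVec, nullVecTwo, coordVec, this]
    have ha : -(1 / √2) / v 0 ≠ 0 := div_ne_zero (by simp) hne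
    obtain ⟨g, hg1, hg2, hg3⟩ := exists_isometry_map_eq_of_sub (hl (-(1 / √2) / v 0)) hal
      (by rw [mink_smul_left, mink_smul_right, hvv, haa]; ring) (by
        by_cases hne' : (-(1 / √2) / v 0) • v = RotationType.parabolic.axisVec n
        · exact Or.inl hne'
        · right
          by_contra hle
          refine hne' (sub_eq_zero.1 (eq_zero_of_mink_self (not_lt.1 hle) ?_))
          rw [Pi.sub_apply, he0, Pi.smul_apply, smul_eq_mul, div_mul_cancel₀ _ hne, sub_self])
    exact ⟨_, g, ha, by simp, hg1, hg2, hg3⟩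

/-- The Gram determinant of `a, a', v` vanishes when these vectors lie in a plane; here `a` is the
part of `x` in `𝕃ⁿ⁺¹`. -/
lemma gram_relation {P3 : Submodule ℝ (Fin (n + 2) → ℝ)} (h3 : Module.finrank ℝ P3 = 3)
    {x x' v : Fin (n + 2) → ℝ} (hx : x ∈ P3) (hx' : x' ∈ P3) (hv : v ∈ P3) (hvert : vertVec n ∈ P3)
    (hvl : v (Fin.last (n + 1)) = 0) (hxx : mink x x = -1 + x (Fin.last (n + 1)) ^ 2)
    (hxx' : mink x x' = x (Fin.last (n + 1)) * x' (Fin.last (n + 1))) (hx'x' : mink x' x' = 1) :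
    mink x' v ^ 2 = (mink x v ^ 2 + mink v v) * (1 - x' (Fin.last (n + 1)) ^ 2) := by
  have hdep : ¬LinearIndependent ℝ ![(⟨x, hx⟩ : P3), ⟨x', hx'⟩, ⟨v, hv⟩, ⟨vertVec n, hvert⟩] := by
    intro h
    have := h.fintype_card_le_finrank
    rw [h3] at this
    simp at this
  obtain ⟨k, hk, i, hi⟩ := Fintype.not_linearIndependent_iff.1 hdep
  simp only [Fin.sum_univ_four, Matrix.cons_val_zero, Matrix.cons_val_one, Matrix.cons_val] at hk
  have hk' : k 0 • x + k 1 • x' + k 2 • v + k 3 • vertVec n = 0 := congrArg Subtype.val hk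
  have hp : ∀ w, k 0 * mink x w + k 1 * mink x' w + k 2 * mink v w + k 3 * mink (vertVec n) w = 0 := by
    intro w
    rw [← mink_smul_left, ← mink_smul_left, ← mink_smul_left, ← mink_smul_left, ← mink_add_left,
      ← mink_add_left, ← mink_add_left, hk', mink_zero_left]
  have e1 := hp x
  have e2 := hp x'
  have e3 := hp v
  have e4 := hp (vertVec n)
  rw [mink_comm (vertVec n), mink_vertVec] at e1 e2 e3
  rw [mink_vertVec, mink_vertVec, mink_vertVec, mink_vertVec, vertVec_last, hvl] at e4
  rw [hvl] at e3
  rw [hxx, mink_comm x' x, hxx', mink_comm v x] at e1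
  rw [hxx', hx'x', mink_comm v x'] at e2
  set h := x (Fin.last (n + 1))
  set h' := x' (Fin.last (n + 1))
  set y := mink x v
  set y' := mink x' v
  have f1 : k 0 = k 2 * y := by linear_combination -e1 + h * e4
  have f2 : k 1 * (1 - h' ^ 2) = -(k 2 * y') := by linear_combination e2 - h' * e4
  have f3 : k 2 * (y ^ 2 + mink v v) = -(k 1 * y') := by rw [f1] at e3; linear_combination e3
  by_cases h1 : k 1 = 0
  · have h2 : k 2 ≠ 0 := by
      intro h2
      apply hi
      rw [h1, h2] at e4
      rw [h2, zero_mul] at f1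
      rw [f1] at e4
      have h3 : k 3 = 0 := by linarith
      fin_cases i <;> assumption
    rw [h1] at f2 f3
    simp only [zero_mul, neg_zero, mul_eq_zero, h2, false_or, zero_eq_neg] at f2 f3
    rw [f2, f3]; ring
  · apply mul_left_cancel₀ h1
    linear_combination y' * f3 - (y ^ 2 + mink v v) * f2

/-- A profile curve of a spherical rotation hypersurface has a smooth distance to the axis, because
it lies in a half-space bounded by the axis. -/
lemma exists_smooth_radius {P2 P3 : Submodule ℝ (Fin (n + 2) → ℝ)} (h3 : Module.finrank ℝ P3 = 3)
    (h2 : Module.finrank ℝ P2 = 2) (h23 : P2 ≤ P3) {v : Fin (n + 2) → ℝ} (hv : v ∈ P2)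
    (hvert : vertVec n ∈ P2) (hvl : v (Fin.last (n + 1)) = 0) (hvv : mink v v = -1)
    (hspan : ∀ w ∈ P2, ∃ a b : ℝ, w = a • v + b • vertVec n)
    {ℓ : (Fin (n + 2) → ℝ) →ₗ[ℝ] ℝ} (hℓ : ∀ x ∈ P2, ℓ x = 0) (hℓ' : ∃ x ∈ P3, ℓ x ≠ 0) :
    ∃ t : ℝ, 0 ≤ t ∧ ∀ x ∈ P3, x ∈ hypProd n → (t * ℓ x) ^ 2 = mink x v ^ 2 - 1 := by
  obtain ⟨w, hw, hℓw⟩ := hℓ'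
  have hsup : P2 ⊔ Submodule.span ℝ {w} = P3 := by
    refine Submodule.eq_of_le_of_finrank_le
      (sup_le h23 ((Submodule.span_singleton_le_iff_mem _ _).2 hw)) ?_
    have hlt : P2 < P2 ⊔ Submodule.span ℝ {w} := by
      refine lt_of_le_of_ne le_sup_left fun h => hℓw (hℓ w ?_)
      rw [h]
      exact Submodule.mem_sup_right (Submodule.mem_span_singleton_self w)
    have := Submodule.finrank_lt_finrank_of_lt hlt
    omega
  -- The component of `w` orthogonal to the axis.
  set w' := w + mink w v • v - w (Fin.last (n + 1)) • vertVec n with hw'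
  have hve : mink v (vertVec n) = 0 := by rw [mink_vertVec, hvl]
  have hw'v : mink w' v = 0 := by
    rw [hw', mink_sub_left, mink_add_left, mink_smul_left, mink_smul_left, hvv,
      mink_comm (vertVec n), hve]
    ring
  have hw'l : w' (Fin.last (n + 1)) = 0 := by simp [hw', hvl, vertVec_last]
  have hℓw' : ℓ w' = ℓ w := by simp [hw', hℓ v hv, hℓ _ hvert]
  have hw'0 : w' ≠ 0 := fun h => hℓw (by rw [← hℓw', h, map_zero])
  have hpos : 0 < mink w' w' := mink_self_pos_of_orthogonal hvv hw'0 hw'v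
  refine ⟨√(mink w' w') / |ℓ w|, by positivity, fun x hx hxh => ?_⟩
  rw [← hsup] at hx
  obtain ⟨p, hp, q, hq, rfl⟩ := Submodule.mem_sup.1 hx
  obtain ⟨e, rfl⟩ := Submodule.mem_span_singleton.1 hq
  obtain ⟨a, b, rfl⟩ := hspan p hp
  have hdec : a • v + b • vertVec n + e • w = (a - e * mink w v) • v
      + (b + e * w (Fin.last (n + 1))) • vertVec n + e • w' := by
    rw [hw']; module
  have hxx := (mem_hypProd.1 hxh).1
  have hℓx : ℓ (a • v + b • vertVec n + e • w) = e * ℓ w := by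
    simp [hℓ v hv, hℓ _ hvert]
  rw [hℓx]
  rw [hdec] at hxx ⊢
  set a' := a - e * mink w v
  set b' := b + e * w (Fin.last (n + 1))
  have hwe : mink w' (vertVec n) = 0 := by rw [mink_vertVec, hw'l]
  have hee : mink (vertVec n) (vertVec n) = 1 := by rw [mink_vertVec, vertVec_last]
  have hlast : (a' • v + b' • vertVec n + e • w') (Fin.last (n + 1)) = b' := by
    simp [hvl, vertVec_last, hw'l]
  rw [hlast] at hxx
  have hxv : mink (a' • v + b' • vertVec n + e • w') v = -a' := by
    simp only [mink_add_left, mink_smul_left, hvv, mink_comm (vertVec n) v, hve, hw'v]; ring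
  rw [hxv]
  simp only [mink_add_left, mink_add_right, mink_smul_left, mink_smul_right, hvv,
    mink_comm (vertVec n) v, mink_comm (vertVec n) w', mink_comm v w', hve, hw'v, hwe, hee] at hxx
  have h1 : (√(mink w' w') / |ℓ w| * (e * ℓ w)) ^ 2 = mink w' w' * e ^ 2 := by
    rw [mul_pow, div_pow, Real.sq_sqrt hpos.le, sq_abs]
    field_simp
  rw [h1]
  linear_combination hxx

/-- Up to an isometry, a rotation hypersurface is the set of points of `ℍⁿ × ℝ` whose inner product
with the axis vector and whose height are those of a point of the profile curve `(y, H)`; moreover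
the radius `r` of the orbits is a smooth function. -/
lemma exists_profile (hn : n ≠ 0) {τ : RotationType} {R : Set (Fin (n + 2) → ℝ)}
    (hR : IsRotationHypersurface n τ R) :
    ∃ (g : (Fin (n + 2) → ℝ) ≃ₗ[ℝ] (Fin (n + 2) → ℝ)) (I : Set ℝ) (y H r : ℝ → ℝ),
      PreservesHypProd n g ∧ g (vertVec n) = vertVec n ∧ I.OrdConnected ∧ (interior I).Nonempty ∧
      ContDiffOn ℝ ∞ y I ∧ ContDiffOn ℝ ∞ H I ∧ ContDiffOn ℝ ∞ r I ∧
      (∀ s ∈ I, 0 ≤ r s) ∧ (∀ s ∈ I, r s ^ 2 = y s ^ 2 - τ.sign) ∧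
      (τ ≠ .hyperbolic → ∀ s ∈ I, 0 < y s) ∧
      (τ = .hyperbolic → ∃ s ∈ interior I, 0 ≤ y s) ∧
      (∀ s ∈ interior I, deriv y s ^ 2 = r s ^ 2 * (1 - deriv H s ^ 2)) ∧
      g '' R = {x | x ∈ hypProd n ∧ ∃ s ∈ I, mink x (τ.axisVec n) = y s ∧
        x (Fin.last (n + 1)) = H s} := by
  obtain ⟨P2, P3, I, α, ⟨h3, -, -, h2, h23, hvert⟩, hτ, ⟨hI, hIne, hα, hαm, hαu, ℓ, hℓ, hℓ', hℓα⟩,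
    rfl⟩ := hR
  obtain ⟨v₁, hv₁, hv₁0, hv₁l, hspan₁⟩ := exists_axis_generator h2 hvert
  obtain ⟨t, ht, hvt⟩ := hτ.mink_generator hv₁ hv₁0 hv₁l hvert hspan₁
  obtain ⟨s₀, hs₀⟩ := hIne
  obtain ⟨ε, hε, hε'⟩ : ∃ ε : ℝ, (ε = 1 ∨ ε = -1) ∧ 0 ≤ ε * mink (α s₀) v₁ := by
    rcases le_total 0 (mink (α s₀) v₁) with h | h
    · exact ⟨1, Or.inl rfl, by linarith⟩
    · exact ⟨-1, Or.inr rfl, by linarith⟩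
  obtain ⟨a, g, ha, haε, hg, hgv, hge⟩ := exists_isometry_axisVec hn hv₁0 hv₁l ht hvt ε hε
  set v := a • v₁ with hvdef
  have hv : v ∈ P2 := P2.smul_mem _ hv₁
  have hvl : v (Fin.last (n + 1)) = 0 := by simp [hvdef, hv₁l]
  have hspan : ∀ w ∈ P2, ∃ a b : ℝ, w = a • v + b • vertVec n := by
    intro w hw
    obtain ⟨b, c, h⟩ := hspan₁ w hw
    exact ⟨b / a, c, by rw [hvdef, smul_smul, div_mul_cancel₀ _ ha, ← h]⟩
  have hvv : mink v v = -τ.sign := by rw [← hg.1, hgv, mink_axisVec_self hn]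
  have hlast : ∀ x, g x (Fin.last (n + 1)) = x (Fin.last (n + 1)) := by
    intro x
    have h := hg.1 x (vertVec n)
    rwa [hge, mink_vertVec, mink_vertVec] at h
  have hmv : ∀ x, mink (g x) (τ.axisVec n) = mink x v := fun x => by rw [← hgv, hg.1]
  have hy : ContDiffOn ℝ ∞ (fun s => mink (α s) v) I := by
    have : ContDiff ℝ ∞ (fun x : Fin (n + 2) → ℝ => mink x v) := by unfold mink; fun_prop
    exact this.comp_contDiffOn hα
  have hH : ContDiffOn ℝ ∞ (fun s => α s (Fin.last (n + 1))) I := by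
    have : ContDiff ℝ ∞ (fun x : Fin (n + 2) → ℝ => x (Fin.last (n + 1))) := by fun_prop
    exact this.comp_contDiffOn hα
  have hypos : τ ≠ .hyperbolic → ∀ s ∈ I, 0 < mink (α s) v := by
    intro h s hs
    rw [← hmv]
    exact mink_axisVec_pos hn h (hg.apply_mem (hαm s hs).1)
  have hrad : ∃ r : ℝ → ℝ, ContDiffOn ℝ ∞ r I ∧ (∀ s ∈ I, 0 ≤ r s) ∧
      ∀ s ∈ I, r s ^ 2 = mink (α s) v ^ 2 - τ.sign := by
    cases τ with
    | spherical =>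
      obtain ⟨t, ht, hx⟩ := exists_smooth_radius h3 h2 h23 hv hvert hvl hvv hspan hℓ hℓ'
      refine ⟨fun s => t * ℓ (α s), ?_, fun s hs => mul_nonneg ht (hℓα s hs),
        fun s hs => hx _ (hαm s hs).2 (hαm s hs).1⟩
      exact contDiffOn_const.mul
        ((LinearMap.toContinuousLinearMap ℓ).contDiff.comp_contDiffOn hα)
    | hyperbolic =>
      have hp : ∀ s, 0 < mink (α s) v ^ 2 + 1 := fun s => by positivity
      refine ⟨fun s => √(mink (α s) v ^ 2 + 1),
        ((hy.pow 2).add contDiffOn_const).sqrt fun s _ => (hp s).ne',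
        fun s _ => Real.sqrt_nonneg _, fun s _ => ?_⟩
      rw [Real.sq_sqrt (hp s).le, RotationType.sign]; ring
    | parabolic =>
      exact ⟨_, hy, fun s hs => (hypos (by simp) s hs).le, fun s _ => by
        simp [RotationType.sign]⟩
  obtain ⟨r, hr, hr0, hry⟩ := hrad
  refine ⟨g, I, fun s => mink (α s) v, fun s => α s (Fin.last (n + 1)), r, hg, hge, hI, ⟨s₀, hs₀⟩,
    hy, hH, hr, hr0, hry, hypos, fun h => ⟨s₀, hs₀, ?_⟩, ?_, ?_⟩
  · have h1 := haε h
    change 0 ≤ mink (α s₀) v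
    rw [hvdef, mink_smul_right]
    rcases hε with rfl | rfl
    · exact mul_nonneg (by linarith) (by linarith)
    · exact mul_nonneg_of_nonpos_of_nonpos (by linarith) (by linarith)
  · intro s hs
    have hsI : I ∈ 𝓝 s := mem_interior_iff_mem_nhds.1 hs
    have hsI' := interior_subset hs
    have hd : HasDerivAt α (deriv α s) s :=
      ((hα.contDiffAt hsI).differentiableAt (by simp)).hasDerivAt
    have hdm : ∀ m, HasDerivAt (fun s => α s m) (deriv α s m) s := hasDerivAt_pi.1 hd
    have hbil : ∀ w w' : ℝ → Fin (n + 2) → ℝ, ∀ dw dw', HasDerivAt w dw s → HasDerivAt w' dw' s →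
        HasDerivAt (fun s => mink (w s) (w' s)) (mink dw (w' s) + mink (w s) dw') s := by
      intro w w' dw dw' h h'
      have hm := hasDerivAt_pi.1 h
      have hm' := hasDerivAt_pi.1 h'
      simp only [mink, ← Finset.sum_add_distrib]
      refine HasDerivAt.fun_sum fun i _ => ?_
      refine (((hm i).fun_mul (hm' i)).const_mul _).congr_deriv ?_
      ring
    have h1 : HasDerivAt (fun s => mink (α s) v) (mink (deriv α s) v) s := by
      simpa [mink_zero_right] using hbil α (fun _ => v) _ 0 hd (hasDerivAt_const s v)
    rw [h1.deriv, (hdm _).deriv, hry s hsI']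
    have hd3 : deriv α s ∈ P3 := by
      have hcl : IsClosed (P3 : Set (Fin (n + 2) → ℝ)) := P3.closed_of_finiteDimensional
      have hslope := hasDerivAt_iff_tendsto_slope.1 hd
      refine hcl.mem_of_tendsto hslope ?_
      filter_upwards [mem_nhdsWithin_of_mem_nhds hsI] with t' ht'
      rw [slope_def_module]
      exact P3.smul_mem _ (P3.sub_mem (hαm t' ht').2 (hαm s hsI').2)
    have hxx' : mink (α s) (deriv α s)
        = α s (Fin.last (n + 1)) * deriv α s (Fin.last (n + 1)) := by
      have e1 := hbil α α _ _ hd hd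
      have e2 : HasDerivAt (fun s => -1 + α s (Fin.last (n + 1)) ^ 2)
          (2 * α s (Fin.last (n + 1)) * deriv α s (Fin.last (n + 1))) s := by
        simpa using ((hdm (Fin.last (n + 1))).fun_pow 2).const_add (-1)
      have e3 : (fun s => mink (α s) (α s)) =ᶠ[𝓝 s] fun s => -1 + α s (Fin.last (n + 1)) ^ 2 :=
        Filter.mem_of_superset hsI fun t' ht' => (mem_hypProd.1 (hαm t' ht').1).1
      have e4 := (e2.congr_of_eventuallyEq e3).unique e1
      rw [mink_comm (deriv α s)] at e4
      linarith
    have hun := hαu s hsI'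
    rw [derivWithin_of_mem_nhds hsI] at hun
    have := gram_relation h3 (hαm s hsI').2 hd3 (h23 hv) (h23 hvert) hvl
      (mem_hypProd.1 (hαm s hsI').1).1 hxx' hun
    rw [this, hvv]; ring
  · rw [rotationOrbit_eq hv hvert hspan fun s hs => (hαm s hs).1]
    ext x
    constructor
    · rintro ⟨x, ⟨hx, s, hs, e1, e2⟩, rfl⟩
      exact ⟨hg.apply_mem hx, s, hs, by rw [hmv, e1], by rw [hlast, e2]⟩
    · rintro ⟨hx, s, hs, e1, e2⟩
      rw [← hg.2] at hx
      obtain ⟨x, hx, rfl⟩ := hx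
      exact ⟨x, ⟨hx, s, hs, by rw [← hmv, e1], (hlast x).symm.trans e2⟩, rfl⟩

end Reduction

/-! ### Isometries, and the regularity of the profile -/

section Profile

variable {n : ℕ}

section Isometry

variable {M : Type*} [TopologicalSpace M] [ChartedSpace (EuclideanSpace ℝ (Fin n)) M]

lemma inducedMetric_isometry_comp {g : (Fin (n + 2) → ℝ) ≃ₗ[ℝ] (Fin (n + 2) → ℝ)}
    (hg : ∀ x y, mink (g x) (g y) = mink x y) (F : EuclideanSpace ℝ (Fin n) → (Fin (n + 2) → ℝ)) :
    inducedMetric (fun u => g (F u)) = inducedMetric F := by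
  have hpd : ∀ i u, pd i (fun u => g (F u)) u = g (pd i F u) := by
    intro i u
    have h := (g.toContinuousLinearEquiv).comp_fderiv (f := F) (x := u)
    have h' := congrArg (fun L => L (EuclideanSpace.single i 1)) h
    exact h'
  funext u
  ext i j
  simp only [inducedMetric, Matrix.of_apply, hpd, hg]

lemma HasConstSectionalCurvature.isometry_comp {f : M → (Fin (n + 2) → ℝ)} {c : ℝ}
    (hc : HasConstSectionalCurvature f c) {g : (Fin (n + 2) → ℝ) ≃ₗ[ℝ] (Fin (n + 2) → ℝ)}
    (hg : ∀ x y, mink (g x) (g y) = mink x y) :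
    HasConstSectionalCurvature (fun p => g (f p)) c := by
  intro e he u hu
  have h := hc e he u hu
  rw [← inducedMetric_isometry_comp hg] at h
  exact h

lemma mfderiv_isometry_comp {f : M → (Fin (n + 2) → ℝ)} (hf : IsHypersurface f)
    (L : (Fin (n + 2) → ℝ) →L[ℝ] (Fin (n + 2) → ℝ)) (w : Fin (n + 2) → ℝ) (p : M) :
    mfderiv 𝓘(ℝ, EuclideanSpace ℝ (Fin n)) 𝓘(ℝ, Fin (n + 2) → ℝ) (fun p => L (f p) + w) p
      = L.comp (mfderiv 𝓘(ℝ, EuclideanSpace ℝ (Fin n)) 𝓘(ℝ, Fin (n + 2) → ℝ) f p) := by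
  have h1 : HasMFDerivAt 𝓘(ℝ, Fin (n + 2) → ℝ) 𝓘(ℝ, Fin (n + 2) → ℝ) (fun x => L x + w) (f p) L :=
    (L.hasFDerivAt.add_const w).hasMFDerivAt
  have h2 := (hf.1.mdifferentiableAt (by simp) (x := p)).hasMFDerivAt
  exact (h1.comp p h2).mfderiv

lemma IsHypersurface.isometry_comp {f : M → (Fin (n + 2) → ℝ)} (hf : IsHypersurface f)
    {g : (Fin (n + 2) → ℝ) ≃ₗ[ℝ] (Fin (n + 2) → ℝ)} (hg : PreservesHypProd n g) (b : ℝ) :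
    IsHypersurface (fun p => g (f p) + b • vertVec n) := by
  have hL : ContDiff ℝ ∞ (fun x => g.toContinuousLinearEquiv x + b • vertVec n) :=
    (g.toContinuousLinearEquiv.contDiff).add contDiff_const
  refine ⟨hL.contMDiff.comp hf.1, fun p => ?_, fun p => ?_⟩
  · have h := mfderiv_isometry_comp hf g.toContinuousLinearEquiv.toContinuousLinearMap
      (b • vertVec n) p
    intro a a' haa
    have h' : ∀ a, mfderiv 𝓘(ℝ, EuclideanSpace ℝ (Fin n)) 𝓘(ℝ, Fin (n + 2) → ℝ)
        (fun p => g (f p) + b • vertVec n) p a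
        = g (mfderiv 𝓘(ℝ, EuclideanSpace ℝ (Fin n)) 𝓘(ℝ, Fin (n + 2) → ℝ) f p a) := fun a =>
      congrArg (fun L => L a) h
    rw [h', h'] at haa
    exact hf.2.1 p (g.injective haa)
  · have h := hg.apply_mem (hf.2.2 p)
    have hi : (Fin.init (g (f p) + b • vertVec n) : Fin (n + 1) → ℝ) = Fin.init (g (f p)) := by
      have h0 := init_vertVec (n := n)
      funext i
      have := congrFun h0 i
      simp only [Fin.init] at this ⊢
      simp [this]
    change (Fin.init (g (f p) + b • vertVec n) : Fin (n + 1) → ℝ) ∈ hypSpace (n + 1)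
    rw [hi]
    exact h

end Isometry

lemma subset_closure_interior {I : Set ℝ} (hI : I.OrdConnected) (hne : (interior I).Nonempty) :
    I ⊆ closure (interior I) := by
  rw [(hI.convex (𝕜 := ℝ)).closure_interior_eq_closure_of_nonempty_interior hne]
  exact subset_closure

/-- The profile curve of a hypersurface `f` that is a rotation hypersurface with axis in normal
position: `y` and `H` are the inner product with the axis vector and the height, `r` is the radius
of the orbits, and the curve `(y, H)` has unit speed. -/
structure IsProfileOf (τ : RotationType) (R : Set (Fin (n + 2) → ℝ)) (I : Set ℝ) (y H r : ℝ → ℝ) :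
    Prop where
  ordConnected : I.OrdConnected
  interior_nonempty : (interior I).Nonempty
  contDiffOn_y : ContDiffOn ℝ ∞ y I
  contDiffOn_H : ContDiffOn ℝ ∞ H I
  contDiffOn_r : ContDiffOn ℝ ∞ r I
  r_nonneg : ∀ s ∈ I, 0 ≤ r s
  r_sq : ∀ s ∈ I, r s ^ 2 = y s ^ 2 - τ.sign
  y_pos : τ ≠ .hyperbolic → ∀ s ∈ I, 0 < y s
  y_nonneg : τ = .hyperbolic → ∃ s ∈ interior I, 0 ≤ y s
  unit_speed : ∀ s ∈ interior I, deriv y s ^ 2 = r s ^ 2 * (1 - deriv H s ^ 2)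
  eq_setOf : R = {x | x ∈ hypProd n ∧ ∃ s ∈ I, mink x (τ.axisVec n) = y s ∧
    x (Fin.last (n + 1)) = H s}

/-- A hypersurface is not contained in a vertical line. -/
lemma not_range_subset_vertical_line (hn : 3 ≤ n) {M : Type*} [TopologicalSpace M]
    [ChartedSpace (EuclideanSpace ℝ (Fin n)) M] {f : M → (Fin (n + 2) → ℝ)}
    (hf : IsHypersurface f) (p : M) (w : Fin (n + 2) → ℝ) :
    ¬∀ p, ∃ b : ℝ, f p = w + b • vertVec n := by
  intro h
  set e := ContinuousLinearMap.proj (R := ℝ) (φ := fun _ : Fin (n + 2) => ℝ) (Fin.last (n + 1))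
  set L : (Fin (n + 2) → ℝ) →L[ℝ] (Fin (n + 2) → ℝ) :=
    ContinuousLinearMap.id ℝ _ - e.smulRight (vertVec n) with hL
  have hconst : (fun p => L (f p) + 0) = fun _ => L w := by
    funext p
    obtain ⟨b, hb⟩ := h p
    have h1 : L (vertVec n) = 0 := by simp [hL, e, vertVec_last]
    rw [add_zero, hb, map_add, map_smul, h1, smul_zero, add_zero]
  have hm := mfderiv_isometry_comp hf L 0 p
  rw [hconst, mfderiv_const] at hm
  have hD := hf.2.1 p
  set D : EuclideanSpace ℝ (Fin n) →L[ℝ] (Fin (n + 2) → ℝ) :=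
    mfderiv 𝓘(ℝ, EuclideanSpace ℝ (Fin n)) 𝓘(ℝ, Fin (n + 2) → ℝ) f p
  have hLD : ∀ a, D a = e (D a) • vertVec n := by
    intro a
    have h1 : L (D a) = 0 := (congrArg (fun T : EuclideanSpace ℝ (Fin n) →L[ℝ] _ => T a) hm).symm
    have h2 : L (D a) = D a - e (D a) • vertVec n := rfl
    rw [h2] at h1
    exact sub_eq_zero.1 h1
  have hinj : Function.Injective (e.comp D).toLinearMap := by
    intro a a' haa
    apply hD
    have haa' : e (D a) = e (D a') := haa
    change D a = D a'
    rw [hLD a, hLD a', haa']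
  have := LinearMap.finrank_le_finrank_of_injective hinj
  simp at this
  omega

variable {M : Type*} [TopologicalSpace M] [ChartedSpace (EuclideanSpace ℝ (Fin n)) M]
  {f : M → (Fin (n + 2) → ℝ)} {c : ℝ} {τ : RotationType} {I : Set ℝ} {y H r : ℝ → ℝ}

/-- The profile curve of a spherical rotation hypersurface does not stay on the axis. -/
lemma IsProfileOf.exists_r_pos (hn : 3 ≤ n) (hf : IsHypersurface f)
    (h : IsProfileOf .spherical (range f) I y H r) : ∃ s ∈ interior I, 0 < r s := by
  by_contra! hle
  have hr0 : ∀ s ∈ I, r s = 0 := by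
    have h1 : EqOn r (fun _ => 0) (interior I) := fun s hs =>
      le_antisymm (hle s hs) (h.r_nonneg s (interior_subset hs))
    exact h1.of_subset_closure h.contDiffOn_r.continuousOn continuousOn_const interior_subset
      (subset_closure_interior h.ordConnected h.interior_nonempty)
  have hy1 : ∀ s ∈ I, y s = 1 := by
    intro s hs
    have h1 := h.r_sq s hs
    have h2 := h.y_pos (by simp) s hs
    rw [hr0 s hs, RotationType.sign] at h1
    nlinarith
  have hax : ∀ x : Fin (n + 2) → ℝ, mink x (RotationType.spherical.axisVec n) = x 0 := by
    intro x
    rw [RotationType.axisVec, mink_neg_right, mink_coordVec]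
    simp
  have hline : ∀ x ∈ range f, ∃ b : ℝ, x = coordVec n 0 + b • vertVec n := by
    intro x hx
    rw [h.eq_setOf] at hx
    obtain ⟨hx, s, hs, e1, -⟩ := hx
    rw [hax, hy1 s hs] at e1
    refine ⟨x (Fin.last (n + 1)), ?_⟩
    have hzero : x - x (Fin.last (n + 1)) • vertVec n - coordVec n 0 = 0 := by
      refine eq_zero_of_mink_self ?_ ?_
      · have h1 := (mem_hypProd.1 hx).1
        have hcc : mink (coordVec n 0) (coordVec n 0) = -1 := by
          rw [mink_coordVec]; simp [coordVec]
        have hxc : mink x (coordVec n 0) = -1 := by rw [mink_coordVec]; simp [e1]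
        have hvc : mink (vertVec n) (coordVec n 0) = 0 := by
          rw [mink_coordVec]; simp [vertVec, coordVec]
        have hxv := mink_vertVec (n := n) x
        have hvv : mink (vertVec n) (vertVec n) = 1 := by rw [mink_vertVec, vertVec_last]
        simp only [mink_sub_left, mink_sub_right, mink_smul_left, mink_smul_right,
          mink_comm (coordVec n 0), mink_comm (vertVec n) x, h1, hcc, hxc, hvc, hxv, hvv]
        apply le_of_eq
        ring
      · have hv0 : vertVec n 0 = 0 := by simp [vertVec, coordVec]
        simp [e1, hv0, coordVec]
    have : x = coordVec n 0 + x (Fin.last (n + 1)) • vertVec n := by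
      rw [sub_sub, sub_eq_zero] at hzero
      exact hzero.trans (add_comm _ _)
    exact this
  obtain ⟨s, hs⟩ := h.interior_nonempty
  have hp : coordVec n 0 + H s • vertVec n ∈ range f := by
    rw [h.eq_setOf]
    have hv0 : vertVec n 0 = 0 := by simp [vertVec, coordVec]
    have hc0 : coordVec n 0 (Fin.last (n + 1)) = 0 := by simp [coordVec]
    refine ⟨?_, s, interior_subset hs, ?_, ?_⟩
    · rw [mem_hypProd]
      have hcc : mink (coordVec n 0) (coordVec n 0) = -1 := by
        rw [mink_coordVec]; simp [coordVec]
      have hcv : mink (coordVec n 0) (vertVec n) = 0 := by rw [mink_vertVec, hc0]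
      have hvv : mink (vertVec n) (vertVec n) = 1 := by rw [mink_vertVec, vertVec_last]
      constructor
      · simp only [mink_add_left, mink_add_right, mink_smul_left, mink_smul_right,
          mink_comm (vertVec n) (coordVec n 0), hcc, hcv, hvv, Pi.add_apply, Pi.smul_apply, hc0,
          vertVec_last, smul_eq_mul]
        ring
      · simp [hv0, coordVec]
    · rw [hax, hy1 s (interior_subset hs)]
      simp [hv0, coordVec]
    · simp [hc0, vertVec_last]
  obtain ⟨p, -⟩ := hp
  exact not_range_subset_vertical_line hn hf p _ fun p => hline _ (mem_range_self p)

/-- In the interior of the interval, the profile curve does not meet the axis, and it satisfies the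
differential equations that express the constancy of the sectional curvature. -/
lemma IsProfileOf.ode [T2Space M] [SecondCountableTopology M]
    [IsManifold 𝓘(ℝ, EuclideanSpace ℝ (Fin n)) ∞ M] (hn : 3 ≤ n) (hf : IsHypersurface f) (hc : HasConstSectionalCurvature f c)
    (h : IsProfileOf τ (range f) I y H r) :
    ∀ s ∈ interior I, 0 < r s ∧ deriv (deriv r) s = -c * r s ∧
      deriv r s ^ 2 = τ.sign - c * r s ^ 2 := by
  have hcont : ContinuousOn r (interior I) := h.contDiffOn_r.continuousOn.mono interior_subset
  set J := interior I ∩ r ⁻¹' Ioi 0 with hJdef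
  have hJ : IsOpen J := hcont.isOpen_inter_preimage isOpen_interior isOpen_Ioi
  have hJI : J ⊆ I := fun s hs => interior_subset hs.1
  have hode := profile_ode hn hf hc τ hJ (h.contDiffOn_y.mono hJI) (h.contDiffOn_H.mono hJI)
    (h.contDiffOn_r.mono hJI) (fun s hs => hs.2) (fun s hs => h.r_sq s (hJI hs))
    (fun hτ s hs => h.y_pos hτ s (hJI hs)) (fun s hs => h.unit_speed s hs.1)
    (fun x hx s hs e1 e2 => by rw [h.eq_setOf]; exact ⟨hx, s, hJI hs, e1, e2⟩)
  suffices hpos : interior I ⊆ J from fun s hs => ⟨(hpos hs).2, hode s (hpos hs)⟩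
  cases τ with
  | spherical =>
    have hpre : IsPreconnected (interior I) := h.ordConnected.interior.isPreconnected
    obtain ⟨s₁, hs₁, hrs₁⟩ := h.exists_r_pos hn hf
    refine hpre.subset_of_closure_inter_subset hJ ⟨s₁, hs₁, hs₁, hrs₁⟩ ?_
    rintro s ⟨hs, hsI⟩
    refine ⟨hsI, lt_of_le_of_ne (h.r_nonneg s (interior_subset hsI)) fun h0 => ?_⟩
    -- At a zero of `r` the derivative would have to be both `0` and `± 1`.
    have hmin : IsLocalMin r s := by
      filter_upwards [isOpen_interior.mem_nhds hsI] with t ht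
      rw [← h0]
      exact h.r_nonneg t (interior_subset ht)
    have hd := hmin.deriv_eq_zero
    have hdc : ContinuousAt (deriv r) s :=
      ((contDiffOn_deriv isOpen_interior (h.contDiffOn_r.mono interior_subset)).continuousOn
        ).continuousAt (isOpen_interior.mem_nhds hsI)
    have hrc : ContinuousAt r s := hcont.continuousAt (isOpen_interior.mem_nhds hsI)
    have : (𝓝[J] s).NeBot := mem_closure_iff_nhdsWithin_neBot.1 hs
    have l1 : Tendsto (fun t => deriv r t ^ 2) (𝓝[J] s) (𝓝 (deriv r s ^ 2)) :=
      (hdc.pow 2).tendsto.mono_left nhdsWithin_le_nhds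
    have l2 : Tendsto (fun t => RotationType.spherical.sign - c * r t ^ 2) (𝓝[J] s)
        (𝓝 (RotationType.spherical.sign - c * r s ^ 2)) :=
      (continuousAt_const.sub (continuousAt_const.mul (hrc.pow 2))).tendsto.mono_left
        nhdsWithin_le_nhds
    have := tendsto_nhds_unique (l1.congr' (by
      filter_upwards [self_mem_nhdsWithin] with t ht using (hode t ht).2)) l2
    rw [hd, ← h0, RotationType.sign] at this
    norm_num at this
  | hyperbolic =>
    intro s hs
    refine ⟨hs, lt_of_le_of_ne (h.r_nonneg s (interior_subset hs)) fun h0 => ?_⟩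
    have h1 := h.r_sq s (interior_subset hs)
    rw [← h0, RotationType.sign] at h1
    nlinarith [sq_nonneg (y s)]
  | parabolic =>
    intro s hs
    refine ⟨hs, lt_of_le_of_ne (h.r_nonneg s (interior_subset hs)) fun h0 => ?_⟩
    have h1 := h.r_sq s (interior_subset hs)
    have h2 := h.y_pos (by simp) s (interior_subset hs)
    rw [← h0, RotationType.sign] at h1
    nlinarith

end Profile

/-! ### Integration of the differential equations of the profile -/

section Integration

lemma exists_const_of_hasDerivAt_zero {J : Set ℝ} (hJ : IsOpen J) (hJ' : IsPreconnected J)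
    {g : ℝ → ℝ} (hg : ∀ s ∈ J, HasDerivAt g 0 s) : ∃ a, ∀ s ∈ J, g s = a :=
  hJ.exists_is_const_of_deriv_eq_zero hJ'
    (fun s hs => (hg s hs).differentiableAt.differentiableWithinAt) fun s hs => (hg s hs).deriv

/-- The first order system satisfied by `y`, by the height `K` (up to sign) and by
`z = r' / √(1 + c)`, whose solutions are `y = ψ(K)` for elementary functions `ψ`. -/
structure IsProfileSystem (κ μ : ℝ) (J : Set ℝ) (y K z k : ℝ → ℝ) : Prop where
  isOpen : IsOpen J
  isPreconnected : IsPreconnected J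
  nonempty : J.Nonempty
  hasDerivAt_K : ∀ s ∈ J, HasDerivAt K (k s) s
  hasDerivAt_y : ∀ s ∈ J, HasDerivAt y (z s * k s) s
  hasDerivAt_z : ∀ s ∈ J, HasDerivAt z (μ * (y s * k s)) s
  z_sq : ∀ s ∈ J, z s ^ 2 = κ + μ * y s ^ 2

section System

variable {κ μ : ℝ} {J : Set ℝ} {y K z k : ℝ → ℝ}

/-- The two first integrals of the system for `μ = B⁻²`. -/
lemma IsProfileSystem.exists_exp {B : ℝ} (hB : 0 < B) (hμ : μ = (B ^ 2)⁻¹)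
    (h : IsProfileSystem κ μ J y K z k) :
    ∃ P Q : ℝ, P * Q = -κ * B ^ 2 ∧
      ∀ s ∈ J, y s = (P * Real.exp (K s / B) + Q * Real.exp (-(K s / B))) / 2 := by
  obtain ⟨P, hP⟩ := exists_const_of_hasDerivAt_zero h.isOpen h.isPreconnected
    (g := fun s => (y s + B * z s) * Real.exp (-(K s / B))) fun s hs => by
      have h1 := ((h.hasDerivAt_K s hs).div_const B).fun_neg.exp
      have h2 := (h.hasDerivAt_y s hs).fun_add ((h.hasDerivAt_z s hs).const_mul B)
      refine (h2.fun_mul h1).congr_deriv ?_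
      rw [hμ]
      field_simp
      ring
  obtain ⟨Q, hQ⟩ := exists_const_of_hasDerivAt_zero h.isOpen h.isPreconnected
    (g := fun s => (y s - B * z s) * Real.exp (K s / B)) fun s hs => by
      have h1 := ((h.hasDerivAt_K s hs).div_const B).exp
      have h2 := (h.hasDerivAt_y s hs).fun_sub ((h.hasDerivAt_z s hs).const_mul B)
      refine (h2.fun_mul h1).congr_deriv ?_
      rw [hμ]
      field_simp
      ring
  have hexp : ∀ s, Real.exp (K s / B) * Real.exp (-(K s / B)) = 1 := fun s => by
    rw [← Real.exp_add, add_neg_cancel, Real.exp_zero]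
  refine ⟨P, Q, ?_, fun s hs => ?_⟩
  · obtain ⟨s, hs⟩ := h.nonempty
    rw [← hP s hs, ← hQ s hs]
    have hz := h.z_sq s hs
    have : (y s + B * z s) * Real.exp (-(K s / B)) * ((y s - B * z s) * Real.exp (K s / B))
        = (y s ^ 2 - B ^ 2 * z s ^ 2) * (Real.exp (K s / B) * Real.exp (-(K s / B))) := by ring
    rw [this, hexp, hz, hμ]
    field_simp
    ring
  · rw [← hP s hs, ← hQ s hs]
    linear_combination (-y s) * hexp s

/-- Multiples of exponentials as translates of the exponential. -/
lemma mul_exp_div_eq {P B : ℝ} (hP : 0 < P) (hB : 0 < B) (δ x : ℝ) :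
    P * Real.exp (x / B) = B * Real.exp ((x + B * (Real.log (P / B) - δ)) / B + δ) ∧
    B ^ 2 / P * Real.exp (-(x / B))
      = B * Real.exp (-((x + B * (Real.log (P / B) - δ)) / B + δ)) := by
  have h1 : (x + B * (Real.log (P / B) - δ)) / B + δ = x / B + Real.log (P / B) := by
    field_simp
    ring
  rw [h1, neg_add, Real.exp_add, Real.exp_add, Real.exp_neg (Real.log _),
    Real.exp_log (by positivity)]
  constructor <;> field_simp

lemma IsProfileSystem.exists_sinh {B : ℝ} (hB : 0 < B) (hμ : μ = (B ^ 2)⁻¹) (δ : ℝ)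
    (h : IsProfileSystem 1 μ J y K z k) :
    ∃ ε b : ℝ, (ε = 1 ∨ ε = -1) ∧ ∀ s ∈ J, y s = B * Real.sinh ((ε * K s + b) / B + δ) := by
  obtain ⟨P, Q, hPQ, hy⟩ := h.exists_exp hB hμ
  have hneg : P * Q < 0 := by rw [hPQ]; nlinarith
  rcases mul_neg_iff.1 hneg with ⟨hP, hQ⟩ | ⟨hP, hQ⟩
  · refine ⟨1, B * (Real.log (P / B) - δ), Or.inl rfl, fun s hs => ?_⟩
    obtain ⟨e1, e2⟩ := mul_exp_div_eq hP hB δ (K s)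
    have hQ' : Q = -(B ^ 2 / P) := by field_simp; linarith
    rw [hy s hs, Real.sinh_eq, one_mul, hQ', e1, neg_mul, e2]
    ring
  · refine ⟨-1, B * (Real.log (Q / B) - δ), Or.inr rfl, fun s hs => ?_⟩
    obtain ⟨e1, e2⟩ := mul_exp_div_eq hQ hB δ (-1 * K s)
    have hP' : P = -(B ^ 2 / Q) := by field_simp; linarith
    have e3 : -1 * K s / B = -(K s / B) := by ring
    rw [e3] at e1 e2
    rw [neg_neg] at e2
    rw [hy s hs, Real.sinh_eq, hP', e1, neg_mul, e2]
    ring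

lemma IsProfileSystem.exists_cosh {B : ℝ} (hB : 0 < B) (hμ : μ = (B ^ 2)⁻¹) (δ : ℝ)
    (h : IsProfileSystem (-1) μ J y K z k) (hy0 : ∃ s ∈ J, 0 ≤ y s) :
    ∃ b : ℝ, ∀ s ∈ J, y s = B * Real.cosh ((K s + b) / B - δ) := by
  obtain ⟨P, Q, hPQ, hy⟩ := h.exists_exp hB hμ
  have hpos : 0 < P * Q := by rw [hPQ]; nlinarith
  have hP : 0 < P := by
    rcases mul_pos_iff.1 hpos with ⟨hP, -⟩ | ⟨hP, hQ⟩
    · exact hP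
    · obtain ⟨s, hs, hys⟩ := hy0
      rw [hy s hs] at hys
      have := mul_neg_of_neg_of_pos hP (Real.exp_pos (K s / B))
      have := mul_neg_of_neg_of_pos hQ (Real.exp_pos (-(K s / B)))
      linarith
  refine ⟨B * (Real.log (P / B) - -δ), fun s hs => ?_⟩
  obtain ⟨e1, e2⟩ := mul_exp_div_eq hP hB (-δ) (K s)
  have hQ' : Q = B ^ 2 / P := by field_simp; linarith
  rw [sub_eq_add_neg _ δ, hy s hs, Real.cosh_eq, hQ', e1, e2]
  ring

lemma IsProfileSystem.exists_expo {B : ℝ} (hB : 0 < B) (hμ : μ = (B ^ 2)⁻¹)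
    (h : IsProfileSystem 0 μ J y K z k) (hy0 : ∀ s ∈ J, 0 < y s) :
    ∃ ε b : ℝ, (ε = 1 ∨ ε = -1) ∧ ∀ s ∈ J, y s = Real.exp ((ε * K s + b) / B) := by
  obtain ⟨P, Q, hPQ, hy⟩ := h.exists_exp hB hμ
  obtain ⟨s₀, hs₀⟩ := h.nonempty
  have hy₀ := hy0 s₀ hs₀
  rw [hy s₀ hs₀] at hy₀
  have key : ∀ P : ℝ, 0 < P → ∀ x, P * Real.exp (x / B) = Real.exp ((x + B * Real.log P) / B) := by
    intro P hP x
    have : (x + B * Real.log P) / B = x / B + Real.log P := by field_simp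
    rw [this, Real.exp_add, Real.exp_log hP, mul_comm]
  have hz : P * Q = 0 := by rw [hPQ]; ring
  rcases mul_eq_zero.1 hz with rfl | rfl
  · have hQ : 0 < Q := by
      by_contra hle
      have := mul_nonpos_of_nonpos_of_nonneg (not_lt.1 hle) (Real.exp_pos (-(K s₀ / B))).le
      linarith
    refine ⟨-1, B * Real.log (Q / 2), Or.inr rfl, fun s hs => ?_⟩
    rw [← key _ (by positivity), hy s hs]
    ring_nf
  · have hP : 0 < P := by
      by_contra hle
      have := mul_nonpos_of_nonpos_of_nonneg (not_lt.1 hle) (Real.exp_pos (K s₀ / B)).le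
      linarith
    refine ⟨1, B * Real.log (P / 2), Or.inl rfl, fun s hs => ?_⟩
    rw [← key _ (by positivity), hy s hs]
    ring_nf

/-- For `μ = 0` the relation between `y` and the height is affine. -/
lemma IsProfileSystem.exists_affine (h : IsProfileSystem κ 0 J y K z k) :
    ∃ a b : ℝ, a ^ 2 = κ ∧ ∀ s ∈ J, y s = a * K s + b := by
  obtain ⟨a, ha⟩ := exists_const_of_hasDerivAt_zero h.isOpen h.isPreconnected
    (g := z) fun s hs => (h.hasDerivAt_z s hs).congr_deriv (by ring)
  obtain ⟨b, hb⟩ := exists_const_of_hasDerivAt_zero h.isOpen h.isPreconnected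
    (g := fun s => y s - a * K s) fun s hs => by
      refine ((h.hasDerivAt_y s hs).fun_sub ((h.hasDerivAt_K s hs).const_mul a)).congr_deriv ?_
      rw [ha s hs, sub_self]
  obtain ⟨s₀, hs₀⟩ := h.nonempty
  refine ⟨a, b, ?_, fun s hs => ?_⟩
  · rw [← ha s₀ hs₀, h.z_sq s₀ hs₀]; ring
  · rw [← hb s hs]; ring

lemma IsProfileSystem.exists_cos {B : ℝ} (hB : 0 < B) (hμ : μ = -(B ^ 2)⁻¹)
    (h : IsProfileSystem 1 μ J y K z k) (hy0 : ∀ s ∈ J, 0 < y s) :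
    ∃ b : ℝ, ∀ s ∈ J, y s = B * Real.cos ((K s + b) / B) ∧ |(K s + b) / B| < Real.pi / 2 := by
  obtain ⟨s₀, hs₀⟩ := h.nonempty
  have hz₀ := h.z_sq s₀ hs₀
  have hy₀ := hy0 s₀ hs₀
  -- The initial angle is determined by `sin θ = -z`, `cos θ = y / B`.
  set θ := -Real.arcsin (z s₀) with hθ
  have hz1 : z s₀ ^ 2 < 1 := by
    rw [hz₀, hμ]
    have : 0 < (B ^ 2)⁻¹ * y s₀ ^ 2 := by positivity
    linarith
  have hsin : Real.sin θ = -z s₀ := by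
    rw [hθ, Real.sin_neg, Real.sin_arcsin] <;> nlinarith
  have hcos : Real.cos θ = y s₀ / B := by
    have : 1 - z s₀ ^ 2 = (y s₀ / B) ^ 2 := by rw [hz₀, hμ]; field_simp; ring
    rw [hθ, Real.cos_neg, Real.cos_arcsin, this, Real.sqrt_sq (by positivity)]
  have hθlt : |θ| < Real.pi / 2 := by
    rw [hθ, abs_neg, abs_lt]
    exact ⟨Real.neg_pi_div_two_lt_arcsin.2 (by nlinarith), Real.arcsin_lt_pi_div_two.2 (by nlinarith)⟩
  set b := B * θ - K s₀ with hb
  have hθ₀ : (K s₀ + b) / B = θ := by rw [hb]; field_simp; ring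
  have hang : ∀ s ∈ J, HasDerivAt (fun s => (K s + b) / B) (k s / B) s := fun s hs =>
    ((h.hasDerivAt_K s hs).add_const b).div_const B
  obtain ⟨P, hP⟩ := exists_const_of_hasDerivAt_zero h.isOpen h.isPreconnected
    (g := fun s => y s * Real.cos ((K s + b) / B) - B * z s * Real.sin ((K s + b) / B))
    fun s hs => by
      refine (((h.hasDerivAt_y s hs).fun_mul (hang s hs).cos).fun_sub
        (((h.hasDerivAt_z s hs).const_mul B).fun_mul (hang s hs).sin)).congr_deriv ?_
      rw [hμ]
      field_simp
      ring
  obtain ⟨Q, hQ⟩ := exists_const_of_hasDerivAt_zero h.isOpen h.isPreconnected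
    (g := fun s => y s * Real.sin ((K s + b) / B) + B * z s * Real.cos ((K s + b) / B))
    fun s hs => by
      refine (((h.hasDerivAt_y s hs).fun_mul (hang s hs).sin).fun_add
        (((h.hasDerivAt_z s hs).const_mul B).fun_mul (hang s hs).cos)).congr_deriv ?_
      rw [hμ]
      field_simp
      ring
  have hP₀ := hP s₀ hs₀
  have hQ₀ := hQ s₀ hs₀
  simp only [hθ₀, hcos, hsin] at hP₀ hQ₀
  have hPB : P = B := by
    rw [← hP₀]
    have : y s₀ * (y s₀ / B) - B * z s₀ * -z s₀ = y s₀ ^ 2 / B + B * z s₀ ^ 2 := by ring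
    rw [this, hz₀, hμ]
    field_simp
    ring
  have hQB : Q = 0 := by
    rw [← hQ₀]
    field_simp
    ring
  have hy : ∀ s ∈ J, y s = B * Real.cos ((K s + b) / B) := by
    intro s hs
    have h1 := hP s hs
    have h2 := hQ s hs
    have h3 := Real.sin_sq_add_cos_sq ((K s + b) / B)
    rw [hPB] at h1
    rw [hQB] at h2
    linear_combination (-y s) * h3 + Real.cos ((K s + b) / B) * h1
      + Real.sin ((K s + b) / B) * h2
  refine ⟨b, fun s hs => ⟨hy s hs, ?_⟩⟩
  -- The angle cannot reach `± π / 2`, where `y` would vanish.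
  by_contra hge
  have hcont : ContinuousOn (fun s => |(K s + b) / B|) J := fun s hs =>
    (hang s hs).continuousAt.abs.continuousWithinAt
  have := h.isPreconnected.intermediate_value hs₀ hs hcont
  obtain ⟨t, ht, hte⟩ := this ⟨by simp only [hθ₀]; exact hθlt.le, not_lt.1 hge⟩
  have hyt := hy t ht
  simp only at hte
  rw [← Real.cos_abs, hte, Real.cos_pi_div_two, mul_zero] at hyt
  exact (hy0 t ht).ne' hyt

end System

variable {J : Set ℝ} {κ c : ℝ} {y H r : ℝ → ℝ}

/-- The relation `y² h'² = (1 + c) r²` between the height and the radius of the orbits. -/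
lemma sq_mul_deriv_sq (hJ : IsOpen J) (hy : ContDiffOn ℝ ∞ y J) (hr : ContDiffOn ℝ ∞ r J)
    (hry : ∀ s ∈ J, r s ^ 2 = y s ^ 2 - κ)
    (hunit : ∀ s ∈ J, deriv y s ^ 2 = r s ^ 2 * (1 - deriv H s ^ 2))
    (hode : ∀ s ∈ J, 0 < r s ∧ deriv (deriv r) s = -c * r s ∧ deriv r s ^ 2 = κ - c * r s ^ 2) :
    ∀ s ∈ J, r s * deriv r s = y s * deriv y s ∧ (y s * deriv H s) ^ 2 = (1 + c) * r s ^ 2 := by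
  intro s hs
  have h1 : r s * deriv r s = y s * deriv y s := by
    have e1 := (hasDerivAt_of_contDiffOn hJ hr hs).fun_pow 2
    have e2 := ((hasDerivAt_of_contDiffOn hJ hy hs).fun_pow 2).sub_const κ
    have e3 : (fun s => r s ^ 2) =ᶠ[𝓝 s] fun s => y s ^ 2 - κ :=
      Filter.mem_of_superset (hJ.mem_nhds hs) hry
    have e4 := (e2.congr_of_eventuallyEq e3).unique e1
    norm_num at e4
    linarith
  refine ⟨h1, ?_⟩
  obtain ⟨hpos, -, h2⟩ := hode s hs
  have h3 : r s ^ 2 * (deriv r s ^ 2 - y s ^ 2 * (1 - deriv H s ^ 2)) = 0 := by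
    have h4 : (r s * deriv r s) ^ 2 = (y s * deriv y s) ^ 2 := by rw [h1]
    linear_combination h4 + y s ^ 2 * hunit s hs
  have h4 := (mul_eq_zero.1 h3).resolve_left (by positivity)
  linear_combination h4 - h2 - hry s hs

lemma neg_one_le_of_sq {a b c : ℝ} (hb : 0 < b) (h : a ^ 2 = (1 + c) * b ^ 2) : -1 ≤ c := by
  by_contra hlt
  have : (1 + c) * b ^ 2 < 0 := mul_neg_of_neg_of_pos (by linarith) (by positivity)
  nlinarith [sq_nonneg a]

/-- For `c = -1` the height is constant. -/
lemma exists_height_const (hJ : IsOpen J) (hJ' : IsPreconnected J) (hy : ContDiffOn ℝ ∞ y J)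
    (hH : ContDiffOn ℝ ∞ H J) (hr : ContDiffOn ℝ ∞ r J)
    (hry : ∀ s ∈ J, r s ^ 2 = y s ^ 2 - κ)
    (hunit : ∀ s ∈ J, deriv y s ^ 2 = r s ^ 2 * (1 - deriv H s ^ 2))
    (hode : ∀ s ∈ J, 0 < r s ∧ deriv (deriv r) s = r s ∧ deriv r s ^ 2 = κ + r s ^ 2) :
    ∃ t, ∀ s ∈ J, H s = t := by
  have hsq := sq_mul_deriv_sq (c := -1) hJ hy hr hry hunit fun s hs => by
    obtain ⟨h1, h2, h3⟩ := hode s hs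
    exact ⟨h1, by rw [h2]; ring, by rw [h3]; ring⟩
  refine exists_const_of_hasDerivAt_zero hJ hJ' fun s hs => ?_
  suffices h0 : deriv H s = 0 by
    rw [← h0]; exact hasDerivAt_of_contDiffOn hJ hH hs
  by_contra hne
  -- Otherwise `y` vanishes near `s`, so that `r` is constant there, against `r'' = r`.
  have hc := (contDiffOn_deriv hJ hH).continuousOn.continuousAt (hJ.mem_nhds hs)
  have hy0 : ∀ᶠ t in 𝓝 s, y t = 0 := by
    filter_upwards [hc.eventually_ne hne, hJ.mem_nhds hs] with t h1 h2
    have h3 := (hsq t h2).2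
    norm_num at h3
    exact h3.resolve_right h1
  have hd : ∀ᶠ t in 𝓝 s, deriv r t = 0 := by
    filter_upwards [hy0, hJ.mem_nhds hs] with t h1 h2
    have h3 := (hsq t h2).1
    rw [h1, zero_mul] at h3
    exact (mul_eq_zero.1 h3).resolve_left (hode t h2).1.ne'
  have hdd : deriv (deriv r) s = 0 := by
    have : deriv r =ᶠ[𝓝 s] fun _ => 0 := hd
    rw [this.deriv_eq, deriv_const]
  have h4 := (hode s hs).2.1
  rw [hdd] at h4
  exact (hode s hs).1.ne h4

/-- For `c > -1` the differential equations of the profile amount to a linear system with respect to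
the height, up to the sign of the height. -/
lemma exists_isProfileSystem (hJ : IsOpen J) (hJ' : IsPreconnected J) (hne : J.Nonempty)
    (hc : -1 < c) (hy : ContDiffOn ℝ ∞ y J) (hH : ContDiffOn ℝ ∞ H J) (hr : ContDiffOn ℝ ∞ r J)
    (hry : ∀ s ∈ J, r s ^ 2 = y s ^ 2 - κ)
    (hunit : ∀ s ∈ J, deriv y s ^ 2 = r s ^ 2 * (1 - deriv H s ^ 2))
    (hode : ∀ s ∈ J, 0 < r s ∧ deriv (deriv r) s = -c * r s ∧ deriv r s ^ 2 = κ - c * r s ^ 2) :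
    ∃ ε : ℝ, (ε = 1 ∨ ε = -1) ∧ ∃ z k, IsProfileSystem κ (-c / (1 + c)) J y (fun s => ε * H s) z k ∧
      ∀ s ∈ J, y s ≠ 0 := by
  have hsq := sq_mul_deriv_sq hJ hy hr hry hunit hode
  have h1c : 0 < 1 + c := by linarith
  set w := √(1 + c) with hw
  have hw0 : 0 < w := Real.sqrt_pos.2 h1c
  have hw2 : w ^ 2 = 1 + c := Real.sq_sqrt h1c.le
  obtain ⟨ε, hε, hyH⟩ : ∃ ε : ℝ, (ε = 1 ∨ ε = -1) ∧ ∀ s ∈ J, y s * (ε * deriv H s) = w * r s := by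
    have := hJ'.eq_or_eq_neg_of_sq_eq
      (hy.continuousOn.mul (contDiffOn_deriv hJ hH).continuousOn)
      (continuousOn_const.mul hr.continuousOn (f := fun _ => w)) (fun s hs => by
        have := (hsq s hs).2
        change (y s * deriv H s) ^ 2 = (w * r s) ^ 2
        rw [this, mul_pow, hw2])
      (fun {s} hs => (mul_pos hw0 (hode s hs).1).ne')
    rcases this with h | h
    · exact ⟨1, Or.inl rfl, fun s hs => by rw [one_mul]; exact h hs⟩
    · refine ⟨-1, Or.inr rfl, fun s hs => ?_⟩
      have h1 : y s * deriv H s = -(w * r s) := h hs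
      linarith
  have hyne : ∀ s ∈ J, y s ≠ 0 := by
    intro s hs h0
    have := hyH s hs
    rw [h0, zero_mul] at this
    exact (mul_pos hw0 (hode s hs).1).ne this
  refine ⟨ε, hε, fun s => deriv r s / w, fun s => ε * deriv H s, ⟨hJ, hJ', hne, ?_, ?_, ?_, ?_⟩,
    hyne⟩
  · exact fun s hs => (hasDerivAt_of_contDiffOn hJ hH hs).const_mul ε
  · intro s hs
    refine (hasDerivAt_of_contDiffOn hJ hy hs).congr_deriv ?_
    apply mul_left_cancel₀ (hyne s hs)
    rw [← (hsq s hs).1]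
    have := hyH s hs
    field_simp
    linear_combination (-deriv r s) * this
  · intro s hs
    refine ((hasDerivAt_of_contDiffOn hJ (contDiffOn_deriv hJ hr) hs).div_const w).congr_deriv ?_
    rw [hyH s hs, (hode s hs).2.1, ← hw2]
    field_simp
  · intro s hs
    rw [div_pow, (hode s hs).2.2, hw2, hry s hs]
    field_simp
    ring

end Integration

/-! ### Closed embedded hypersurfaces are complete -/

section Completeness

open MeasureTheory

variable {n : ℕ}

/-- The coordinates of a vector tangent to `ℍⁿ × ℝ` at `x` are bounded by `x₁` times its length. -/
lemma sq_le_of_tangent {x w : Fin (n + 2) → ℝ} (hx : x ∈ hypProd n)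
    (hw : mink x w = x (Fin.last (n + 1)) * w (Fin.last (n + 1))) (i : Fin (n + 2)) :
    w i ^ 2 ≤ x 0 ^ 2 * mink w w := by
  have h1 := sq_mink_add_le (Fin.init x : Fin (n + 1) → ℝ) (Fin.init w)
  have h2 := mink_self_add_sq_nonneg (Fin.init w : Fin (n + 1) → ℝ)
  have h3 := (mem_hypSpace_succ.1 hx).1
  have h4 := one_le_of_mem_hypProd hx
  have h5 := mink_init x w
  have h6 := mink_init w w
  have hx0 : (Fin.init x : Fin (n + 1) → ℝ) 0 = x 0 := rfl
  have hw0 : (Fin.init w : Fin (n + 1) → ℝ) 0 = w 0 := rfl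
  have h7 : mink (Fin.init x : Fin (n + 1) → ℝ) (Fin.init w) = 0 := by linarith
  rw [h7, h3, hx0, hw0] at h1
  rw [hw0] at h2
  set N := mink (Fin.init w : Fin (n + 1) → ℝ) (Fin.init w)
  have hT : N + w 0 ^ 2 ≤ x 0 ^ 2 * N := by nlinarith
  have hN : 0 ≤ N := by nlinarith [pow_pos (zero_lt_one.trans_le h4) 2]
  have hx1 : 1 ≤ x 0 ^ 2 := by nlinarith
  rw [h6]
  have hl : 0 ≤ x 0 ^ 2 * w (Fin.last (n + 1)) ^ 2 := by positivity
  refine Fin.lastCases ?_ (fun i => ?_) i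
  · nlinarith [mul_nonneg (sq_nonneg (x 0)) hN, sq_nonneg (w (Fin.last (n + 1)))]
  · have : w i.castSucc ^ 2 ≤ N + w 0 ^ 2 := by
      refine Fin.cases ?_ (fun j => ?_) i
      · simp only [Fin.castSucc_zero]; linarith
      · have := sq_le_mink_self_add_sq (Fin.init w : Fin (n + 1) → ℝ) j
        rw [hw0] at this
        exact this
    nlinarith

/-- A function whose derivative is bounded by a multiple of `m` varies by at most that multiple of the
integral of `m`. -/
lemma abs_sub_le_mul_integral {g m : ℝ → ℝ} (hg : ContDiffOn ℝ 1 g (Icc 0 1))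
    (hm : ContinuousOn m (Icc 0 1)) (hm0 : ∀ t ∈ Icc (0 : ℝ) 1, 0 ≤ m t) {C : ℝ} (hC : 0 ≤ C)
    (hle : ∀ t ∈ Icc (0 : ℝ) 1, |derivWithin g (Icc 0 1) t| ≤ C * m t) :
    ∀ t ∈ Icc (0 : ℝ) 1, |g t - g 0| ≤ C * ∫ s in (0 : ℝ)..1, m s := by
  intro t ht
  have hsub : Icc 0 t ⊆ Icc (0 : ℝ) 1 := Icc_subset_Icc_right ht.2
  have hd : ContinuousOn (derivWithin g (Icc 0 1)) (Icc 0 1) :=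
    hg.continuousOn_derivWithin (uniqueDiffOn_Icc zero_lt_one) le_rfl
  have hint : IntervalIntegrable m volume 0 1 := by
    apply ContinuousOn.intervalIntegrable
    rwa [uIcc_of_le zero_le_one]
  have hint0 : IntervalIntegrable m volume 0 t := by
    apply ContinuousOn.intervalIntegrable
    rw [uIcc_of_le ht.1]
    exact hm.mono hsub
  have hFTC : ∫ s in (0 : ℝ)..t, derivWithin g (Icc 0 1) s = g t - g 0 := by
    refine intervalIntegral.integral_eq_sub_of_hasDerivAt_of_le ht.1 (hg.continuousOn.mono hsub)
      (fun s hs => ?_) ?_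
    · have hs' : Icc (0 : ℝ) 1 ∈ 𝓝 s := Icc_mem_nhds hs.1 (hs.2.trans_le ht.2)
      rw [derivWithin_of_mem_nhds hs']
      exact ((hg.contDiffAt hs').differentiableAt (by simp)).hasDerivAt
    · apply ContinuousOn.intervalIntegrable
      rw [uIcc_of_le ht.1]
      exact hd.mono hsub
  have h1 : ‖∫ s in (0 : ℝ)..t, derivWithin g (Icc 0 1) s‖ ≤ ∫ s in (0 : ℝ)..t, C * m s :=
    intervalIntegral.norm_integral_le_of_norm_le ht.1
      (Eventually.of_forall fun s hs => hle s (hsub (Ioc_subset_Icc_self hs))) (hint0.const_mul C)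
  rw [hFTC, Real.norm_eq_abs, intervalIntegral.integral_const_mul] at h1
  refine h1.trans (mul_le_mul_of_nonneg_left ?_ hC)
  refine intervalIntegral.integral_mono_interval le_rfl ht.1 ht.2 ?_ hint
  filter_upwards [ae_restrict_mem measurableSet_Ioc] with s hs using
    hm0 s (Ioc_subset_Icc_self hs)

/-- Along a curve of length less than `r`, the first coordinate grows at most by the factor `exp r`,
and the coordinates of the end points differ at most by a corresponding multiple of `r`. -/
lemma JoinedWithin.bounds {S : Set (Fin (n + 2) → ℝ)} (hS : S ⊆ hypProd n)
    {x y : Fin (n + 2) → ℝ} {r : ℝ} (h : JoinedWithin S x y r) :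
    y 0 ≤ x 0 * Real.exp r ∧ ∀ i, |y i - x i| ≤ x 0 * Real.exp r * r := by
  obtain ⟨γ, hγ, hmaps, h0, h1, hlen⟩ := h
  have hu := uniqueDiffOn_Icc (zero_lt_one (α := ℝ))
  set γ' := derivWithin γ (Icc 0 1) with hγ'
  set m : ℝ → ℝ := fun t => √(mink (γ' t) (γ' t)) with hm
  have hγ'c : ContinuousOn γ' (Icc 0 1) := hγ.continuousOn_derivWithin hu le_rfl
  have hmc : ContinuousOn m (Icc 0 1) := by
    have : Continuous (fun w : Fin (n + 2) → ℝ => √(mink w w)) := by unfold mink; fun_prop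
    exact this.comp_continuousOn hγ'c
  have hd : ∀ t ∈ Icc (0 : ℝ) 1, HasDerivWithinAt γ (γ' t) (Icc 0 1) t := fun t ht =>
    ((hγ t ht).differentiableWithinAt (by simp)).hasDerivWithinAt
  have hdi : ∀ i, ∀ t ∈ Icc (0 : ℝ) 1, HasDerivWithinAt (fun t => γ t i) (γ' t i) (Icc 0 1) t :=
    fun i t ht => hasDerivWithinAt_pi.1 (hd t ht) i
  have htan : ∀ t ∈ Icc (0 : ℝ) 1,
      mink (γ t) (γ' t) = γ t (Fin.last (n + 1)) * γ' t (Fin.last (n + 1)) := by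
    intro t ht
    have e1 : HasDerivWithinAt (fun t => mink (γ t) (γ t)) (2 * mink (γ t) (γ' t)) (Icc 0 1) t := by
      simp only [mink, Finset.mul_sum]
      refine HasDerivWithinAt.fun_sum fun i _ => ?_
      refine (((hdi i t ht).fun_mul (hdi i t ht)).const_mul _).congr_deriv ?_
      ring
    have e2 : HasDerivWithinAt (fun t => -1 + γ t (Fin.last (n + 1)) ^ 2)
        (2 * γ t (Fin.last (n + 1)) * γ' t (Fin.last (n + 1))) (Icc 0 1) t := by
      simpa using ((hdi (Fin.last (n + 1)) t ht).fun_pow 2).const_add (-1)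
    have e3 := e2.congr_of_mem (fun t ht => (mem_hypProd.1 (hS (hmaps ht))).1) ht
    have e4 := (hu t ht).eq_deriv _ e1 e3
    linarith
  have hbd : ∀ t ∈ Icc (0 : ℝ) 1, ∀ i, |γ' t i| ≤ γ t 0 * m t := by
    intro t ht i
    have hx0 := (zero_lt_one.trans_le (one_le_of_mem_hypProd (hS (hmaps ht)))).le
    have h2 := sq_le_of_tangent (hS (hmaps ht)) (htan t ht) i
    rw [hm, ← Real.sqrt_sq hx0, ← Real.sqrt_mul (sq_nonneg _), ← Real.sqrt_sq_eq_abs]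
    exact Real.sqrt_le_sqrt h2
  have hpos : ∀ t ∈ Icc (0 : ℝ) 1, 0 < γ t 0 := fun t ht =>
    zero_lt_one.trans_le (one_le_of_mem_hypProd (hS (hmaps ht)))
  have hci : ∀ i, ContDiffOn ℝ 1 (fun t => γ t i) (Icc 0 1) := fun i => contDiffOn_pi.1 hγ i
  have hint0 : 0 ≤ ∫ s in (0 : ℝ)..1, m s :=
    intervalIntegral.integral_nonneg zero_le_one fun s _ => Real.sqrt_nonneg _
  -- The logarithm of the first coordinate varies less than the length.
  have hlog := abs_sub_le_mul_integral (g := fun t => Real.log (γ t 0)) (m := m) (C := 1)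
    ((hci 0).log fun t ht => (hpos t ht).ne') hmc (fun t _ => Real.sqrt_nonneg _) zero_le_one
    (fun t ht => by
      rw [((hdi 0 t ht).log (hpos t ht).ne').derivWithin (hu t ht), abs_div,
        abs_of_pos (hpos t ht), one_mul, div_le_iff₀ (hpos t ht), mul_comm]
      exact hbd t ht 0)
  have hgrow : ∀ t ∈ Icc (0 : ℝ) 1, γ t 0 ≤ x 0 * Real.exp r := by
    intro t ht
    have h2 := (abs_le.1 (hlog t ht)).2
    rw [one_mul] at h2
    have h3 : Real.log (γ t 0) ≤ Real.log (γ 0 0) + r := by linarith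
    have h4 := Real.exp_le_exp.2 h3
    rwa [Real.exp_add, Real.exp_log (hpos t ht), Real.exp_log (hpos 0 (by simp)), h0] at h4
  have hx0 : 0 < x 0 := by rw [← h0]; exact hpos 0 (by simp)
  have h11 : (1 : ℝ) ∈ Icc (0 : ℝ) 1 := by simp
  refine ⟨by rw [← h1]; exact hgrow 1 h11, fun i => ?_⟩
  have h2 := abs_sub_le_mul_integral (hci i) hmc (fun t _ => Real.sqrt_nonneg _)
    (C := x 0 * Real.exp r) (by positivity) (fun t ht => by
      rw [(hdi i t ht).derivWithin (hu t ht)]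
      exact (hbd t ht i).trans
        (mul_le_mul_of_nonneg_right (hgrow t ht) (Real.sqrt_nonneg _))) 1 h11
  rw [h0, h1] at h2
  exact h2.trans (mul_le_mul_of_nonneg_left hlen.le (by positivity))

lemma IsEmbeddedHypersurface.isComplete {S : Set (Fin (n + 2) → ℝ)}
    (hS : IsEmbeddedHypersurface n S) (hcl : IsClosed S) : IsCompleteHypersurface n S := by
  refine ⟨hS, fun u hu hcauchy => ?_⟩
  obtain ⟨N₁, hN₁⟩ := hcauchy 1 one_pos
  set C := u N₁ 0 * Real.exp 1 * Real.exp 1 with hC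
  have hu0 : ∀ i, 0 < u i 0 := fun i =>
    zero_lt_one.trans_le (one_le_of_mem_hypProd (hS.1 (hu i)))
  have hCpos : 0 < C := by have := hu0 N₁; positivity
  have hcs : CauchySeq u := by
    rw [Metric.cauchySeq_iff']
    intro ε hε
    set δ := min 1 (ε / (2 * C)) with hδ
    have hδ0 : 0 < δ := lt_min one_pos (by positivity)
    obtain ⟨N, hN⟩ := hcauchy δ hδ0
    refine ⟨max N N₁, fun i hi => ?_⟩
    have h1 := (hN (max N N₁) (le_max_left _ _) i ((le_max_left _ _).trans hi)).bounds hS.1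
    have h2 := ((hN₁ N₁ le_rfl (max N N₁) (le_max_right _ _)).bounds hS.1).1
    have h3 : u (max N N₁) 0 * Real.exp δ ≤ C :=
      mul_le_mul h2 (Real.exp_le_exp.2 (min_le_left _ _)) (Real.exp_pos _).le (by
        have := hu0 N₁; positivity)
    have h4 : C * δ < ε := by
      have : C * δ ≤ C * (ε / (2 * C)) := mul_le_mul_of_nonneg_left (min_le_right _ _) hCpos.le
      have h5 : C * (ε / (2 * C)) = ε / 2 := by field_simp
      linarith
    rw [dist_pi_lt_iff hε]
    intro j
    rw [Real.dist_eq]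
    exact ((h1.2 j).trans (mul_le_mul_of_nonneg_right h3 hδ0.le)).trans_lt h4
  obtain ⟨x, hx⟩ := cauchySeq_tendsto_of_complete hcs
  exact ⟨x, hcl.mem_of_tendsto hx (Eventually.of_forall hu), hx⟩

end Completeness

/-! ### Level sets of the inner product with a vector along the height -/

section LevelSet

variable {n : ℕ}

/-- The points of `ℍⁿ × ℝ` of height in `D` at which the inner product with `v` is the value of `ψ`
at the height. -/
def levelSet (n : ℕ) (v : Fin (n + 2) → ℝ) (ψ : ℝ → ℝ) (D : Set ℝ) : Set (Fin (n + 2) → ℝ) :=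
  {x | x ∈ hypProd n ∧ x (Fin.last (n + 1)) ∈ D ∧ mink x v = ψ (x (Fin.last (n + 1)))}

/-- The level sets are embedded hypersurfaces if `ψ' ≠ 0` or if the orbits about the axis `v` have
positive radius; here `⟨x, v⟩² + ⟨v, v⟩` is the square of the radius. -/
lemma isEmbeddedHypersurface_levelSet {v : Fin (n + 2) → ℝ} (hvl : v (Fin.last (n + 1)) = 0)
    {ψ ψ' : ℝ → ℝ} {D : Set ℝ} (hD : IsOpen D) (hψ : ContDiffOn ℝ ∞ ψ D)
    (hψ' : ∀ h ∈ D, HasDerivAt ψ (ψ' h) h)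
    (hreg : ∀ x ∈ levelSet n v ψ D,
      mink x v ^ 2 + mink v v ≠ 0 ∨ ψ' (x (Fin.last (n + 1))) ≠ 0) :
    IsEmbeddedHypersurface n (levelSet n v ψ D) := by
  set ℓ := Fin.last (n + 1) with hℓ
  set O : Set (Fin (n + 2) → ℝ) := {x | 0 < x 0} ∩ {x | x ℓ ∈ D} with hO
  have hOo : IsOpen O :=
    (isOpen_lt continuous_const (continuous_apply 0)).inter (hD.preimage (continuous_apply ℓ))
  set Φ : (Fin (n + 2) → ℝ) → ℝ × ℝ :=
    fun x => (mink x x + 1 - x ℓ ^ 2, mink x v - ψ (x ℓ)) with hΦ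
  refine isEmbeddedHypersurface_of_regular (O := O) (Φ := Φ) hOo ?_ ?_ (fun x hx => hx.1) ?_
  · have h1 : ContDiff ℝ ∞ (fun x : Fin (n + 2) → ℝ => mink x x + 1 - x ℓ ^ 2) := by
      unfold mink; fun_prop
    have h2 : ContDiff ℝ ∞ (fun x : Fin (n + 2) → ℝ => mink x v) := by unfold mink; fun_prop
    have h3 : ContDiff ℝ ∞ (fun x : Fin (n + 2) → ℝ => x ℓ) := by fun_prop
    exact h1.contDiffOn.prodMk (h2.contDiffOn.sub (hψ.comp h3.contDiffOn fun x hx => hx.2))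
  · ext x
    simp only [levelSet, mem_hypProd, hO, hΦ, Prod.mk_eq_zero, mem_ofPred_eq, mem_inter_iff]
    constructor
    · rintro ⟨⟨h1, h2⟩, h3, h4⟩
      exact ⟨⟨h2, h3⟩, by rw [h1]; ring, by rw [h4]; ring⟩
    · rintro ⟨⟨h2, h3⟩, h1, h4⟩
      exact ⟨⟨by linarith, h2⟩, h3, by linarith⟩
  · intro x hx
    -- The derivative of `Φ` in the direction `w`.
    have hder : ∀ w, fderiv ℝ Φ x w
        = (2 * mink x w - 2 * x ℓ * w ℓ, mink w v - ψ' (x ℓ) * w ℓ) := by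
      intro w
      have hline : ∀ i, HasDerivAt (fun t : ℝ => (x + t • w) i) (w i) 0 := by
        intro i
        simpa using ((hasDerivAt_id (0 : ℝ)).mul_const (w i)).const_add (x i)
      have hx0 : x + (0 : ℝ) • w = x := by simp
      have hdiff : DifferentiableAt ℝ Φ x := by
        have h1 : Differentiable ℝ (fun x : Fin (n + 2) → ℝ => mink x x + 1 - x ℓ ^ 2) := by
          unfold mink; fun_prop
        have h2 : Differentiable ℝ (fun x : Fin (n + 2) → ℝ => mink x v) := by
          unfold mink; fun_prop
        have h3 : DifferentiableAt ℝ (fun x : Fin (n + 2) → ℝ => x ℓ) x := by fun_prop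
        exact (h1 x).prodMk ((h2 x).sub
          (DifferentiableAt.comp x (hψ' _ hx.2.1).differentiableAt h3))
      have hcurve : HasDerivAt (fun t : ℝ => x + t • w) w 0 := hasDerivAt_pi.2 hline
      have e1 : HasDerivAt (fun t : ℝ => Φ (x + t • w)) (fderiv ℝ Φ x w) 0 := by
        have := hdiff.hasFDerivAt
        rw [← hx0] at this
        have h4 := this.comp_hasDerivAt (0 : ℝ) hcurve
        rw [hx0] at h4
        exact h4
      have e2 : HasDerivAt (fun t : ℝ => Φ (x + t • w))
          (2 * mink x w - 2 * x ℓ * w ℓ, mink w v - ψ' (x ℓ) * w ℓ) 0 := by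
        refine HasDerivAt.prodMk ?_ ?_
        · have h5 : HasDerivAt (fun t : ℝ => mink (x + t • w) (x + t • w)) (2 * mink x w) 0 := by
            simp only [mink, Finset.mul_sum]
            refine HasDerivAt.fun_sum fun i _ => ?_
            refine (((hline i).fun_mul (hline i)).const_mul _).congr_deriv ?_
            simp only [zero_smul, add_zero]
            ring
          refine ((h5.add_const 1).fun_sub ((hline ℓ).fun_pow 2)).congr_deriv ?_
          simp
        · have h5 : HasDerivAt (fun t : ℝ => mink (x + t • w) v) (mink w v) 0 := by
            simp only [mink]
            refine HasDerivAt.fun_sum fun i _ => ?_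
            exact ((hline i).mul_const _).const_mul _
          have h6 : HasDerivAt ψ (ψ' (x ℓ)) ((x + (0 : ℝ) • w) ℓ) := by
            rw [hx0]; exact hψ' _ hx.2.1
          exact h5.fun_sub (h6.comp (0 : ℝ) (hline ℓ))
      exact e1.unique e2
    obtain ⟨hxx, -⟩ := mem_hypProd.1 hx.1
    set e := vertVec n
    have hel : e ℓ = 1 := vertVec_last
    have hev : ∀ w, mink w e = w ℓ := mink_vertVec
    -- The horizontal part of `x`.
    set a := x - x ℓ • e with ha
    have hal : a ℓ = 0 := by simp [ha, hel]
    have hxa : mink x a = -1 := by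
      rw [ha, mink_sub_right, mink_smul_right, hev, hxx]; ring
    have hav : mink a v = mink x v := by
      rw [ha, mink_sub_left, mink_smul_left, mink_comm e, hev, hvl]; ring
    have hve : mink e v = 0 := by rw [mink_comm, hev, hvl]
    set y := mink x v with hy
    have key : ∀ d : Fin (n + 2) → ℝ, 2 * mink x d - 2 * x ℓ * d ℓ = 0 →
        mink d v - ψ' (x ℓ) * d ℓ ≠ 0 → Function.Surjective (fderiv ℝ Φ x) := by
      intro d hd1 hd2 p
      set q := mink d v - ψ' (x ℓ) * d ℓ with hq
      refine ⟨(-p.1 / 2) • a + ((p.2 + p.1 / 2 * y) / q) • d, ?_⟩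
      rw [map_add, map_smul, map_smul, hder, hder, hd1, ← hq, hxa, hal, hav]
      ext
      · simp
      · simp only [Prod.smul_mk, smul_eq_mul, Prod.mk_add_mk]
        field_simp
        ring
    rcases hreg x hx with h | h
    · refine key (v + y • a) ?_ ?_
      · rw [mink_add_right, mink_smul_right, hxa, Pi.add_apply, Pi.smul_apply, hvl, hal, ← hy]
        simp
      · rw [mink_add_left, mink_smul_left, hav, Pi.add_apply, Pi.smul_apply, hvl, hal]
        intro h0
        apply h
        simp only [smul_zero, add_zero, mul_zero, sub_zero] at h0
        linarith
    · refine key e ?_ ?_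
      · rw [hev, hel]; ring
      · rw [hve, hel]
        simpa using h

lemma isClosed_levelSet {v : Fin (n + 2) → ℝ} {ψ : ℝ → ℝ} (hψ : Continuous ψ) {D : Set ℝ}
    (hD : IsClosed D) : IsClosed (levelSet n v ψ D) := by
  have h1 : Continuous (fun x : Fin (n + 2) → ℝ => mink x v) := by unfold mink; fun_prop
  exact isClosed_hypProd.inter ((hD.preimage (continuous_apply _)).inter
    (isClosed_eq h1 (hψ.comp (continuous_apply _))))

end LevelSet

/-! ### The parametrized sets in terms of the inner product with the axis vector -/

section ParametrizedSets

variable {n : ℕ}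

lemma sum_smul_coordVec_apply {m : ℕ} {ι : Fin m → Fin (n + 2)} (hι : Function.Injective ι)
    (a : Fin m → ℝ) (i : Fin m) : (∑ j, a j • coordVec n (ι j)) (ι i) = a i := by
  rw [Finset.sum_apply, Finset.sum_eq_single i]
  · simp [coordVec]
  · intro j _ hj
    simp [coordVec, hι.ne hj.symm]
  · simp

lemma sum_smul_coordVec_apply_of_ne {m : ℕ} {ι : Fin m → Fin (n + 2)} {k : Fin (n + 2)}
    (hk : ∀ j, ι j ≠ k) (a : Fin m → ℝ) : (∑ j, a j • coordVec n (ι j)) k = 0 := by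
  rw [Finset.sum_apply]
  exact Finset.sum_eq_zero fun j _ => by simp [coordVec, (hk j).symm]

lemma coordVec_apply (i j : Fin (n + 2)) : coordVec n i j = if j = i then 1 else 0 := by
  simp [coordVec, Pi.single_apply]

lemma mink_axisVec_spherical (x : Fin (n + 2) → ℝ) :
    mink x (RotationType.spherical.axisVec n) = x 0 := by
  rw [RotationType.axisVec, mink_neg_right, mink_coordVec]
  simp

lemma mink_axisVec_hyperbolic (hn : n ≠ 0) (x : Fin (n + 2) → ℝ) :
    mink x (RotationType.hyperbolic.axisVec n) = x (Fin.last n).castSucc := by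
  rw [RotationType.axisVec, mink_coordVec]
  simp [hn]

lemma mink_axisVec_parabolic (hn : n ≠ 0) (x : Fin (n + 2) → ℝ) :
    mink x (RotationType.parabolic.axisVec n) = (x 0 - x (Fin.last n).castSucc) / √2 :=
  mink_nullVecTwo x hn

lemma sphericalSet_eq (hn : n ≠ 0) (k h : ℝ → ℝ) :
    sphericalSet n k h = {x | x ∈ hypProd n ∧ ∃ s,
      mink x (RotationType.spherical.axisVec n) = Real.cosh (k s) ∧
        x (Fin.last (n + 1)) = h s} := by
  have hι : Function.Injective fun i : Fin n => i.castSucc.succ := fun i j hij =>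
    Fin.castSucc_injective _ (Fin.succ_injective _ hij)
  have hι0 : ∀ j : Fin n, j.castSucc.succ ≠ 0 := fun j => Fin.succ_ne_zero _
  have hιl : ∀ j : Fin n, j.castSucc.succ ≠ Fin.last (n + 1) := fun j hj => by
    rw [← Fin.succ_last, Fin.succ_inj] at hj
    exact Fin.castSucc_ne_last j hj
  have h0l : (0 : Fin (n + 2)) ≠ Fin.last (n + 1) := (Fin.last_pos).ne
  have hmink : ∀ x : Fin (n + 2) → ℝ, mink x x
      = -x 0 ^ 2 + ∑ i : Fin n, x i.castSucc.succ ^ 2 + x (Fin.last (n + 1)) ^ 2 := by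
    intro x
    rw [mink_self_succ, Fin.sum_univ_castSucc, Fin.succ_last]
    ring
  have hpt : ∀ (s : ℝ) (φ : Fin n → ℝ) (x : Fin (n + 2) → ℝ),
      x = Real.cosh (k s) • coordVec n 0
        + ∑ i : Fin n, (Real.sinh (k s) * φ i) • coordVec n i.castSucc.succ + h s • vertVec n ↔
      x 0 = Real.cosh (k s) ∧ (∀ i : Fin n, x i.castSucc.succ = Real.sinh (k s) * φ i) ∧
        x (Fin.last (n + 1)) = h s := by
    intro s φ x
    have c0 : (Real.cosh (k s) • coordVec n 0 + ∑ i : Fin n, (Real.sinh (k s) * φ i) •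
        coordVec n i.castSucc.succ + h s • vertVec n) 0 = Real.cosh (k s) := by
      rw [Pi.add_apply, Pi.add_apply, sum_smul_coordVec_apply_of_ne (ι := fun i => i.castSucc.succ)
        hι0]
      simp [vertVec, coordVec_apply, h0l]
    have ci : ∀ i : Fin n, (Real.cosh (k s) • coordVec n 0 + ∑ i : Fin n, (Real.sinh (k s) * φ i) •
        coordVec n i.castSucc.succ + h s • vertVec n) i.castSucc.succ = Real.sinh (k s) * φ i := by
      intro i
      rw [Pi.add_apply, Pi.add_apply, sum_smul_coordVec_apply (ι := fun i => i.castSucc.succ) hι]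
      simp [vertVec, coordVec_apply, hι0, hιl]
    have cl : (Real.cosh (k s) • coordVec n 0 + ∑ i : Fin n, (Real.sinh (k s) * φ i) •
        coordVec n i.castSucc.succ + h s • vertVec n) (Fin.last (n + 1)) = h s := by
      rw [Pi.add_apply, Pi.add_apply, sum_smul_coordVec_apply_of_ne (ι := fun i => i.castSucc.succ)
        hιl]
      simp [vertVec, coordVec_apply, h0l.symm]
    constructor
    · rintro rfl
      exact ⟨c0, ci, cl⟩
    · rintro ⟨e0, ei, el⟩
      ext j
      refine Fin.cases (e0.trans c0.symm) (fun j => ?_) j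
      exact Fin.lastCases (el.trans cl.symm) (fun i => (ei i).trans (ci i).symm) j
  ext x
  simp only [sphericalSet, mem_ofPred_eq, mem_hypProd, mink_axisVec_spherical]
  constructor
  · rintro ⟨s, φ, hφ, hx⟩
    obtain ⟨e0, ei, el⟩ := (hpt s φ x).1 hx
    refine ⟨⟨?_, by rw [e0]; exact Real.cosh_pos _⟩, s, e0, el⟩
    have : ∑ i : Fin n, x i.castSucc.succ ^ 2 = Real.sinh (k s) ^ 2 := by
      simp only [ei, mul_pow, ← Finset.mul_sum, hφ, mul_one]
    rw [hmink, this, e0, Real.cosh_sq]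
    ring
  · rintro ⟨⟨h1, -⟩, s, e0, el⟩
    have hsum : ∑ i : Fin n, x i.castSucc.succ ^ 2 = Real.sinh (k s) ^ 2 := by
      rw [hmink, e0, Real.cosh_sq] at h1
      linarith
    by_cases hs : Real.sinh (k s) = 0
    · -- On the axis every direction parametrizes the point.
      refine ⟨s, Pi.single ⟨0, Nat.pos_of_ne_zero hn⟩ 1, by simp [Pi.single_apply, ite_pow],
        (hpt _ _ _).2 ⟨e0, fun i => ?_, el⟩⟩
      rw [hs, zero_mul]
      rw [hs, zero_pow two_ne_zero] at hsum
      exact pow_eq_zero_iff two_ne_zero |>.1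
        ((Finset.sum_eq_zero_iff_of_nonneg fun i _ => sq_nonneg _).1 hsum i (Finset.mem_univ i))
    · refine ⟨s, fun i => x i.castSucc.succ / Real.sinh (k s), ?_,
        (hpt _ _ _).2 ⟨e0, fun i => (mul_div_cancel₀ _ hs).symm, el⟩⟩
      simp only [div_pow, ← Finset.sum_div, hsum]
      exact div_self (pow_ne_zero 2 hs)

lemma hyperbolicSet_eq (hn : n ≠ 0) (k h : ℝ → ℝ) :
    hyperbolicSet n k h = {x | x ∈ hypProd n ∧ ∃ s,
      mink x (RotationType.hyperbolic.axisVec n) = Real.sinh (k s) ∧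
        x (Fin.last (n + 1)) = h s} := by
  obtain ⟨m, rfl⟩ := Nat.exists_eq_succ_of_ne_zero hn
  simp only [Nat.succ_eq_add_one] at *
  have hι : Function.Injective fun i : Fin (m + 1) => i.castSucc.castSucc := fun i j hij =>
    Fin.castSucc_injective _ (Fin.castSucc_injective _ hij)
  have hιn : ∀ j : Fin (m + 1), j.castSucc.castSucc ≠ (Fin.last (m + 1)).castSucc := fun j hj =>
    Fin.castSucc_ne_last j (Fin.castSucc_injective _ hj)
  have hιl : ∀ j : Fin (m + 1), j.castSucc.castSucc ≠ Fin.last ((m + 1) + 1) := fun j =>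
    Fin.castSucc_ne_last _
  have hnl : (Fin.last (m + 1)).castSucc ≠ Fin.last ((m + 1) + 1) := Fin.castSucc_ne_last _
  have hmink : ∀ x : Fin ((m + 1) + 2) → ℝ, mink x x = mink (fun i : Fin (m + 1) => x i.castSucc.castSucc)
      (fun i => x i.castSucc.castSucc) + x (Fin.last (m + 1)).castSucc ^ 2
        + x (Fin.last ((m + 1) + 1)) ^ 2 := by
    intro x
    rw [mink_init, mink_init (Fin.init x : Fin (m + 2) → ℝ), sq, sq]
    rfl
  have hpt : ∀ (s : ℝ) (φ : Fin (m + 1) → ℝ) (x : Fin ((m + 1) + 2) → ℝ),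
      x = ∑ i : Fin (m + 1), (Real.cosh (k s) * φ i) • coordVec (m + 1) i.castSucc.castSucc
        + Real.sinh (k s) • coordVec (m + 1) (Fin.last (m + 1)).castSucc + h s • vertVec (m + 1) ↔
      (∀ i : Fin (m + 1), x i.castSucc.castSucc = Real.cosh (k s) * φ i) ∧
        x (Fin.last (m + 1)).castSucc = Real.sinh (k s) ∧ x (Fin.last ((m + 1) + 1)) = h s := by
    intro s φ x
    have ci : ∀ i : Fin (m + 1), (∑ i : Fin (m + 1), (Real.cosh (k s) * φ i) • coordVec (m + 1) i.castSucc.castSucc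
        + Real.sinh (k s) • coordVec (m + 1) (Fin.last (m + 1)).castSucc + h s • vertVec (m + 1)) i.castSucc.castSucc
          = Real.cosh (k s) * φ i := by
      intro i
      rw [Pi.add_apply, Pi.add_apply,
        sum_smul_coordVec_apply (ι := fun i => i.castSucc.castSucc) hι]
      simp [vertVec, coordVec_apply, hιn, hιl]
    have cn : (∑ i : Fin (m + 1), (Real.cosh (k s) * φ i) • coordVec (m + 1) i.castSucc.castSucc
        + Real.sinh (k s) • coordVec (m + 1) (Fin.last (m + 1)).castSucc + h s • vertVec (m + 1))
          (Fin.last (m + 1)).castSucc = Real.sinh (k s) := by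
      rw [Pi.add_apply, Pi.add_apply,
        sum_smul_coordVec_apply_of_ne (ι := fun i => i.castSucc.castSucc) hιn]
      simp [vertVec, coordVec_apply, hnl]
    have cl : (∑ i : Fin (m + 1), (Real.cosh (k s) * φ i) • coordVec (m + 1) i.castSucc.castSucc
        + Real.sinh (k s) • coordVec (m + 1) (Fin.last (m + 1)).castSucc + h s • vertVec (m + 1))
          (Fin.last ((m + 1) + 1)) = h s := by
      rw [Pi.add_apply, Pi.add_apply,
        sum_smul_coordVec_apply_of_ne (ι := fun i => i.castSucc.castSucc) hιl]
      simp [vertVec, coordVec_apply, hnl.symm]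
    constructor
    · rintro rfl
      exact ⟨ci, cn, cl⟩
    · rintro ⟨ei, en, el⟩
      ext j
      refine Fin.lastCases (el.trans cl.symm) (fun j => ?_) j
      exact Fin.lastCases (en.trans cn.symm) (fun i => (ei i).trans (ci i).symm) j
  have hfun : ∀ (a : ℝ) (φ : Fin (m + 1) → ℝ), mink (fun i => a * φ i) (fun i => a * φ i)
      = a ^ 2 * mink φ φ := by
    intro a φ
    have : (fun i => a * φ i) = a • φ := rfl
    rw [this, mink_smul_left, mink_smul_right]
    ring
  ext x
  simp only [hyperbolicSet, mem_ofPred_eq, mem_hypProd, mink_axisVec_hyperbolic hn]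
  constructor
  · rintro ⟨s, φ, hφ, hx⟩
    obtain ⟨ei, en, el⟩ := (hpt s φ x).1 hx
    rw [mem_hypSpace_succ] at hφ
    refine ⟨⟨?_, ?_⟩, s, en, el⟩
    · rw [hmink]
      simp only [ei]
      rw [hfun, hφ.1, en, Real.cosh_sq]
      ring
    · have := ei (0 : Fin (m + 1))
      change x 0 = _ at this
      rw [this]
      exact mul_pos (Real.cosh_pos _) hφ.2
  · rintro ⟨⟨h1, h2⟩, s, en, el⟩
    have hc := (Real.cosh_pos (k s)).ne'
    refine ⟨s, fun i => x i.castSucc.castSucc / Real.cosh (k s), ?_,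
      (hpt _ _ _).2 ⟨fun i => (mul_div_cancel₀ _ hc).symm, en, el⟩⟩
    rw [mem_hypSpace_succ]
    constructor
    · have h3 : (fun i : Fin (m + 1) => x i.castSucc.castSucc / Real.cosh (k s))
          = fun i => (Real.cosh (k s))⁻¹ * x i.castSucc.castSucc := by
        funext i; rw [div_eq_inv_mul]
      rw [h3, hfun]
      rw [hmink, en] at h1
      have h4 : mink (fun i : Fin (m + 1) => x i.castSucc.castSucc) (fun i => x i.castSucc.castSucc)
          = -Real.cosh (k s) ^ 2 := by
        rw [Real.cosh_sq]; linarith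
      rw [h4]
      field_simp
    · exact div_pos h2 (Real.cosh_pos _)

lemma parabolicSet_eq (hn : n ≠ 0) (k h : ℝ → ℝ) (hk : ∀ s, 0 < k s) :
    parabolicSet n k h = {x | x ∈ hypProd n ∧ ∃ s,
      mink x (RotationType.parabolic.axisVec n) = k s ∧ x (Fin.last (n + 1)) = h s} := by
  obtain ⟨m, rfl⟩ := Nat.exists_eq_succ_of_ne_zero hn
  simp only [Nat.succ_eq_add_one] at *
  set a : Fin (m + 1 + 2) := (Fin.last (m + 1)).castSucc with ha
  set b : Fin (m + 1 + 2) := Fin.last (m + 1 + 1) with hb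
  set ι : Fin m → Fin (m + 1 + 2) := fun j => ⟨(j : ℕ) + 1, by omega⟩ with hιdef
  have hι : Function.Injective ι := fun i j hij => by
    have := congrArg Fin.val hij
    simp only [hιdef] at this
    exact Fin.ext (by omega)
  have hι0 : ∀ j, ι j ≠ 0 := fun j hj => by
    have := congrArg Fin.val hj
    simp [hιdef] at this
  have hιa : ∀ j, ι j ≠ a := fun j hj => by
    have := congrArg Fin.val hj
    simp [hιdef, ha] at this
    omega
  have hιb : ∀ j, ι j ≠ b := fun j hj => by
    have := congrArg Fin.val hj
    simp [hιdef, hb] at this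
    omega
  have h0a : (0 : Fin (m + 1 + 2)) ≠ a := fun hj => by
    have := congrArg Fin.val hj
    simp [ha] at this
  have h0b : (0 : Fin (m + 1 + 2)) ≠ b := fun hj => by
    have := congrArg Fin.val hj
    simp [hb] at this
  have hab : a ≠ b := Fin.castSucc_ne_last _
  have hι' : ∀ j : Fin m, j.castSucc.castSucc.succ = ι j := fun j => rfl
  have hcases : ∀ {P : Fin (m + 1 + 2) → Prop}, P 0 → (∀ j, P (ι j)) → P a → P b → ∀ i, P i := by
    intro P h0 hj hna hnb i
    refine Fin.cases h0 (fun i => ?_) i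
    refine Fin.lastCases hnb (fun i => ?_) i
    refine Fin.lastCases hna (fun i => ?_) i
    exact hj i
  have hmink : ∀ x : Fin (m + 1 + 2) → ℝ,
      mink x x = -x 0 ^ 2 + ∑ j, x (ι j) ^ 2 + x a ^ 2 + x b ^ 2 := by
    intro x
    rw [mink_self_succ, Fin.sum_univ_castSucc, Fin.sum_univ_castSucc]
    simp only [hι']
    have e1 : (Fin.last (m + 1)).succ = b := rfl
    have e2 : (Fin.last m).castSucc.succ = a := rfl
    rw [e1, e2]
    ring
  have h2 : √2 ^ 2 = (2 : ℝ) := Real.sq_sqrt (by norm_num)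
  have h20 : √2 ≠ (0 : ℝ) := by positivity
  have hpt : ∀ (k h q : ℝ) (t : Fin m → ℝ) (x : Fin (m + 1 + 2) → ℝ),
      x = k • nullVecOne (m + 1) + ∑ j, (k * t j) • coordVec (m + 1) (ι j)
        + q • nullVecTwo (m + 1) + h • vertVec (m + 1) ↔
      x 0 = (k - q) / √2 ∧ (∀ j, x (ι j) = k * t j) ∧ x a = (-k - q) / √2 ∧ x b = h := by
    intro k h q t x
    set X := k • nullVecOne (m + 1) + ∑ j, (k * t j) • coordVec (m + 1) (ι j)
        + q • nullVecTwo (m + 1) + h • vertVec (m + 1) with hX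
    have c0 : X 0 = (k - q) / √2 := by
      rw [hX, Pi.add_apply, Pi.add_apply, Pi.add_apply, sum_smul_coordVec_apply_of_ne hι0]
      simp [nullVecOne, nullVecTwo, vertVec, coordVec_apply, h0a, h0b, ← ha, ← hb]
      ring
    have ca : X a = (-k - q) / √2 := by
      rw [hX, Pi.add_apply, Pi.add_apply, Pi.add_apply, sum_smul_coordVec_apply_of_ne hιa]
      simp [nullVecOne, nullVecTwo, vertVec, coordVec_apply, h0a.symm, hab, ← ha, ← hb]
      ring
    have cb : X b = h := by
      rw [hX, Pi.add_apply, Pi.add_apply, Pi.add_apply, sum_smul_coordVec_apply_of_ne hιb]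
      simp [nullVecOne, nullVecTwo, vertVec, coordVec_apply, h0b.symm, hab.symm, ← ha, ← hb]
    have cj : ∀ j, X (ι j) = k * t j := by
      intro j
      rw [hX, Pi.add_apply, Pi.add_apply, Pi.add_apply, sum_smul_coordVec_apply hι]
      simp [nullVecOne, nullVecTwo, vertVec, coordVec_apply, hι0, hιa, hιb, ← ha, ← hb]
    constructor
    · rintro rfl
      exact ⟨c0, cj, ca, cb⟩
    · rintro ⟨e0, ej, ea, eb⟩
      ext i
      exact hcases (P := fun i => x i = X i) (e0.trans c0.symm) (fun j => (ej j).trans (cj j).symm)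
        (ea.trans ca.symm) (eb.trans cb.symm) i
  ext x
  simp only [mem_ofPred_eq, mem_hypProd, mink_axisVec_parabolic hn]
  constructor
  · rintro ⟨s, t, hx⟩
    change Fin m → ℝ at t
    change x = k s • nullVecOne (m + 1) + ∑ j : Fin m, (k s * t j) • coordVec (m + 1) (ι j)
      + (-(1 / (2 * k s)) - k s / 2 * ∑ j : Fin m, t j ^ 2) • nullVecTwo (m + 1)
      + h s • vertVec (m + 1) at hx
    obtain ⟨e0, ej, ea, eb⟩ := (hpt _ _ _ t x).1 hx
    have hks := hk s
    have hsum : ∑ j, x (ι j) ^ 2 = k s ^ 2 * ∑ j, t j ^ 2 := by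
      simp only [ej, mul_pow, ← Finset.mul_sum]
    have hT : 0 ≤ ∑ j, t j ^ 2 := Finset.sum_nonneg fun j _ => sq_nonneg _
    refine ⟨⟨?_, ?_⟩, s, ?_, eb⟩
    · rw [hmink, hsum, e0, ea]
      change _ = -1 + x b ^ 2
      rw [div_pow, div_pow, h2]
      field_simp
      ring
    · rw [e0]
      have : 0 ≤ k s / 2 * ∑ j, t j ^ 2 := by positivity
      have : 0 < 1 / (2 * k s) := by positivity
      apply div_pos _ (by positivity)
      linarith
    · rw [e0, ea]
      field_simp
      rw [h2]
      ring
  · rintro ⟨⟨h1, h3⟩, s, e1, eb⟩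
    have hks := hk s
    have h4 : x 0 - x a = √2 * k s := by rw [← e1, mul_div_cancel₀ _ h20]
    have hsum : ∑ j, (x (ι j) / k s) ^ 2 = (∑ j, x (ι j) ^ 2) / k s ^ 2 := by
      simp only [div_pow, Finset.sum_div]
    rw [hmink] at h1
    change _ = -1 + x b ^ 2 at h1
    have h5 : (x 0 + x a) * (√2 * k s) = 1 + ∑ j, x (ι j) ^ 2 := by
      rw [← h4]; linarith
    set T := ∑ j, x (ι j) ^ 2
    have h6 : x 0 + x a = (1 + T) / (√2 * k s) := by field_simp; linarith
    refine ⟨s, fun j => x (ι j) / k s, (hpt _ _ _ _ x).2 ⟨?_, fun j => ?_, ?_, eb⟩⟩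
    · have : x 0 = ((√2 * k s) + (1 + T) / (√2 * k s)) / 2 := by linarith
      change x 0 = (k s - (-(1 / (2 * k s)) - k s / 2 * ∑ j : Fin m, (x (ι j) / k s) ^ 2)) / √2
      rw [this, hsum]
      field_simp
      rw [h2]
      ring
    · field_simp
    · have : x a = (-(√2 * k s) + (1 + T) / (√2 * k s)) / 2 := by linarith
      change x a = (-k s - (-(1 / (2 * k s)) - k s / 2 * ∑ j : Fin m, (x (ι j) / k s) ^ 2)) / √2
      rw [this, hsum]
      field_simp
      rw [h2]
      ring

end ParametrizedSets

/-! ### Rotation hypersurfaces with axis in normal position -/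

section PlanarCurves

variable {n : ℕ}

/-- The point of the coordinate space spanned by `∂/∂x₁`, `∂/∂x_{n+1}`, `∂/∂x_{n+2}` with
coordinates `p`, `q`, `h`. -/
def planarPoint (n : ℕ) (p q h : ℝ) : Fin (n + 2) → ℝ :=
  p • coordVec n 0 + q • coordVec n (Fin.last n).castSucc + h • vertVec n

lemma zero_ne_last_castSucc (hn : n ≠ 0) : (0 : Fin (n + 2)) ≠ (Fin.last n).castSucc := by
  intro h
  have := congrArg Fin.val h
  simp at this
  omega

lemma planarPoint_zero (hn : n ≠ 0) (p q h : ℝ) : planarPoint n p q h 0 = p := by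
  simp [planarPoint, vertVec, coordVec_apply, zero_ne_last_castSucc hn, (Fin.last_pos).ne]

lemma planarPoint_castSucc (hn : n ≠ 0) (p q h : ℝ) :
    planarPoint n p q h (Fin.last n).castSucc = q := by
  simp [planarPoint, vertVec, coordVec_apply, (zero_ne_last_castSucc hn).symm,
    Fin.castSucc_ne_last]

lemma planarPoint_last (p q h : ℝ) : planarPoint n p q h (Fin.last (n + 1)) = h := by
  simp [planarPoint, vertVec, coordVec_apply, (Fin.last_pos).ne',
    (Fin.castSucc_ne_last (Fin.last n)).symm]

lemma mink_planarPoint (hn : n ≠ 0) (p q h p' q' h' : ℝ) :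
    mink (planarPoint n p q h) (planarPoint n p' q' h') = -(p * p') + q * q' + h * h' := by
  conv_lhs => rw [planarPoint.eq_1 n p' q' h']
  rw [mink_add_right, mink_add_right, mink_smul_right, mink_smul_right, mink_smul_right,
    mink_coordVec, mink_coordVec, mink_vertVec, planarPoint_zero hn, planarPoint_castSucc hn,
    planarPoint_last]
  simp [hn]
  ring

lemma planarPoint_mem_hypProd (hn : n ≠ 0) {p q : ℝ} (hp : 0 < p) (hpq : p ^ 2 = 1 + q ^ 2)
    (h : ℝ) : planarPoint n p q h ∈ hypProd n := by
  rw [mem_hypProd, mink_planarPoint hn, planarPoint_zero hn, planarPoint_last]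
  exact ⟨by linear_combination -hpq, hp⟩

lemma axisVec_mem_span (τ : RotationType) :
    τ.axisVec n ∈ Submodule.span ℝ
      (range ![coordVec n 0, coordVec n (Fin.last n).castSucc, vertVec n]) := by
  have h0 : coordVec n 0 ∈ Submodule.span ℝ
      (range ![coordVec n 0, coordVec n (Fin.last n).castSucc, vertVec n]) :=
    Submodule.subset_span ⟨0, rfl⟩
  have h1 : coordVec n (Fin.last n).castSucc ∈ Submodule.span ℝ
      (range ![coordVec n 0, coordVec n (Fin.last n).castSucc, vertVec n]) :=
    Submodule.subset_span ⟨1, rfl⟩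
  cases τ with
  | spherical => exact Submodule.neg_mem _ h0
  | hyperbolic => exact h1
  | parabolic => exact Submodule.smul_mem _ _ (Submodule.add_mem _ h0 h1)

lemma axisVec_ne_zero (hn : n ≠ 0) (τ : RotationType) : τ.axisVec n ≠ 0 := by
  intro h
  have h1 := mink_axisVec_self hn τ
  cases τ with
  | spherical => rw [h, mink_zero_left, RotationType.sign] at h1; norm_num at h1
  | hyperbolic => rw [h, mink_zero_left, RotationType.sign] at h1; norm_num at h1
  | parabolic =>
    have h2 : mink (coordVec n 0) (RotationType.parabolic.axisVec n) = 1 / √2 := by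
      rw [mink_axisVec_parabolic hn, coordVec_apply, coordVec_apply,
        if_neg (zero_ne_last_castSucc hn).symm]
      simp
    rw [h, mink_zero_right] at h2
    have : (0 : ℝ) < 1 / √2 := by positivity
    linarith

lemma isAxisPair_span (hn : n ≠ 0) (τ : RotationType) :
    IsAxisPair n (Submodule.span ℝ (range ![τ.axisVec n, vertVec n]))
      (Submodule.span ℝ
        (range ![coordVec n 0, coordVec n (Fin.last n).castSucc, vertVec n])) := by
  refine ⟨?_, Submodule.subset_span ⟨0, rfl⟩, Submodule.subset_span ⟨2, rfl⟩, ?_, ?_,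
    Submodule.subset_span ⟨1, rfl⟩⟩
  · refine (finrank_span_eq_card (Fintype.linearIndependent_iff.2 fun a ha => ?_)).trans (by simp)
    rw [Fin.sum_univ_three] at ha
    have ha' : planarPoint n (a 0) (a 1) (a 2) = 0 := ha
    intro i
    fin_cases i
    · have := congrFun ha' 0
      rwa [planarPoint_zero hn] at this
    · have := congrFun ha' (Fin.last n).castSucc
      rwa [planarPoint_castSucc hn] at this
    · have := congrFun ha' (Fin.last (n + 1))
      rwa [planarPoint_last] at this
  · refine (finrank_span_eq_card (LinearIndependent.pair_iff.2 fun a b hab => ?_)).trans (by simp)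
    have hb := congrFun hab (Fin.last (n + 1))
    simp only [Pi.add_apply, Pi.smul_apply, axisVec_last hn, vertVec_last, smul_eq_mul, mul_zero,
      mul_one, zero_add, Pi.zero_apply] at hb
    rw [hb, zero_smul, add_zero] at hab
    exact ⟨(smul_eq_zero.1 hab).resolve_right (axisVec_ne_zero hn τ), hb⟩
  · rw [Submodule.span_le]
    rintro _ ⟨i, rfl⟩
    fin_cases i
    · exact axisVec_mem_span τ
    · exact Submodule.subset_span ⟨2, rfl⟩

lemma mem_span_axisVec {τ : RotationType} {w : Fin (n + 2) → ℝ}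
    (hw : w ∈ Submodule.span ℝ (range ![τ.axisVec n, vertVec n])) :
    ∃ a b : ℝ, w = a • τ.axisVec n + b • vertVec n := by
  rw [Matrix.range_cons, Matrix.range_cons, Matrix.range_empty, union_empty, singleton_union,
    Submodule.mem_span_pair] at hw
  obtain ⟨a, b, h⟩ := hw
  exact ⟨a, b, h.symm⟩

lemma axis_span (hn : n ≠ 0) (τ : RotationType) :
    τ.Axis (Submodule.span ℝ (range ![τ.axisVec n, vertVec n])) := by
  have hmem : τ.axisVec n ∈ Submodule.span ℝ (range ![τ.axisVec n, vertVec n]) :=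
    Submodule.subset_span ⟨0, rfl⟩
  have hav : mink (τ.axisVec n) (vertVec n) = 0 := by rw [mink_vertVec, axisVec_last hn]
  have haa := mink_axisVec_self hn τ
  have hvv : mink (vertVec n) (vertVec n) = 1 := by rw [mink_vertVec, vertVec_last]
  cases τ with
  | spherical => exact ⟨_, hmem, by rw [haa]; norm_num [RotationType.sign]⟩
  | hyperbolic =>
    intro w hw hw0
    obtain ⟨a, b, rfl⟩ := mem_span_axisVec hw
    simp only [mink_add_left, mink_add_right, mink_smul_left, mink_smul_right, haa, hav, hvv,
      mink_comm (vertVec n) (RotationType.hyperbolic.axisVec n), RotationType.sign]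
    by_contra hle
    have ha : a = 0 := by nlinarith [sq_nonneg a, sq_nonneg b]
    have hb : b = 0 := by nlinarith [sq_nonneg a, sq_nonneg b]
    exact hw0 (by rw [ha, hb]; simp)
  | parabolic =>
    refine ⟨_, hmem, axisVec_ne_zero hn _, fun w hw => ?_⟩
    obtain ⟨a, b, rfl⟩ := mem_span_axisVec hw
    rw [mink_add_right, mink_smul_right, mink_smul_right, haa, hav, RotationType.sign]
    ring

/-- A unit speed planar curve generates a rotation hypersurface with axis in normal position. In
the spherical case the half-space condition is `q ≥ 0`; in the other cases it holds because the axis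
does not meet `ℍⁿ × ℝ`. -/
lemma isRotationHypersurface_planar (hn : n ≠ 0) (τ : RotationType) {I : Set ℝ}
    (hI : I.OrdConnected) (hne : (interior I).Nonempty) {p q h p' q' h' y : ℝ → ℝ}
    (hp : ContDiff ℝ ∞ p) (hq : ContDiff ℝ ∞ q) (hh : ContDiff ℝ ∞ h)
    (hp' : ∀ s, HasDerivAt p (p' s) s) (hq' : ∀ s, HasDerivAt q (q' s) s)
    (hh' : ∀ s, HasDerivAt h (h' s) s) (hp0 : ∀ s, 0 < p s) (hpq : ∀ s, p s ^ 2 = 1 + q s ^ 2)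
    (hunit : ∀ s, -p' s ^ 2 + q' s ^ 2 + h' s ^ 2 = 1) (hq0 : τ = .spherical → ∀ s ∈ I, 0 ≤ q s)
    (hy : ∀ s, mink (planarPoint n (p s) (q s) (h s)) (τ.axisVec n) = y s) :
    IsRotationHypersurface n τ {x | x ∈ hypProd n ∧ ∃ s ∈ I, mink x (τ.axisVec n) = y s ∧
      x (Fin.last (n + 1)) = h s} := by
  set α : ℝ → Fin (n + 2) → ℝ := fun s => planarPoint n (p s) (q s) (h s) with hα
  have hmem : ∀ s, α s ∈ hypProd n := fun s => planarPoint_mem_hypProd hn (hp0 s) (hpq s) _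
  have hαc : ContDiff ℝ ∞ α := ((hp.smul contDiff_const).add (hq.smul contDiff_const)).add
    (hh.smul contDiff_const)
  have hα' : ∀ s, HasDerivAt α (planarPoint n (p' s) (q' s) (h' s)) s := fun s =>
    (((hp' s).smul_const _).fun_add ((hq' s).smul_const _)).fun_add ((hh' s).smul_const _)
  refine ⟨_, _, I, α, isAxisPair_span hn τ, axis_span hn τ,
    ⟨hI, hne, hαc.contDiffOn, fun s _ => ⟨hmem s, ?_⟩, fun s hs => ?_, ?_⟩, ?_⟩
  · exact Submodule.add_mem _ (Submodule.add_mem _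
      (Submodule.smul_mem _ _ (Submodule.subset_span ⟨0, rfl⟩))
      (Submodule.smul_mem _ _ (Submodule.subset_span ⟨1, rfl⟩)))
      (Submodule.smul_mem _ _ (Submodule.subset_span ⟨2, rfl⟩))
  · rw [(hα' s).hasDerivWithinAt.derivWithin (uniqueDiffOn_convex hI.convex hne s hs),
      mink_planarPoint hn]
    linear_combination hunit s
  · -- The linear form that defines the half-space.
    have hzero : ∀ ℓ : (Fin (n + 2) → ℝ) →ₗ[ℝ] ℝ, ℓ (τ.axisVec n) = 0 → ℓ (vertVec n) = 0 →
        ∀ x ∈ Submodule.span ℝ (range ![τ.axisVec n, vertVec n]), ℓ x = 0 := by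
      intro ℓ h1 h2 x hx
      obtain ⟨a, b, rfl⟩ := mem_span_axisVec hx
      rw [map_add, map_smul, map_smul, h1, h2]
      simp
    have hvert0 : vertVec n 0 = 0 := by simp [vertVec, coordVec_apply, (Fin.last_pos).ne]
    have hvertn : vertVec n (Fin.last n).castSucc = 0 := by
      simp [vertVec, coordVec_apply, Fin.castSucc_ne_last]
    cases τ with
    | spherical =>
      refine ⟨LinearMap.proj (Fin.last n).castSucc, hzero _ ?_ hvertn,
        ⟨coordVec n (Fin.last n).castSucc, Submodule.subset_span ⟨1, rfl⟩, ?_⟩, fun s hs => ?_⟩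
      · simp [RotationType.axisVec, coordVec_apply, (zero_ne_last_castSucc hn).symm]
      · simp [coordVec_apply]
      · simp only [LinearMap.proj_apply, hα, planarPoint_castSucc hn]
        exact hq0 rfl s hs
    | hyperbolic =>
      refine ⟨LinearMap.proj 0, hzero _ ?_ hvert0,
        ⟨coordVec n 0, Submodule.subset_span ⟨0, rfl⟩, ?_⟩, fun s hs => ?_⟩
      · simp [RotationType.axisVec, coordVec_apply, zero_ne_last_castSucc hn]
      · simp [coordVec_apply]
      · simp only [LinearMap.proj_apply, hα, planarPoint_zero hn]
        exact (hp0 s).le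
    | parabolic =>
      refine ⟨minkForm (RotationType.parabolic.axisVec n), hzero _ ?_ ?_,
        ⟨coordVec n 0, Submodule.subset_span ⟨0, rfl⟩, ?_⟩, fun s hs => ?_⟩
      · change mink _ _ = 0
        rw [mink_axisVec_self hn, RotationType.sign, neg_zero]
      · change mink _ _ = 0
        rw [mink_comm, mink_vertVec, axisVec_last hn]
      · change mink _ _ ≠ 0
        rw [mink_axisVec_parabolic hn, coordVec_apply, coordVec_apply,
          if_neg (zero_ne_last_castSucc hn).symm]
        simp
      · exact (mink_axisVec_pos hn (by simp) (hmem s)).le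
  · have hv : τ.axisVec n ∈ Submodule.span ℝ (range ![τ.axisVec n, vertVec n]) :=
      Submodule.subset_span ⟨0, rfl⟩
    have hv' : vertVec n ∈ Submodule.span ℝ (range ![τ.axisVec n, vertVec n]) :=
      Submodule.subset_span ⟨1, rfl⟩
    rw [rotationOrbit_eq hv hv' (fun w hw => mem_span_axisVec hw) (fun s _ => hmem s)]
    simp only [hα, hy, planarPoint_last]

end PlanarCurves

/-! ### Level sets as complete rotation hypersurfaces -/

section Models

variable {n : ℕ}

/-- A set of points whose inner product with `v` and whose height are those of a point of a curve is
a level set if the curve is the graph of `ψ`. -/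
lemma setOf_exists_eq_levelSet {v : Fin (n + 2) → ℝ} {I D : Set ℝ} {y h ψ : ℝ → ℝ}
    (hrel : ∀ s ∈ I, h s ∈ D ∧ y s = ψ (h s))
    (hsurj : ∀ x ∈ levelSet n v ψ D, ∃ s ∈ I, h s = x (Fin.last (n + 1))) :
    {x | x ∈ hypProd n ∧ ∃ s ∈ I, mink x v = y s ∧ x (Fin.last (n + 1)) = h s}
      = levelSet n v ψ D := by
  ext x
  constructor
  · rintro ⟨hx, s, hs, e1, e2⟩
    exact ⟨hx, by rw [e2]; exact (hrel s hs).1, by rw [e1, e2]; exact (hrel s hs).2⟩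
  · intro hx
    obtain ⟨s, hs, e⟩ := hsurj x hx
    exact ⟨hx.1, s, hs, by rw [hx.2.2, ← e, (hrel s hs).2], e.symm⟩

/-- If a piece of a hypersurface lies, up to a symmetry of the factor `ℝ`, in an embedded level set,
then it is congruent to an open subset of that set. -/
lemma isCongruentToOpenPiece_levelSet {M : Type*} [TopologicalSpace M]
    [ChartedSpace (EuclideanSpace ℝ (Fin n)) M] [IsManifold 𝓘(ℝ, EuclideanSpace ℝ (Fin n)) ∞ M]
    {f : M → (Fin (n + 2) → ℝ)} (hf : IsHypersurface f)
    {g : (Fin (n + 2) → ℝ) ≃ₗ[ℝ] (Fin (n + 2) → ℝ)} (hg : PreservesHypProd n g)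
    {v : Fin (n + 2) → ℝ} (hvl : v (Fin.last (n + 1)) = 0) {ψ : ℝ → ℝ} {D : Set ℝ}
    (hS : IsEmbeddedHypersurface n (levelSet n v ψ D)) {ε b : ℝ} (hε : ε = 1 ∨ ε = -1)
    (hran : ∀ p, ε * g (f p) (Fin.last (n + 1)) + b ∈ D ∧
      mink (g (f p)) v = ψ (ε * g (f p) (Fin.last (n + 1)) + b)) :
    IsCongruentToOpenPiece n (range f) (levelSet n v ψ D) := by
  obtain ⟨g', hg', hinit, hlast⟩ : ∃ g' : (Fin (n + 2) → ℝ) ≃ₗ[ℝ] (Fin (n + 2) → ℝ),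
      PreservesHypProd n g' ∧ (∀ x, (Fin.init (g' x) : Fin (n + 1) → ℝ) = Fin.init (g x)) ∧
        ∀ x, g' x (Fin.last (n + 1)) = ε * g x (Fin.last (n + 1)) := by
    rcases hε with rfl | rfl
    · exact ⟨g, hg, fun _ => rfl, fun x => (one_mul _).symm⟩
    · obtain ⟨ρ, hρ, h1⟩ := preservesHypProd_vertReflection (n := n)
      exact ⟨g.trans ρ, hg.trans hρ, fun x => (h1 (g x)).1, fun x => by
        rw [LinearEquiv.trans_apply, (h1 (g x)).2]; ring⟩
  have hf' := hf.isometry_comp hg' b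
  refine ⟨fun x => g' x + b • vertVec n, ⟨g', b, hg', fun _ => rfl⟩, ?_⟩
  rw [← range_comp]
  refine isOpenPiece_range hS hf' fun p => ?_
  have h1 : (g' (f p) + b • vertVec n) (Fin.last (n + 1))
      = ε * g (f p) (Fin.last (n + 1)) + b := by
    rw [Pi.add_apply, Pi.smul_apply, vertVec_last, hlast, smul_eq_mul, mul_one]
  have h2 : mink (g' (f p) + b • vertVec n) v = mink (g (f p)) v := by
    rw [mink_add_left, mink_smul_left, mink_comm (vertVec n), mink_vertVec, hvl, mink_init,
      hinit, mink_init (g (f p)), hvl]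
    ring
  change g' (f p) + b • vertVec n ∈ levelSet n v ψ D
  exact ⟨hf'.2.2 p, by rw [h1]; exact (hran p).1, by rw [h1, h2]; exact (hran p).2⟩

end Models

/-! ### The models -/

section ExplicitModels

variable {n : ℕ}

/-- A unit speed planar curve that is, up to reparametrization and symmetry, the graph of a smooth
function `ψ` generates the level set of `ψ`, which is a complete rotation hypersurface if it is
regular and closed. -/
lemma rotation_complete_levelSet (hn : n ≠ 0) (τ : RotationType) {I D : Set ℝ}
    (hI : I.OrdConnected) (hne : (interior I).Nonempty) {p q h p' q' h' y ψ ψ' : ℝ → ℝ}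
    (hp : ContDiff ℝ ∞ p) (hq : ContDiff ℝ ∞ q) (hh : ContDiff ℝ ∞ h)
    (hp' : ∀ s, HasDerivAt p (p' s) s) (hq' : ∀ s, HasDerivAt q (q' s) s)
    (hh' : ∀ s, HasDerivAt h (h' s) s) (hp0 : ∀ s, 0 < p s) (hpq : ∀ s, p s ^ 2 = 1 + q s ^ 2)
    (hunit : ∀ s, -p' s ^ 2 + q' s ^ 2 + h' s ^ 2 = 1) (hq0 : τ = .spherical → ∀ s ∈ I, 0 ≤ q s)
    (hy : ∀ s, mink (planarPoint n (p s) (q s) (h s)) (τ.axisVec n) = y s)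
    (hD : IsOpen D) (hψ : ContDiff ℝ ∞ ψ) (hψ' : ∀ t, HasDerivAt ψ (ψ' t) t)
    (hreg : ∀ x ∈ levelSet n (τ.axisVec n) ψ D,
      mink x (τ.axisVec n) ^ 2 - τ.sign ≠ 0 ∨ ψ' (x (Fin.last (n + 1))) ≠ 0)
    (hcl : IsClosed (levelSet n (τ.axisVec n) ψ D))
    (hrel : ∀ s, h s ∈ D ∧ y s = ψ (h s))
    (hsurj : ∀ x ∈ levelSet n (τ.axisVec n) ψ D, ∃ s ∈ I, h s = x (Fin.last (n + 1))) :
    IsRotationHypersurface n τ (levelSet n (τ.axisVec n) ψ D) ∧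
    IsCompleteHypersurface n (levelSet n (τ.axisVec n) ψ D) ∧
    {x | x ∈ hypProd n ∧ ∃ s, mink x (τ.axisVec n) = y s ∧ x (Fin.last (n + 1)) = h s}
      = levelSet n (τ.axisVec n) ψ D := by
  refine ⟨?_, ?_, ?_⟩
  · rw [← setOf_exists_eq_levelSet (fun s _ => hrel s) hsurj]
    exact isRotationHypersurface_planar hn τ hI hne hp hq hh hp' hq' hh' hp0 hpq hunit hq0 hy
  · refine IsEmbeddedHypersurface.isComplete (isEmbeddedHypersurface_levelSet (axisVec_last hn τ)
      hD hψ.contDiffOn (fun t _ => hψ' t) fun x hx => ?_) hcl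
    rw [mink_axisVec_self hn, ← sub_eq_add_neg]
    exact hreg x hx
  · rw [← setOf_exists_eq_levelSet (I := univ) (fun s _ => hrel s) fun x hx =>
      (hsurj x hx).imp fun s hs => ⟨mem_univ s, hs.2⟩]
    simp

lemma one_le_mink_axisVec_spherical {x : Fin (n + 2) → ℝ} (hx : x ∈ hypProd n) :
    1 ≤ mink x (RotationType.spherical.axisVec n) := by
  rw [mink_axisVec_spherical]
  exact one_le_of_mem_hypProd hx

lemma interior_Ici_nonempty : (interior (Ici (0 : ℝ))).Nonempty := by
  rw [interior_Ici]; exact ⟨1, mem_Ioi.2 one_pos⟩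

/-- The numerical data of the case `-1 < c < 0`. -/
lemma exists_sqrt_neg {c : ℝ} (hc : -1 < c) (hc0 : c < 0) :
    0 < √(-c) ∧ √(-c) ^ 2 = -c ∧ 0 < √(1 + c) ∧ √(1 + c) ^ 2 = 1 + c ∧
      √((c + 1) / -c) = √(1 + c) / √(-c) := by
  refine ⟨Real.sqrt_pos.2 (by linarith), Real.sq_sqrt (by linarith), Real.sqrt_pos.2 (by linarith),
    Real.sq_sqrt (by linarith), ?_⟩
  rw [add_comm c 1, Real.sqrt_div (by linarith)]

lemma sphericalSet_of_neg (hn : n ≠ 0) {c : ℝ} (hc : -1 < c) (hc0 : c < 0) :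
    ∃ δ : ℝ,
    let L := levelSet n (RotationType.spherical.axisVec n)
      (fun t => √((c + 1) / -c) * Real.sinh (t / √((c + 1) / -c) + δ)) univ
    IsRotationHypersurface n .spherical L ∧ IsCompleteHypersurface n L ∧
    sphericalSet n (fun s => Real.arsinh (1 / √(-c) * Real.sinh (√(-c) * s)))
      (fun s => √((c + 1) / -c) *
        Real.log ((Real.cosh (√(-c) * s) + √(-c + Real.sinh (√(-c) * s) ^ 2)) / (1 + √(-c)))) = L := by
  obtain ⟨ha, ha2, hb, hb2, hB⟩ := exists_sqrt_neg hc hc0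
  rw [hB]
  set a := √(-c)
  set b := √(1 + c)
  have hc' : c = -a ^ 2 := by linarith
  have hb2' : b ^ 2 = 1 - a ^ 2 := by rw [hb2, hc']; ring
  set W : ℝ → ℝ := fun s => √(-c + Real.sinh (a * s) ^ 2) with hW
  have hWpos : ∀ s, 0 < -c + Real.sinh (a * s) ^ 2 := fun s => by
    rw [← ha2]; positivity
  have hW0 : ∀ s, 0 < W s := fun s => Real.sqrt_pos.2 (hWpos s)
  have hW2 : ∀ s, W s ^ 2 = a ^ 2 + Real.sinh (a * s) ^ 2 := fun s => by
    rw [hW, Real.sq_sqrt (hWpos s).le, ha2]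
  have hCW : ∀ s, Real.cosh (a * s) ^ 2 = 1 + Real.sinh (a * s) ^ 2 := fun s => by
    rw [Real.cosh_sq]; ring
  have hS : ∀ s, HasDerivAt (fun s => Real.sinh (a * s)) (a * Real.cosh (a * s)) s := fun s => by
    simpa [mul_comm] using ((hasDerivAt_id s).const_mul a).sinh
  have hC : ∀ s, HasDerivAt (fun s => Real.cosh (a * s)) (a * Real.sinh (a * s)) s := fun s => by
    simpa [mul_comm] using ((hasDerivAt_id s).const_mul a).cosh
  have hWd : ∀ s, HasDerivAt W (a * Real.sinh (a * s) * Real.cosh (a * s) / W s) s := fun s => by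
    refine ((((hS s).fun_pow 2).const_add (-c)).sqrt (hWpos s).ne').congr_deriv ?_
    change _ / (2 * W s) = _
    have := (hW0 s).ne'
    field_simp
    norm_num
  have hWc : ContDiff ℝ ∞ W := by
    refine ContDiff.sqrt ?_ fun s => (hWpos s).ne'
    fun_prop
  have hCpos : ∀ s, 0 < Real.cosh (a * s) := fun s => Real.cosh_pos _
  have hCWpos : ∀ s, 0 < Real.cosh (a * s) + W s := fun s => add_pos (hCpos s) (hW0 s)
  set h : ℝ → ℝ := fun s => b / a * Real.log ((Real.cosh (a * s) + W s) / (1 + a)) with hh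
  have hpos : ∀ s, 0 < (Real.cosh (a * s) + W s) / (1 + a) := fun s =>
    div_pos (hCWpos s) (by positivity)
  have hrel : ∀ s, Real.sinh (h s / (b / a) + Real.log ((1 + a) / b)) = W s / b := by
    intro s
    have e1 : h s / (b / a) + Real.log ((1 + a) / b) = Real.log ((Real.cosh (a * s) + W s) / b) := by
      rw [hh, mul_div_cancel_left₀ _ (by positivity), ← Real.log_mul (hpos s).ne' (by positivity)]
      congr 1
      field_simp
    have := hCWpos s
    rw [e1, Real.sinh_log (by positivity)]
    field_simp
    linear_combination -hW2 s + hCW s - hb2'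
  refine ⟨Real.log ((1 + a) / b), ?_⟩
  have key := rotation_complete_levelSet (D := univ) hn .spherical (I := Ici 0) ordConnected_Ici
    interior_Ici_nonempty (p := fun s => W s / a) (q := fun s => 1 / a * Real.sinh (a * s)) (h := h)
    (p' := fun s => Real.sinh (a * s) * Real.cosh (a * s) / W s)
    (q' := fun s => Real.cosh (a * s)) (h' := fun s => b * Real.sinh (a * s) / W s)
    (y := fun s => W s / a)
    (ψ := fun t => b / a * Real.sinh (t / (b / a) + Real.log ((1 + a) / b)))
    (ψ' := fun t => Real.cosh (t / (b / a) + Real.log ((1 + a) / b)))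
    (hWc.div_const a) (by fun_prop)
    (contDiff_const.mul (ContDiff.log (((by fun_prop : ContDiff ℝ ∞ fun s => Real.cosh (a * s)).add
      hWc).div_const _) fun s => (hpos s).ne'))
    (fun s => by
      refine ((hWd s).div_const a).congr_deriv ?_
      field_simp)
    (fun s => by
      refine ((hS s).const_mul (1 / a)).congr_deriv ?_
      field_simp)
    (fun s => by
      refine (((((hC s).fun_add (hWd s)).div_const (1 + a)).log (hpos s).ne').const_mul
        (b / a)).congr_deriv ?_
      have h1 := (hW0 s).ne'
      have h2 := (hCWpos s).ne'
      field_simp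
      ring)
    (fun s => div_pos (hW0 s) ha)
    (fun s => by
      rw [div_pow, hW2, mul_pow]
      field_simp)
    (fun s => by
      have h1 := (hW0 s).ne'
      field_simp
      rw [hW2, hCW, hb2']
      ring)
    (fun _ s hs => mul_nonneg (by positivity) (Real.sinh_nonneg_iff.2 (mul_nonneg ha.le hs)))
    (fun s => by rw [mink_axisVec_spherical, planarPoint_zero hn])
    isOpen_univ (by fun_prop)
    (fun t => by
      refine ((((hasDerivAt_id t).div_const (b / a)).add_const _).sinh.const_mul
        (b / a)).congr_deriv ?_
      simp only [id]
      field_simp)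
    (fun x _ => Or.inr (Real.cosh_pos _).ne')
    (isClosed_levelSet (by fun_prop) isClosed_univ)
    (fun s => ⟨mem_univ _, by rw [hrel]; field_simp⟩)
    (fun x hx => by
      set x₀ := mink x (RotationType.spherical.axisVec n) with hx₀
      have h1 : 1 ≤ x₀ := one_le_mink_axisVec_spherical hx.1
      have h2 : 0 ≤ x₀ ^ 2 - 1 := by nlinarith
      refine ⟨Real.arsinh (a * √(x₀ ^ 2 - 1)) / a,
        div_nonneg (Real.arsinh_nonneg_iff.2 (by positivity)) ha.le, ?_⟩
      have h3 : W (Real.arsinh (a * √(x₀ ^ 2 - 1)) / a) = a * x₀ := by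
        rw [← sq_eq_sq₀ (hW0 _).le (by positivity), hW2, mul_div_cancel₀ _ ha.ne',
          Real.sinh_arsinh, mul_pow, Real.sq_sqrt h2]
        ring
      have h4 := hrel (Real.arsinh (a * √(x₀ ^ 2 - 1)) / a)
      have h5 : x₀ = b / a * Real.sinh (x (Fin.last (n + 1)) / (b / a) + Real.log ((1 + a) / b)) :=
        hx.2.2
      rw [h3, h5] at h4
      have h6 : Real.sinh (h (Real.arsinh (a * √(x₀ ^ 2 - 1)) / a) / (b / a)
          + Real.log ((1 + a) / b))
          = Real.sinh (x (Fin.last (n + 1)) / (b / a) + Real.log ((1 + a) / b)) := by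
        rw [← h5] at h4
        rw [h4, h5]
        field_simp
      exact (div_left_inj' (by positivity)).1 (add_right_cancel (Real.sinh_injective h6)))
  refine ⟨key.1, key.2.1, ?_⟩
  rw [sphericalSet_eq hn, ← key.2.2]
  have : ∀ s, Real.cosh (Real.arsinh (1 / a * Real.sinh (a * s))) = W s / a := by
    intro s
    rw [Real.cosh_arsinh, Real.sqrt_eq_iff_mul_self_eq (by positivity)
      (div_pos (hW0 s) ha).le, ← sq, div_pow, hW2]
    field_simp
  simp only [this, hh, hW]

lemma sphericalSet_of_zero (hn : n ≠ 0) :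
    let L := levelSet n (RotationType.spherical.axisVec n) (fun t => 1 + t) univ
    IsRotationHypersurface n .spherical L ∧ IsCompleteHypersurface n L ∧
    sphericalSet n (fun s => Real.arsinh s) (fun s => -1 + √(1 + s ^ 2)) = L := by
  have hpos : ∀ s : ℝ, 0 < 1 + s ^ 2 := fun s => by positivity
  have hp0 : ∀ s : ℝ, 0 < √(1 + s ^ 2) := fun s => Real.sqrt_pos.2 (hpos s)
  have hp2 : ∀ s : ℝ, √(1 + s ^ 2) ^ 2 = 1 + s ^ 2 := fun s => Real.sq_sqrt (hpos s).le
  have hpc : ContDiff ℝ ∞ fun s : ℝ => √(1 + s ^ 2) := by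
    refine ContDiff.sqrt ?_ fun s => (hpos s).ne'
    fun_prop
  have hpd : ∀ s : ℝ, HasDerivAt (fun s => √(1 + s ^ 2)) (s / √(1 + s ^ 2)) s := fun s => by
    refine ((((hasDerivAt_id s).fun_pow 2).const_add 1).sqrt (hpos s).ne').congr_deriv ?_
    have := (hp0 s).ne'
    simp only [id]
    field_simp
    norm_num
  have key := rotation_complete_levelSet (D := univ) hn .spherical (I := Ici 0) ordConnected_Ici
    interior_Ici_nonempty (p := fun s => √(1 + s ^ 2)) (q := fun s => s)
    (h := fun s => -1 + √(1 + s ^ 2)) (p' := fun s => s / √(1 + s ^ 2))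
    (q' := fun _ => 1) (h' := fun s => s / √(1 + s ^ 2))
    (y := fun s => √(1 + s ^ 2)) (ψ := fun t => 1 + t) (ψ' := fun _ => 1)
    hpc contDiff_id (contDiff_const.add hpc) hpd hasDerivAt_id (fun s => (hpd s).const_add _)
    hp0 hp2 (fun s => by ring) (fun _ s hs => hs)
    (fun s => by rw [mink_axisVec_spherical, planarPoint_zero hn])
    isOpen_univ (by fun_prop) (fun t => (hasDerivAt_id t).const_add 1)
    (fun x _ => Or.inr one_ne_zero) (isClosed_levelSet (by fun_prop) isClosed_univ)
    (fun s => ⟨mem_univ _, by ring⟩)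
    (fun x hx => by
      have h1 := one_le_mink_axisVec_spherical hx.1
      rw [hx.2.2] at h1
      refine ⟨√((1 + x (Fin.last (n + 1))) ^ 2 - 1), Real.sqrt_nonneg _, ?_⟩
      rw [Real.sq_sqrt (by nlinarith), add_sub_cancel, Real.sqrt_sq (by linarith)]
      ring)
  refine ⟨key.1, key.2.1, ?_⟩
  rw [sphericalSet_eq hn, ← key.2.2]
  simp only [Real.cosh_arsinh]

lemma sphericalSet_of_pos (hn : n ≠ 0) {c : ℝ} (hc : 0 < c) :
    let L := levelSet n (RotationType.spherical.axisVec n)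
      (fun t => √((c + 1) / c) * Real.cos (t / √((c + 1) / c)))
      (Ioo (-(√((c + 1) / c) * (Real.pi / 2))) (√((c + 1) / c) * (Real.pi / 2)))
    IsRotationHypersurface n .spherical L ∧ IsCompleteHypersurface n L ∧
    sphericalSet n (fun s => Real.arsinh (1 / √c * Real.sin (√c * s)))
      (fun s => -√((c + 1) / c) *
        Real.arctan (Real.cos (√c * s) / √(c + Real.sin (√c * s) ^ 2))) = L := by
  have ha : 0 < √c := Real.sqrt_pos.2 hc
  have ha2 : √c ^ 2 = c := Real.sq_sqrt hc.le
  have hb : 0 < √(c + 1) := Real.sqrt_pos.2 (by linarith)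
  have hb2 : √(c + 1) ^ 2 = c + 1 := Real.sq_sqrt (by linarith)
  have hB : √((c + 1) / c) = √(c + 1) / √c := Real.sqrt_div (by linarith) _
  rw [hB]
  set a := √c
  set b := √(c + 1)
  have hb2' : b ^ 2 = 1 + a ^ 2 := by rw [hb2, ha2]; ring
  set W : ℝ → ℝ := fun s => √(c + Real.sin (a * s) ^ 2) with hW
  have hWpos : ∀ s, 0 < c + Real.sin (a * s) ^ 2 := fun s => by positivity
  have hW0 : ∀ s, 0 < W s := fun s => Real.sqrt_pos.2 (hWpos s)
  have hW2 : ∀ s, W s ^ 2 = a ^ 2 + Real.sin (a * s) ^ 2 := fun s => by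
    rw [hW, Real.sq_sqrt (hWpos s).le, ha2]
  have hCW : ∀ s, Real.cos (a * s) ^ 2 = 1 - Real.sin (a * s) ^ 2 := fun s => Real.cos_sq' _
  have hS : ∀ s, HasDerivAt (fun s => Real.sin (a * s)) (a * Real.cos (a * s)) s := fun s => by
    simpa [mul_comm] using ((hasDerivAt_id s).const_mul a).sin
  have hC : ∀ s, HasDerivAt (fun s => Real.cos (a * s)) (-(a * Real.sin (a * s))) s := fun s => by
    simpa [mul_comm] using ((hasDerivAt_id s).const_mul a).cos
  have hWd : ∀ s, HasDerivAt W (a * Real.sin (a * s) * Real.cos (a * s) / W s) s := fun s => by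
    refine ((((hS s).fun_pow 2).const_add c).sqrt (hWpos s).ne').congr_deriv ?_
    change _ / (2 * W s) = _
    have := (hW0 s).ne'
    field_simp
    norm_num
    ring
  have hWc : ContDiff ℝ ∞ W := by
    refine ContDiff.sqrt ?_ fun s => (hWpos s).ne'
    fun_prop
  set h : ℝ → ℝ := fun s => -(b / a) * Real.arctan (Real.cos (a * s) / W s) with hh
  have hhB : ∀ s, h s / (b / a) = -Real.arctan (Real.cos (a * s) / W s) := fun s => by
    rw [hh]; field_simp
  have hrel : ∀ s, Real.cos (h s / (b / a)) = W s / b := by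
    intro s
    have h1 : 1 + (Real.cos (a * s) / W s) ^ 2 = (b / W s) ^ 2 := by
      have := (hW0 s).ne'
      rw [div_pow, div_pow]
      field_simp
      rw [hW2, hCW, hb2']
      ring
    rw [hhB, Real.cos_neg, Real.cos_arctan, h1, Real.sqrt_sq (div_pos hb (hW0 s)).le, one_div_div]
  have hB0 : 0 < b / a := by positivity
  have hcl : levelSet n (RotationType.spherical.axisVec n)
        (fun t => b / a * Real.cos (t / (b / a)))
        (Ioo (-(b / a * (Real.pi / 2))) (b / a * (Real.pi / 2)))
      = levelSet n (RotationType.spherical.axisVec n)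
        (fun t => b / a * Real.cos (t / (b / a)))
        (Icc (-(b / a * (Real.pi / 2))) (b / a * (Real.pi / 2))) := by
    ext x
    refine ⟨fun hx => ⟨hx.1, Ioo_subset_Icc_self hx.2.1, hx.2.2⟩, fun hx => ⟨hx.1, ?_, hx.2.2⟩⟩
    have h1 : 1 ≤ b / a * Real.cos (x (Fin.last (n + 1)) / (b / a)) :=
      (one_le_mink_axisVec_spherical hx.1).trans_eq hx.2.2
    -- At the end points of the interval the cosine vanishes.
    have h0 : b / a * Real.cos (Real.pi / 2) = 0 := by rw [Real.cos_pi_div_two, mul_zero]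
    refine ⟨lt_of_le_of_ne hx.2.1.1 fun he => ?_, lt_of_le_of_ne hx.2.1.2 fun he => ?_⟩
    · rw [← he, neg_div, Real.cos_neg, mul_div_cancel_left₀ _ hB0.ne', h0] at h1
      norm_num at h1
    · rw [he, mul_div_cancel_left₀ _ hB0.ne', h0] at h1
      norm_num at h1
  have hIne : (interior (Icc 0 (Real.pi / a))).Nonempty := by
    rw [interior_Icc]
    exact nonempty_Ioo.2 (div_pos Real.pi_pos ha)
  have key := rotation_complete_levelSet (D := Ioo (-(b / a * (Real.pi / 2))) (b / a * (Real.pi / 2)))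
    hn .spherical (I := Icc 0 (Real.pi / a)) ordConnected_Icc
    hIne (p := fun s => W s / a) (q := fun s => 1 / a * Real.sin (a * s)) (h := h)
    (p' := fun s => Real.sin (a * s) * Real.cos (a * s) / W s)
    (q' := fun s => Real.cos (a * s)) (h' := fun s => b * Real.sin (a * s) / W s)
    (y := fun s => W s / a)
    (ψ := fun t => b / a * Real.cos (t / (b / a)))
    (ψ' := fun t => -Real.sin (t / (b / a)))
    (hWc.div_const a) (by fun_prop)
    (contDiff_const.mul (ContDiff.arctan
      ((by fun_prop : ContDiff ℝ ∞ fun s => Real.cos (a * s)).div hWc fun s => (hW0 s).ne')))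
    (fun s => by
      refine ((hWd s).div_const a).congr_deriv ?_
      field_simp)
    (fun s => by
      refine ((hS s).const_mul (1 / a)).congr_deriv ?_
      field_simp)
    (fun s => by
      refine ((((hC s).fun_div (hWd s) (hW0 s).ne').arctan).const_mul
        (-(b / a))).congr_deriv ?_
      have h1 := (hW0 s).ne'
      have h2 : 1 + (Real.cos (a * s) / W s) ^ 2 = b ^ 2 / W s ^ 2 := by
        rw [div_pow]
        field_simp
        rw [hW2, hCW, hb2']
        ring
      rw [h2]
      field_simp
      linear_combination Real.sin (a * s) * (hW2 s + hCW s - hb2'))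
    (fun s => div_pos (hW0 s) ha)
    (fun s => by
      rw [div_pow, hW2, mul_pow]
      field_simp)
    (fun s => by
      have h1 := (hW0 s).ne'
      field_simp
      rw [hW2, hCW, hb2']
      ring)
    (fun _ s hs => mul_nonneg (by positivity) (Real.sin_nonneg_of_nonneg_of_le_pi
      (mul_nonneg ha.le hs.1) (by rw [mul_comm]; exact (le_div_iff₀ ha).1 hs.2)))
    (fun s => by rw [mink_axisVec_spherical, planarPoint_zero hn])
    isOpen_Ioo (by fun_prop)
    (fun t => by
      refine ((((hasDerivAt_id t).div_const (b / a))).cos.const_mul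
        (b / a)).congr_deriv ?_
      simp only [id]
      field_simp)
    (fun x hx => by
      by_cases hs : Real.sin (x (Fin.last (n + 1)) / (b / a)) = 0
      · left
        have h1 := Real.cos_sq' (x (Fin.last (n + 1)) / (b / a))
        rw [hx.2.2, mul_pow, h1, hs, div_pow, hb2', RotationType.sign]
        have : (1 + a ^ 2) / a ^ 2 * (1 - 0 ^ 2) - 1 = 1 / a ^ 2 := by field_simp; ring
        rw [this]
        positivity
      · exact Or.inr (neg_ne_zero.2 hs))
    (by rw [hcl]; exact isClosed_levelSet (by fun_prop) isClosed_Icc)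
    (fun s => by
      refine ⟨?_, by rw [hrel]; field_simp⟩
      have h1 : h s = b / a * (-Real.arctan (Real.cos (a * s) / W s)) := by rw [hh]; ring
      rw [h1, ← mul_neg]
      have h2 := Real.arctan_lt_pi_div_two (Real.cos (a * s) / W s)
      have h3 := Real.neg_pi_div_two_lt_arctan (Real.cos (a * s) / W s)
      exact ⟨mul_lt_mul_of_pos_left (by linarith) hB0,
        mul_lt_mul_of_pos_left (by linarith) hB0⟩)
    (fun x hx => by
      have h1 : 1 ≤ mink x (RotationType.spherical.axisVec n) := one_le_mink_axisVec_spherical hx.1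
      rw [hx.2.2] at h1
      have hD := hx.2.1
      set t := x (Fin.last (n + 1)) with ht
      set θ := t / (b / a) with hθ
      have htθ : t = b / a * θ := by rw [hθ, mul_div_cancel₀ _ hB0.ne']
      rw [htθ, ← mul_neg] at hD
      have hθ1 : -(Real.pi / 2) < θ := lt_of_mul_lt_mul_left hD.1 hB0.le
      have hθ2 : θ < Real.pi / 2 := lt_of_mul_lt_mul_left hD.2 hB0.le
      have hcos : 0 < Real.cos θ := Real.cos_pos_of_mem_Ioo ⟨hθ1, hθ2⟩
      have hu : a ≤ b * Real.cos θ := by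
        have := mul_le_mul_of_nonneg_left h1 ha.le
        have e : a * (b / a * Real.cos θ) = b * Real.cos θ := by field_simp
        rw [e] at this
        linarith
      have hu2 : (b * Real.sin θ) ^ 2 ≤ 1 := by
        have h2 : a ^ 2 ≤ (b * Real.cos θ) ^ 2 := pow_le_pow_left₀ ha.le hu 2
        have h3 := Real.sin_sq_add_cos_sq θ
        have h4 : (b * Real.sin θ) ^ 2 = b ^ 2 - (b * Real.cos θ) ^ 2 := by
          linear_combination b ^ 2 * h3
        rw [h4, hb2']
        linarith
      have habs := abs_le.1 ((sq_le_one_iff_abs_le_one _).1 hu2)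
      refine ⟨Real.arccos (-(b * Real.sin θ)) / a, ⟨div_nonneg (Real.arccos_nonneg _) ha.le,
        div_le_div_of_nonneg_right (Real.arccos_le_pi _) ha.le⟩, ?_⟩
      have e1 : a * (Real.arccos (-(b * Real.sin θ)) / a) = Real.arccos (-(b * Real.sin θ)) :=
        mul_div_cancel₀ _ ha.ne'
      have e2 : Real.cos (a * (Real.arccos (-(b * Real.sin θ)) / a)) = -(b * Real.sin θ) := by
        rw [e1, Real.cos_arccos (by linarith) (by linarith)]
      have e3 : W (Real.arccos (-(b * Real.sin θ)) / a) = b * Real.cos θ := by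
        rw [← sq_eq_sq₀ (hW0 _).le (by positivity), hW2]
        have h3 := hCW (Real.arccos (-(b * Real.sin θ)) / a)
        rw [e2] at h3
        linear_combination h3 - b ^ 2 * Real.sin_sq_add_cos_sq θ - hb2'
      have e4 : Real.cos (a * (Real.arccos (-(b * Real.sin θ)) / a))
          / W (Real.arccos (-(b * Real.sin θ)) / a) = -Real.tan θ := by
        rw [e2, e3, Real.tan_eq_sin_div_cos]
        field_simp
      rw [hh]
      simp only
      rw [e4, Real.arctan_neg, Real.arctan_tan hθ1 hθ2, htθ]
      ring)
  refine ⟨key.1, key.2.1, ?_⟩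
  rw [sphericalSet_eq hn, ← key.2.2]
  have : ∀ s, Real.cosh (Real.arsinh (1 / a * Real.sin (a * s))) = W s / a := by
    intro s
    rw [Real.cosh_arsinh, Real.sqrt_eq_iff_mul_self_eq (by positivity)
      (div_pos (hW0 s) ha).le, ← sq, div_pow, hW2]
    field_simp
  simp only [this, hh, hW]

lemma hyperbolicSet_of_neg (hn : n ≠ 0) {c : ℝ} (hc : -1 < c) (hc0 : c < 0) :
    ∃ δ : ℝ,
    let L := levelSet n (RotationType.hyperbolic.axisVec n)
      (fun t => √((c + 1) / -c) * Real.cosh (t / √((c + 1) / -c) - δ)) univ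
    IsRotationHypersurface n .hyperbolic L ∧ IsCompleteHypersurface n L ∧
    hyperbolicSet n (fun s => Real.arcosh (1 / √(-c) * Real.cosh (√(-c) * s)))
      (fun s => √((c + 1) / -c) *
        Real.log (Real.sinh (√(-c) * s) + √(c + Real.cosh (√(-c) * s) ^ 2))) = L := by
  obtain ⟨ha, ha2, hb, hb2, hB⟩ := exists_sqrt_neg hc hc0
  rw [hB]
  set a := √(-c)
  set b := √(1 + c)
  have hc' : c = -a ^ 2 := by linarith
  have hb2' : b ^ 2 = 1 - a ^ 2 := by rw [hb2, hc']; ring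
  set W : ℝ → ℝ := fun s => √(c + Real.cosh (a * s) ^ 2) with hW
  have hCS : ∀ s, Real.cosh (a * s) ^ 2 = 1 + Real.sinh (a * s) ^ 2 := fun s => by
    rw [Real.cosh_sq]; ring
  have hWb : ∀ s, c + Real.cosh (a * s) ^ 2 = b ^ 2 + Real.sinh (a * s) ^ 2 := fun s => by
    rw [hb2, hCS]; ring
  have hWpos : ∀ s, 0 < c + Real.cosh (a * s) ^ 2 := fun s => by rw [hWb]; positivity
  have hW0 : ∀ s, 0 < W s := fun s => Real.sqrt_pos.2 (hWpos s)
  have hW2 : ∀ s, W s ^ 2 = b ^ 2 + Real.sinh (a * s) ^ 2 := fun s => by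
    rw [hW, Real.sq_sqrt (hWpos s).le, hWb]
  have hS : ∀ s, HasDerivAt (fun s => Real.sinh (a * s)) (a * Real.cosh (a * s)) s := fun s => by
    simpa [mul_comm] using ((hasDerivAt_id s).const_mul a).sinh
  have hC : ∀ s, HasDerivAt (fun s => Real.cosh (a * s)) (a * Real.sinh (a * s)) s := fun s => by
    simpa [mul_comm] using ((hasDerivAt_id s).const_mul a).cosh
  have hWd : ∀ s, HasDerivAt W (a * Real.sinh (a * s) * Real.cosh (a * s) / W s) s := fun s => by
    refine ((((hC s).fun_pow 2).const_add c).sqrt (hWpos s).ne').congr_deriv ?_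
    change _ / (2 * W s) = _
    have := (hW0 s).ne'
    field_simp
    norm_num
    ring
  have hWc : ContDiff ℝ ∞ W := by
    refine ContDiff.sqrt ?_ fun s => (hWpos s).ne'
    fun_prop
  have hSW : ∀ s, 0 < Real.sinh (a * s) + W s := fun s => by
    have h1 : |Real.sinh (a * s)| < W s := by
      apply abs_lt_of_sq_lt_sq _ (hW0 s).le
      rw [hW2]
      linarith [pow_pos hb 2]
    linarith [(abs_lt.1 h1).1]
  set h : ℝ → ℝ := fun s => b / a * Real.log (Real.sinh (a * s) + W s) with hh
  have hhB : ∀ s, h s / (b / a) - Real.log b = Real.log ((Real.sinh (a * s) + W s) / b) := by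
    intro s
    rw [hh, mul_div_cancel_left₀ _ (by positivity), Real.log_div (hSW s).ne' hb.ne']
  have hrel : ∀ s, Real.cosh (h s / (b / a) - Real.log b) = W s / b := by
    intro s
    have := hSW s
    rw [hhB, Real.cosh_log (by positivity)]
    field_simp
    linear_combination -hW2 s
  have hrel' : ∀ s, Real.sinh (h s / (b / a) - Real.log b) = Real.sinh (a * s) / b := by
    intro s
    have := hSW s
    rw [hhB, Real.sinh_log (by positivity)]
    field_simp
    linear_combination hW2 s
  refine ⟨Real.log b, ?_⟩
  have key := rotation_complete_levelSet (D := univ) hn .hyperbolic (I := univ) ordConnected_univ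
    (by simp) (p := fun s => 1 / a * Real.cosh (a * s)) (q := fun s => W s / a) (h := h)
    (p' := fun s => Real.sinh (a * s))
    (q' := fun s => Real.sinh (a * s) * Real.cosh (a * s) / W s)
    (h' := fun s => b * Real.cosh (a * s) / W s) (y := fun s => W s / a)
    (ψ := fun t => b / a * Real.cosh (t / (b / a) - Real.log b))
    (ψ' := fun t => Real.sinh (t / (b / a) - Real.log b))
    (by fun_prop) (hWc.div_const a)
    (contDiff_const.mul (ContDiff.log ((by fun_prop : ContDiff ℝ ∞ fun s => Real.sinh (a * s)).add
      hWc) fun s => (hSW s).ne'))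
    (fun s => by
      refine ((hC s).const_mul (1 / a)).congr_deriv ?_
      field_simp)
    (fun s => by
      refine ((hWd s).div_const a).congr_deriv ?_
      field_simp)
    (fun s => by
      refine ((((hS s).fun_add (hWd s)).log (hSW s).ne').const_mul (b / a)).congr_deriv ?_
      have h1 := (hW0 s).ne'
      have h2 := (hSW s).ne'
      field_simp
      ring)
    (fun s => mul_pos (by positivity) (Real.cosh_pos _))
    (fun s => by
      rw [div_pow, hW2, mul_pow, hCS, hb2']
      field_simp
      ring)
    (fun s => by
      have h1 := (hW0 s).ne'
      field_simp
      rw [hW2, hCS, hb2']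
      ring)
    (fun hτ => by simp at hτ)
    (fun s => by rw [mink_axisVec_hyperbolic hn, planarPoint_castSucc hn])
    isOpen_univ (by fun_prop)
    (fun t => by
      refine ((((hasDerivAt_id t).div_const (b / a)).sub_const _).cosh.const_mul
        (b / a)).congr_deriv ?_
      simp only [id]
      field_simp)
    (fun x _ => Or.inl (by rw [RotationType.sign, sub_neg_eq_add]; positivity))
    (isClosed_levelSet (by fun_prop) isClosed_univ)
    (fun s => ⟨mem_univ _, by rw [hrel]; field_simp⟩)
    (fun x _ => by
      set t := x (Fin.last (n + 1))
      refine ⟨Real.arsinh (b * Real.sinh (t / (b / a) - Real.log b)) / a, mem_univ _, ?_⟩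
      have h1 := hrel' (Real.arsinh (b * Real.sinh (t / (b / a) - Real.log b)) / a)
      rw [mul_div_cancel₀ _ ha.ne', Real.sinh_arsinh, mul_div_cancel_left₀ _ hb.ne'] at h1
      exact (div_left_inj' (by positivity)).1 (sub_left_injective (Real.sinh_injective h1)))
  refine ⟨key.1, key.2.1, ?_⟩
  rw [hyperbolicSet_eq hn, ← key.2.2]
  have ha1 : a ≤ 1 := by nlinarith [pow_pos hb 2]
  have : ∀ s, Real.sinh (Real.arcosh (1 / a * Real.cosh (a * s))) = W s / a := by
    intro s
    have h1 : 1 ≤ 1 / a * Real.cosh (a * s) := by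
      have := Real.one_le_cosh (a * s)
      rw [one_div_mul_eq_div, le_div_iff₀ ha]
      linarith
    rw [Real.sinh_arcosh h1, Real.sqrt_eq_iff_mul_self_eq (by nlinarith)
      (div_pos (hW0 s) ha).le, ← sq, div_pow, hW2, mul_pow, hCS, hb2']
    field_simp
    ring
  simp only [this, hh, hW]

lemma parabolicSet_of_neg (hn : n ≠ 0) {c : ℝ} (hc : -1 < c) (hc0 : c < 0) :
    let L := levelSet n (RotationType.parabolic.axisVec n)
      (fun t => Real.exp (t / √((c + 1) / -c))) univ
    IsRotationHypersurface n .parabolic L ∧ IsCompleteHypersurface n L ∧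
    parabolicSet n (fun s => Real.exp (√(-c) * s)) (fun s => √(1 + c) * s) = L := by
  obtain ⟨ha, ha2, hb, hb2, hB⟩ := exists_sqrt_neg hc hc0
  rw [hB]
  set a := √(-c)
  set b := √(1 + c)
  have h20 : (0 : ℝ) < √2 := by positivity
  have h22 : √2 ^ 2 = (2 : ℝ) := Real.sq_sqrt (by norm_num)
  set k : ℝ → ℝ := fun s => Real.exp (a * s) with hk
  set m : ℝ → ℝ := fun s => Real.exp (-(a * s)) with hm
  have hk0 : ∀ s, 0 < k s := fun s => Real.exp_pos _
  have hm0 : ∀ s, 0 < m s := fun s => Real.exp_pos _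
  have hkm : ∀ s, k s * m s = 1 := fun s => by
    rw [hk, hm, ← Real.exp_add, add_neg_cancel, Real.exp_zero]
  have hkd : ∀ s, HasDerivAt k (a * k s) s := fun s => by
    simpa [hk, mul_comm] using ((hasDerivAt_id s).const_mul a).exp
  have hmd : ∀ s, HasDerivAt m (-(a * m s)) s := fun s => by
    simpa [hm, mul_comm] using ((hasDerivAt_id s).const_mul a).fun_neg.exp
  have hkc : ContDiff ℝ ∞ k := by fun_prop
  have hmc : ContDiff ℝ ∞ m := by fun_prop
  have hhd : ∀ s, HasDerivAt (fun s => b * s) b s := fun s => by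
    simpa using (hasDerivAt_id s).const_mul b
  have key := rotation_complete_levelSet (D := univ) hn .parabolic (I := univ) ordConnected_univ
    (by simp) (p := fun s => (√2 * k s + m s / √2) / 2) (q := fun s => (m s / √2 - √2 * k s) / 2)
    (h := fun s => b * s) (p' := fun s => (√2 * (a * k s) + -(a * m s) / √2) / 2)
    (q' := fun s => (-(a * m s) / √2 - √2 * (a * k s)) / 2) (h' := fun _ => b) (y := k)
    (ψ := fun t => Real.exp (t / (b / a))) (ψ' := fun t => Real.exp (t / (b / a)) * (1 / (b / a)))
    (((contDiff_const.mul hkc).add (hmc.div_const _)).div_const _)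
    (((hmc.div_const _).sub (contDiff_const.mul hkc)).div_const _) (by fun_prop)
    (fun s => (((hkd s).const_mul √2).fun_add ((hmd s).div_const √2)).div_const 2)
    (fun s => (((hmd s).div_const √2).fun_sub ((hkd s).const_mul √2)).div_const 2)
    hhd
    (fun s => by have := hk0 s; have := hm0 s; positivity)
    (fun s => by
      have := hkm s
      field_simp
      linear_combination 4 * √2 ^ 2 * this)
    (fun s => by
      have := hkm s
      field_simp
      rw [hb2]
      linear_combination 4 * √2 ^ 2 * a ^ 2 * this + 4 * √2 ^ 2 * ha2)
    (fun hτ => by simp at hτ)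
    (fun s => by
      rw [mink_axisVec_parabolic hn, planarPoint_zero hn, planarPoint_castSucc hn]
      field_simp
      ring)
    isOpen_univ (by fun_prop)
    (fun t => ((hasDerivAt_id t).div_const (b / a)).exp)
    (fun x _ => Or.inr (by positivity))
    (isClosed_levelSet (by fun_prop) isClosed_univ)
    (fun s => ⟨mem_univ _, by
      rw [hk]
      field_simp⟩)
    (fun x _ => ⟨x (Fin.last (n + 1)) / b, mem_univ _, by field_simp⟩)
  refine ⟨key.1, key.2.1, ?_⟩
  rw [parabolicSet_eq hn _ _ hk0, ← key.2.2]

end ExplicitModels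

/-! ### Classification -/

section Classification

variable {n : ℕ}

lemma IsRotationHypersurface.nonempty {τ : RotationType} {R : Set (Fin (n + 2) → ℝ)}
    (hR : IsRotationHypersurface n τ R) : R.Nonempty := by
  obtain ⟨P2, P3, I, α, -, -, ⟨-, ⟨s, hs⟩, -⟩, rfl⟩ := hR
  exact ⟨α s, LinearEquiv.refl ℝ _, PreservesHypProd.refl, fun _ _ => rfl, s, interior_subset hs,
    rfl⟩

section Profile

variable {τ : RotationType} {R : Set (Fin (n + 2) → ℝ)} {I : Set ℝ} {y H r : ℝ → ℝ}

/-- Closed relations between `y` and the height extend from the interior of the interval. -/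
lemma IsProfileOf.eqOn (h : IsProfileOf τ R I y H r) {F G : ℝ → ℝ}
    (hF : ContinuousOn F I) (hG : ContinuousOn G I) (hFG : ∀ s ∈ interior I, F s = G s) :
    ∀ s ∈ I, F s = G s :=
  EqOn.of_subset_closure (fun s hs => hFG s hs) hF hG interior_subset
    (subset_closure_interior h.ordConnected h.interior_nonempty)

lemma IsProfileOf.eq_apply_height (h : IsProfileOf τ R I y H r) {ψ : ℝ → ℝ} (hψ : Continuous ψ)
    {ε b : ℝ} (hrel : ∀ s ∈ interior I, y s = ψ (ε * H s + b)) :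
    ∀ s ∈ I, y s = ψ (ε * H s + b) :=
  h.eqOn h.contDiffOn_y.continuousOn (hψ.comp_continuousOn
    ((continuousOn_const.mul h.contDiffOn_H.continuousOn).add continuousOn_const)) hrel

end Profile

variable {M : Type*} [TopologicalSpace M] [ChartedSpace (EuclideanSpace ℝ (Fin n)) M]
  [IsManifold 𝓘(ℝ, EuclideanSpace ℝ (Fin n)) ∞ M] {f : M → (Fin (n + 2) → ℝ)}
  {g : (Fin (n + 2) → ℝ) ≃ₗ[ℝ] (Fin (n + 2) → ℝ)} {τ : RotationType} {I : Set ℝ} {y H r : ℝ → ℝ}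

/-- If the profile curve is a piece of the graph of `ψ`, up to a symmetry of the height, then the
hypersurface is a piece of the level set of `ψ`. -/
lemma IsProfileOf.isCongruentToOpenPiece (hn : n ≠ 0)
    (h : IsProfileOf τ (range fun p => g (f p)) I y H r)
    (hf : IsHypersurface f) (hg : PreservesHypProd n g) {ψ : ℝ → ℝ} {D : Set ℝ}
    (hS : IsEmbeddedHypersurface n (levelSet n (τ.axisVec n) ψ D)) {ε b : ℝ} (hε : ε = 1 ∨ ε = -1)
    (hrel : ∀ s ∈ I, ε * H s + b ∈ D ∧ y s = ψ (ε * H s + b)) :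
    IsCongruentToOpenPiece n (range f) (levelSet n (τ.axisVec n) ψ D) := by
  refine isCongruentToOpenPiece_levelSet hf hg (axisVec_last hn τ) hS hε (b := b) fun p => ?_
  have hp : g (f p) ∈ range fun p => g (f p) := ⟨p, rfl⟩
  rw [h.eq_setOf] at hp
  obtain ⟨-, s, hs, e1, e2⟩ := hp
  rw [e1, e2]
  exact hrel s hs

lemma isOpenPiece_hypSlice (hf : IsHypersurface f) {t : ℝ}
    (ht : ∀ p, f p (Fin.last (n + 1)) = t) : IsOpenPiece (range f) (hypSlice n t) := by
  have hS : hypSlice n t = levelSet n 0 (fun h => h - t) univ := by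
    ext x
    simp only [hypSlice, levelSet, mem_ofPred_eq, mem_univ, true_and, mink_zero_right, eq_comm,
      sub_eq_zero]
  rw [hS]
  refine isOpenPiece_range (isEmbeddedHypersurface_levelSet rfl isOpen_univ (by fun_prop)
    (fun h _ => (hasDerivAt_id h).sub_const t) fun x _ => Or.inr one_ne_zero) hf fun p => ?_
  rw [← hS]
  exact ⟨hf.2.2 p, ht p⟩

/-- The cylinder over a horosphere; `a ≠ 0` holds automatically for a nonempty intersection, but it
is what makes the level set regular. -/
lemma exists_isOpenPiece_cylinder (hf : IsHypersurface f) (hne : (range f).Nonempty)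
    {v : Fin (n + 2) → ℝ} (hv0 : v ≠ 0) (hvl : v (Fin.last (n + 1)) = 0) (hvv : mink v v = 0)
    {a : ℝ} (ha : a ≠ 0) (hva : ∀ p, mink (f p) v = a) :
    ∃ H, IsHorosphere n H ∧ IsOpenPiece (range f) (cylinder n H) := by
  have hm : ∀ x : Fin (n + 2) → ℝ, mink x v = mink (Fin.init x : Fin (n + 1) → ℝ) (Fin.init v) := by
    intro x
    rw [mink_init, hvl]; ring
  set H : Set (Fin (n + 1) → ℝ) := {x | x ∈ hypSpace (n + 1) ∧ mink x (Fin.init v) = a} with hH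
  have hcyl : cylinder n H = levelSet n v (fun _ => a) univ := by
    ext x
    simp only [cylinder, hH, levelSet, mem_ofPred_eq, mem_univ, true_and, hm]
    rfl
  obtain ⟨_, p, rfl⟩ := hne
  refine ⟨H, ⟨⟨Fin.init (f p), hf.2.2 p, by rw [← hm, hva]⟩, Fin.init v, a, ?_, ?_, rfl⟩, ?_⟩
  · intro h0
    apply hv0
    ext i
    exact Fin.lastCases hvl (fun i => congrFun h0 i) i
  · rw [← hm, hvv]
  · rw [hcyl]
    refine isOpenPiece_range (isEmbeddedHypersurface_levelSet hvl isOpen_univ contDiffOn_const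
      (fun h _ => hasDerivAt_const h a) fun x hx => Or.inl ?_) hf fun p => ⟨hf.2.2 p, mem_univ _, hva p⟩
    rw [hx.2.2, hvv, add_zero]
    exact pow_ne_zero 2 ha

end Classification

end

theorem theorem4p2 (n : ℕ) (hn : 3 ≤ n) (c : ℝ)
    (M : Type*) [TopologicalSpace M] [T2Space M] [SecondCountableTopology M]
    [ChartedSpace (EuclideanSpace ℝ (Fin n)) M]
    [IsManifold 𝓘(ℝ, EuclideanSpace ℝ (Fin n)) ∞ M]
    (f : M → (Fin (n + 2) → ℝ)) (hf : IsHypersurface f)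
    (hrot : ∃ τ, IsRotationHypersurface n τ (Set.range f))
    (hc : HasConstSectionalCurvature f c) :
    -1 ≤ c ∧
    (c = -1 → ∃ t : ℝ, IsOpenPiece (Set.range f) (hypSlice n t)) ∧
    (-1 < c → c < 0 →
      IsPieceOfCompleteRotation n .spherical (Set.range f)
        (sphericalSet n
          (fun s => Real.arsinh (1 / √(-c) * Real.sinh (√(-c) * s)))
          (fun s => √((c + 1) / -c) *
            Real.log ((Real.cosh (√(-c) * s) + √(-c + Real.sinh (√(-c) * s) ^ 2))
              / (1 + √(-c))))) ∨
      IsPieceOfCompleteRotation n .hyperbolic (Set.range f)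
        (hyperbolicSet n
          (fun s => Real.arcosh (1 / √(-c) * Real.cosh (√(-c) * s)))
          (fun s => √((c + 1) / -c) *
            Real.log (Real.sinh (√(-c) * s) + √(c + Real.cosh (√(-c) * s) ^ 2)))) ∨
      IsPieceOfCompleteRotation n .parabolic (Set.range f)
        (parabolicSet n
          (fun s => Real.exp (√(-c) * s))
          (fun s => √(1 + c) * s))) ∧
    (c = 0 →
      IsPieceOfCompleteRotation n .spherical (Set.range f)
        (sphericalSet n
          (fun s => Real.arsinh s)
          (fun s => -1 + √(1 + s ^ 2))) ∨
      ∃ H, IsHorosphere n H ∧ IsOpenPiece (Set.range f) (cylinder n H)) ∧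
    (0 < c →
      IsPieceOfCompleteRotation n .spherical (Set.range f)
        (sphericalSet n
          (fun s => Real.arsinh (1 / √c * Real.sin (√c * s)))
          (fun s => -√((c + 1) / c) *
            Real.arctan (Real.cos (√c * s) / √(c + Real.sin (√c * s) ^ 2))))) := by
  have hn0 : n ≠ 0 := by omega
  obtain ⟨τ, hR⟩ := hrot
  obtain ⟨g, I, y, H, r, hg, hge, hI, hIne, hyc, hHc, hrc, hr0, hry, hypos, hynn, hunit, hset⟩ :=
    exists_profile hn0 hR
  have hF : IsHypersurface fun p => g (f p) := by
    simpa only [zero_smul, add_zero] using hf.isometry_comp hg 0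
  rw [← range_comp] at hset
  have hP : IsProfileOf τ (range fun p => g (f p)) I y H r :=
    ⟨hI, hIne, hyc, hHc, hrc, hr0, hry, hypos, hynn, hunit, hset⟩
  have hode := hP.ode hn hF (hc.isometry_comp hg.1)
  have hJ : IsOpen (interior I) := isOpen_interior
  have hJ' : IsPreconnected (interior I) := hI.interior.isPreconnected
  have hyJ := hyc.mono (interior_subset (s := I))
  have hHJ := hHc.mono (interior_subset (s := I))
  have hrJ := hrc.mono (interior_subset (s := I))
  have hryJ : ∀ s ∈ interior I, r s ^ 2 = y s ^ 2 - τ.sign := fun s hs =>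
    hry s (interior_subset hs)
  have hlast : ∀ x, g x (Fin.last (n + 1)) = x (Fin.last (n + 1)) := by
    intro x
    have h := hg.1 x (vertVec n)
    rwa [hge, mink_vertVec, mink_vertVec] at h
  have hfp : ∀ p, ∃ s ∈ I, mink (g (f p)) (τ.axisVec n) = y s ∧ f p (Fin.last (n + 1)) = H s := by
    intro p
    have hp : g (f p) ∈ range fun p => g (f p) := ⟨p, rfl⟩
    rw [hP.eq_setOf] at hp
    obtain ⟨-, s, hs, e1, e2⟩ := hp
    exact ⟨s, hs, e1, by rw [← e2, hlast]⟩
  have hsys := fun h1 : -1 < c =>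
    exists_isProfileSystem hJ hJ' hIne h1 hyJ hHJ hrJ hryJ hunit hode
  have hsign : ∀ {ε ε' : ℝ}, (ε = 1 ∨ ε = -1) → (ε' = 1 ∨ ε' = -1) →
      (ε' * ε = 1 ∨ ε' * ε = -1) := by
    rintro ε ε' (rfl | rfl) (rfl | rfl) <;> norm_num
  have hyJpos : τ ≠ .hyperbolic → ∀ s ∈ interior I, 0 < y s := fun h s hs =>
    hypos h s (interior_subset hs)
  refine ⟨?_, ?_, ?_, ?_, ?_⟩
  · obtain ⟨s, hs⟩ := hIne
    exact neg_one_le_of_sq (hode s hs).1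
      (sq_mul_deriv_sq hJ hyJ hrJ hryJ hunit hode s hs).2
  · rintro rfl
    obtain ⟨t, ht⟩ := exists_height_const hJ hJ' hyJ hHJ hrJ hryJ hunit fun s hs => by
      obtain ⟨h1, h2, h3⟩ := hode s hs
      exact ⟨h1, by rw [h2]; ring, by rw [h3]; ring⟩
    have htI := hP.eqOn hHc.continuousOn continuousOn_const ht
    refine ⟨t, isOpenPiece_hypSlice hf fun p => ?_⟩
    obtain ⟨s, hs, -, e⟩ := hfp p
    rw [e, htI s hs]
  · intro h1 h0
    obtain ⟨ε, hε, z, k, hS, -⟩ := hsys h1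
    have hB : 0 < √((c + 1) / -c) := Real.sqrt_pos.2 (div_pos (by linarith) (by linarith))
    have hμ : -c / (1 + c) = (√((c + 1) / -c) ^ 2)⁻¹ := by
      rw [Real.sq_sqrt (div_pos (by linarith) (by linarith)).le, inv_div, add_comm]
    cases τ with
    | spherical =>
      left
      obtain ⟨δ, m1, m2, m3⟩ := sphericalSet_of_neg hn0 h1 h0
      obtain ⟨ε', b, hε', hrel⟩ := IsProfileSystem.exists_sinh hB hμ δ hS
      rw [m3]
      refine ⟨m1, m2, hP.isCongruentToOpenPiece hn0 hf hg m2.1 (hsign hε hε') (b := b)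
        fun s hs => ⟨mem_univ _, ?_⟩⟩
      refine hP.eq_apply_height
        (ψ := fun t => √((c + 1) / -c) * Real.sinh (t / √((c + 1) / -c) + δ))
        (by fun_prop) (fun s hs => ?_) s hs
      rw [hrel s hs, mul_assoc]
    | hyperbolic =>
      right; left
      obtain ⟨δ, m1, m2, m3⟩ := hyperbolicSet_of_neg hn0 h1 h0
      obtain ⟨b, hrel⟩ := IsProfileSystem.exists_cosh hB hμ δ hS (hynn rfl)
      rw [m3]
      refine ⟨m1, m2, hP.isCongruentToOpenPiece hn0 hf hg m2.1 hε (b := b)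
        fun s hs => ⟨mem_univ _, ?_⟩⟩
      exact hP.eq_apply_height
        (ψ := fun t => √((c + 1) / -c) * Real.cosh (t / √((c + 1) / -c) - δ))
        (by fun_prop) hrel s hs
    | parabolic =>
      right; right
      obtain ⟨m1, m2, m3⟩ := parabolicSet_of_neg hn0 h1 h0
      obtain ⟨ε', b, hε', hrel⟩ :=
        IsProfileSystem.exists_expo hB hμ hS (hyJpos (by simp))
      rw [m3]
      refine ⟨m1, m2, hP.isCongruentToOpenPiece hn0 hf hg m2.1 (hsign hε hε') (b := b)
        fun s hs => ⟨mem_univ _, ?_⟩⟩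
      refine hP.eq_apply_height (ψ := fun t => Real.exp (t / √((c + 1) / -c)))
        (by fun_prop) (fun s hs => ?_) s hs
      rw [hrel s hs, mul_assoc]
  · intro h0
    obtain ⟨ε, hε, z, k, hS, -⟩ := hsys (by linarith)
    rw [h0, neg_zero, zero_div] at hS
    obtain ⟨a, b, ha, hrel⟩ := hS.exists_affine
    cases τ with
    | spherical =>
      left
      obtain ⟨m1, m2, m3⟩ := sphericalSet_of_zero hn0
      rw [m3]
      refine ⟨m1, m2, hP.isCongruentToOpenPiece hn0 hf hg m2.1
        (hsign hε (sq_eq_sq_iff_eq_or_eq_neg.1 (ha.trans (one_pow 2).symm))) (b := b - 1) fun s hs => ⟨mem_univ _, ?_⟩⟩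
      refine hP.eq_apply_height (ψ := fun t => 1 + t) (by fun_prop) (fun s hs => ?_) s hs
      rw [hrel s hs]; ring
    | hyperbolic =>
      rw [RotationType.sign] at ha
      nlinarith [sq_nonneg a]
    | parabolic =>
      right
      have ha0 : a = 0 := pow_eq_zero_iff two_ne_zero |>.1 ha
      have hyb : ∀ s ∈ I, y s = b := hP.eqOn hyc.continuousOn continuousOn_const fun s hs => by
        rw [hrel s hs, ha0]; ring
      have hgs : ∀ x, mink x (g.symm (RotationType.parabolic.axisVec n))
          = mink (g x) (RotationType.parabolic.axisVec n) := fun x => by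
        rw [← hg.1, g.apply_symm_apply]
      obtain ⟨s₀, hs₀⟩ := hIne
      refine exists_isOpenPiece_cylinder hf hR.nonempty
        (v := g.symm (RotationType.parabolic.axisVec n)) (a := b) ?_ ?_ ?_ ?_ fun p => ?_
      · exact fun h => axisVec_ne_zero hn0 _ ((LinearEquiv.map_eq_zero_iff _).1 h)
      · rw [← hlast (g.symm _), g.apply_symm_apply, axisVec_last hn0]
      · rw [hgs, g.apply_symm_apply, mink_axisVec_self hn0, RotationType.sign, neg_zero]
      · rw [← hyb s₀ (interior_subset hs₀)]
        exact (hyJpos (by simp) s₀ hs₀).ne'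
      · obtain ⟨s, hs, e, -⟩ := hfp p
        rw [hgs, e, hyb s hs]
  · intro h0
    obtain ⟨ε, hε, z, k, hS, hy0⟩ := hsys (by linarith)
    have hc1 : 0 < (c + 1) / c := div_pos (by linarith) h0
    have hB : 0 < √((c + 1) / c) := Real.sqrt_pos.2 hc1
    have hμ : -c / (1 + c) = -(√((c + 1) / c) ^ 2)⁻¹ := by
      rw [Real.sq_sqrt hc1.le, inv_div, add_comm, neg_div]
    -- The relation `z² = κ + μ y²` with `μ < 0` excludes the types with `κ ≤ 0`.
    have hκ : 0 < τ.sign := by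
      obtain ⟨s, hs⟩ := hIne
      have h1 := hS.z_sq s hs
      have h2 : 0 < y s ^ 2 := by have := hy0 s hs; positivity
      have h3 : 0 < (√((c + 1) / c) ^ 2)⁻¹ := by positivity
      rw [hμ] at h1
      nlinarith [sq_nonneg (z s), mul_pos h3 h2]
    cases τ with
    | spherical =>
      obtain ⟨m1, m2, m3⟩ := sphericalSet_of_pos hn0 h0
      obtain ⟨b, hrel⟩ := IsProfileSystem.exists_cos hB hμ hS (hyJpos (by simp))
      rw [m3]
      have hyI := hP.eq_apply_height (ψ := fun t => √((c + 1) / c) * Real.cos (t / √((c + 1) / c)))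
        (by fun_prop) fun s hs => (hrel s hs).1
      have hmax := hP.eqOn (F := fun s => max |(ε * H s + b) / √((c + 1) / c)| (Real.pi / 2))
        (G := fun _ => Real.pi / 2)
        ((((continuousOn_const.mul hHc.continuousOn).add continuousOn_const).div_const _).abs.sup
          continuousOn_const) continuousOn_const fun s hs => max_eq_right (hrel s hs).2.le
      refine ⟨m1, m2, hP.isCongruentToOpenPiece hn0 hf hg m2.1 hε (b := b)
        fun s hs => ⟨?_, hyI s hs⟩⟩
      have h1 : |(ε * H s + b) / √((c + 1) / c)| ≤ Real.pi / 2 := max_eq_right_iff.1 (hmax s hs)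
      have h2 : |(ε * H s + b) / √((c + 1) / c)| ≠ Real.pi / 2 := by
        intro h
        have h3 := hypos (by simp) s hs
        rw [hyI s hs] at h3
        rw [← Real.cos_abs, h, Real.cos_pi_div_two, mul_zero] at h3
        exact lt_irrefl 0 h3
      have h3 := lt_of_le_of_ne h1 h2
      rw [abs_div, abs_of_pos hB, div_lt_iff₀ hB, mul_comm _ (√((c + 1) / c)), abs_lt] at h3
      exact h3
    | hyperbolic => rw [RotationType.sign] at hκ; norm_num at hκ
    | parabolic => exact absurd hκ (lt_irrefl 0)
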